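/- Let $k$ be a field, with the discrete topology. A *topological vector space* is a $k$-vector space with a complete separated linear topology. **Definitions.** A *topological Lie$^*$ algebra* is a topological vector space $L$ with a continuous Lie bracket $L\times L\to L$ such that the open Lie subalgebras form a base of the topology at $0$. A *topological chiral algebra* is a topological vector space $A$ with a continuous unital associative product such that the open left ideals form a base of the topology at $0$. A *chiral algebra filtration* on $A$ is an increasing sequence $A_0\subset A_1\subset\cdots$ of closed subspaces with dense union $A_\infty$, $1\in A_0$ and $A_iA_j\subset A_{i+j}$; put $A_{-1}=0$ and $\mathrm{gr}_iA=A_i/A_{i-1}$ with the quotient topology. It is *commutative* if the ring $\bigoplus_i\mathrm{gr}_iA$ is commutative, and *admissible* if the completion of $A_\infty$ with respect to the topology formed by all left ideals $I\subset A_\infty$ with every $I\cap A_n$ open in $A_n$ maps isomorphically (as a topological algebra) onto $A$. Let $\widehat{\mathrm{gr}}\,A$ be the completion of $\bigoplus_i\mathrm{gr}_iA$ with respect to the topology with base $\bigoplus_i (P\cap A_i)/(P\cap A_{i-1})$, $P\subset A$ an open subspace. For a topological commutative algebra $R$ whose open ideals form a base, and a topological $R$-module $M$, let $\mathrm{Sym}^!_RM=\varprojlim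 \mathrm{Sym}_{R/J}(M/P)$, over pairs of an open ideal $J\subset R$ and an open submodule $P\subset M$ with $JM\subset P$; write $\mathrm{Sym}^!L=\mathrm{Sym}^!_kL$. For a commutative chiral algebra filtration, with $R=A_0$, the inclusions of $A_0$ and $\mathrm{gr}_1A$ induce a morphism of topological algebras $\mathrm{Sym}^!_R(\mathrm{gr}_1A)\to\widehat{\mathrm{gr}}\,A$, the PBW map; the filtration is a *strong PBW filtration* if it is admissible and the PBW map is an isomorphism of topological algebras. A *topological coisson algebra* is a topological commutative algebra with a continuous Poisson bracket such that the open ideals that are Lie subalgebras form a base of the topology. **Statement.** Let $L$ be a topological Lie$^*$ algebra over $k$. Let $U^{ch}(L)$ be the completion of the universal enveloping algebra $U(L)$ with respect to the topology with base the left ideals $U(L)P$, $P\subset L$ an open vector subspace. It is a topological chiral algebra, and it is the chiral enveloping algebra of $L$: the canonical map $L\to U^{ch}(L)$ is a continuous morphism of Lie algebras, and every continuous morphism of Lie algebras $L\to B$ to a topological chiral $k$-algebra $B$ (with the commutator bracket) extends uniquely to a continuous morphism of unital $k$-algebras $U^{ch}(L)\to B$. Let $U^{ch}(L)_n$ be the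 closure of the image of the $n$-th term of the standard (Poincaré–Birkhoff–Witt) filtration of $U(L)$. This is a commutative chiral algebra filtration, and: 1. $U^{ch}(L)_\cdot$ is a strong PBW filtration; in particular it is admissible. 2. The morphism $\mathrm{Sym}^!L\to\widehat{\mathrm{gr}}\,U^{ch}(L)$ induced by $L\to\mathrm{gr}_1U^{ch}(L)$ is an isomorphism of topological coisson algebras. That is, it is an isomorphism of topological algebras; there is a unique topological coisson structure on $\mathrm{Sym}^!L$ whose bracket extends that of $L$, and a unique one on $\widehat{\mathrm{gr}}\,U^{ch}(L)$ for which the bracket of the classes of $a\in U^{ch}(L)_i$ and $b\in U^{ch}(L)_j$ is the class of $ab-ba$ in $\mathrm{gr}_{i+j-1}U^{ch}(L)$; and the morphism is compatible with these brackets. -/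

import Mathlib

open Topology UniformSpace

noncomputable section

namespace TopAlg

section Bases

variable {T ι : Type*} [Ring T] [Nonempty ι] {B : ι → AddSubgroup T}

/-- The uniform structure of the ring topology in which the subgroups `B i` form a base of
neighbourhoods of zero. -/
@[reducible] def basisUniformSpace (hB : RingSubgroupsBasis B) : UniformSpace T :=
  letI := hB.topology
  haveI := hB.nonarchimedean
  IsTopologicalAddGroup.rightUniformSpace T

theorem basisUniformSpace_toTopologicalSpace (hB : RingSubgroupsBasis B) :
    (basisUniformSpace hB).toTopologicalSpace = hB.topology := rfl

theorem basis_isUniformAddGroup (hB : RingSubgroupsBasis B) :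
    @IsUniformAddGroup T (basisUniformSpace hB) _ := by
  let := hB.topology
  have := hB.nonarchimedean
  exact isUniformAddGroup_of_addCommGroup

theorem basis_isTopologicalRing (hB : RingSubgroupsBasis B) :
    @IsTopologicalRing T (basisUniformSpace hB).toTopologicalSpace _ := by
  let := hB.topology
  have := hB.nonarchimedean
  change IsTopologicalRing T
  infer_instance

theorem basis_hasBasis (hB : RingSubgroupsBasis B) :
    (@nhds T (basisUniformSpace hB).toTopologicalSpace 0).HasBasis (fun _ => True)
      fun i => (B i : Set T) :=
  hB.hasBasis_nhds_zero

/-- A family of left ideals, directed downwards, such that every right multiplication is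
continuous at zero, is a base of a ring topology. -/
theorem leftIdealBasis {T ι : Type*} [Ring T] (B : ι → Ideal T)
    (inter : ∀ i j, ∃ l, B l ≤ B i ⊓ B j)
    (right : ∀ (x : T) (i : ι), ∃ j, ∀ a ∈ B j, a * x ∈ B i) :
    RingSubgroupsBasis fun i => (B i).toAddSubgroup where
  inter i j := by
    obtain ⟨l, hl⟩ := inter i j
    exact ⟨l, fun x hx => hl hx⟩
  mul i := ⟨i, by
    rintro _ ⟨x, -, y, hy, rfl⟩
    exact (B i).mul_mem_left x hy⟩
  leftMul x i := ⟨i, fun y hy => (B i).mul_mem_left x hy⟩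
  rightMul x i := by
    obtain ⟨j, hj⟩ := right x i
    exact ⟨j, fun y hy => hj y hy⟩

theorem leftIdealBasis_isLinearTopology {B : ι → Ideal T}
    (hB : RingSubgroupsBasis fun i => (B i).toAddSubgroup) :
    @IsLinearTopology T T _ _ _ (basisUniformSpace hB).toTopologicalSpace := by
  let := (basisUniformSpace hB).toTopologicalSpace
  exact IsLinearTopology.mk_of_hasBasis' T (S := Ideal T) (s := B) (basis_hasBasis hB)
    (fun s r m hm => s.smul_mem r hm)

/-- Scalars of an algebra act on a topological ring by uniformly continuous maps. -/
theorem uniformContinuousConstSMul_of_algebra (R T : Type*) [CommSemiring R] [Ring T]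
    [Algebra R T] [UniformSpace T] [IsUniformAddGroup T] [IsTopologicalRing T] :
    UniformContinuousConstSMul R T := by
  have : ContinuousConstSMul R T := ⟨fun c => by
    simp only [Algebra.smul_def]
    exact continuous_const_mul _⟩
  exact ⟨fun c => uniformContinuous_of_continuousAt_zero
    (DistribSMul.toAddMonoidHom T c) (continuous_const_smul c).continuousAt⟩

end Bases

/-- A topological chiral algebra: a unital associative algebra with a complete separated linear
topology such that the product is continuous and the open left ideals form a base of the
topology. -/
class IsTopologicalChiralAlgebra (A : Type*) [Ring A] [UniformSpace A] : Prop extends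
  IsUniformAddGroup A, IsTopologicalRing A, CompleteSpace A, T2Space A, IsLinearTopology A A

/-- The completion of a topological ring whose open left ideals form a base is a topological
chiral algebra. -/
theorem isTopologicalChiralAlgebra_completion (T : Type*) [Ring T] [UniformSpace T]
    [IsUniformAddGroup T] [IsTopologicalRing T] [IsLinearTopology T T] :
    IsTopologicalChiralAlgebra (Completion T) where
  toIsUniformAddGroup := inferInstance
  toIsTopologicalRing := inferInstance
  toCompleteSpace := inferInstance
  toT2Space := inferInstance
  toIsLinearTopology := by
    have h := (IsLinearTopology.hasBasis_ideal (R := T)).hasBasis_of_isDenseInducing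
      (Completion.isDenseInducing_coe (α := T))
    rw [Completion.coe_zero] at h
    have key : ∀ I : Ideal T, ∀ r x : Completion T,
        x ∈ closure (((↑) : T → Completion T) '' (I : Set T)) →
        r * x ∈ closure (((↑) : T → Completion T) '' (I : Set T)) := by
      intro I r x hx
      induction r using Completion.induction_on with
      | hp => exact isClosed_closure.preimage (continuous_mul_const x)
      | ih r =>
        refine map_mem_closure (continuous_const_mul (r : Completion T)) hx ?_
        rintro _ ⟨y, hy, rfl⟩
        exact ⟨r * y, I.mul_mem_left r hy, Completion.coe_mul r y⟩
    let s : Ideal T → Ideal (Completion T) := fun I =>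
      { (I.toAddSubgroup.map (Completion.toCompl (α := T))).topologicalClosure with
        smul_mem' := fun r x hx => key I r x hx }
    exact IsLinearTopology.mk_of_hasBasis' (Completion T) (S := Ideal (Completion T)) (s := s) h
      (fun s r m hm => s.smul_mem r hm)

theorem exists_open_leftIdeal {A : Type*} [Ring A] [UniformSpace A]
    [IsTopologicalChiralAlgebra A] {U : Set A} (hU : U ∈ 𝓝 0) :
    ∃ I : Ideal A, IsOpen (I : Set A) ∧ (I : Set A) ⊆ U :=
  (IsLinearTopology.hasBasis_open_ideal (R := A)).mem_iff.1 hU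

section LieStar

variable (k L : Type*) [Field k] [LieRing L] [LieAlgebra k L] [TopologicalSpace L]

/-- The condition on the bracket and the topology of a topological Lie* algebra: the bracket is
continuous and the open Lie subalgebras form a base of the topology. (In particular, the topology
is linear. That the underlying topological vector space is complete and separated is expressed
by Mathlib's classes.) -/
class IsTopologicalLieStarAlgebra : Prop where
  continuous_bracket : Continuous fun p : L × L => ⁅p.1, p.2⁆
  exists_subalgebra : ∀ U ∈ 𝓝 (0 : L),
    ∃ P : LieSubalgebra k L, IsOpen (P : Set L) ∧ (P : Set L) ⊆ U

end LieStar

section Enveloping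

attribute [local instance 100] LieRing.ofAssociativeRing

variable (k L : Type*) [Field k] [LieRing L] [LieAlgebra k L]

/-- The universal enveloping algebra `U(L)`, to be equipped with its left ideal topology. -/
def Env : Type _ := UniversalEnvelopingAlgebra k L

instance : Ring (Env k L) := inferInstanceAs (Ring (UniversalEnvelopingAlgebra k L))
instance : Algebra k (Env k L) := inferInstanceAs (Algebra k (UniversalEnvelopingAlgebra k L))

/-- The canonical map `L → U(L)`. -/
def Env.ι : L →ₗ[k] Env k L :=
  ((UniversalEnvelopingAlgebra.ι k : L →ₗ⁅k⁆ UniversalEnvelopingAlgebra k L) :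
    L →ₗ[k] UniversalEnvelopingAlgebra k L)

variable {k L}

theorem Env.ι_lie (x y : L) :
    Env.ι k L ⁅x, y⁆ = Env.ι k L x * Env.ι k L y - Env.ι k L y * Env.ι k L x :=
  (UniversalEnvelopingAlgebra.ι k : L →ₗ⁅k⁆ UniversalEnvelopingAlgebra k L).map_lie x y

theorem Env.adjoin_range_ι : Algebra.adjoin k (Set.range (Env.ι k L)) = ⊤ := by
  let S : Subalgebra k (UniversalEnvelopingAlgebra k L) :=
    Algebra.adjoin k (Set.range (UniversalEnvelopingAlgebra.ι k))
  have hmem : ∀ x : L, UniversalEnvelopingAlgebra.ι k x ∈ S := fun x =>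
    Algebra.subset_adjoin ⟨x, rfl⟩
  let f : L →ₗ⁅k⁆ S :=
    { toFun := fun x => ⟨UniversalEnvelopingAlgebra.ι k x, hmem x⟩
      map_add' := fun x y => Subtype.ext (map_add _ x y)
      map_smul' := fun c x => Subtype.ext (map_smul _ c x)
      map_lie' := fun {x y} => Subtype.ext (Env.ι_lie x y) }
  have h : S.val.comp (UniversalEnvelopingAlgebra.lift k f) = AlgHom.id k _ := by
    apply UniversalEnvelopingAlgebra.hom_ext
    ext x
    change ((UniversalEnvelopingAlgebra.lift k f (UniversalEnvelopingAlgebra.ι k x) : S) :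
      UniversalEnvelopingAlgebra k L) = UniversalEnvelopingAlgebra.ι k x
    rw [UniversalEnvelopingAlgebra.lift_ι_apply]
    rfl
  refine (eq_top_iff).2 fun x _ => ?_
  have hx : (UniversalEnvelopingAlgebra.lift k f x : UniversalEnvelopingAlgebra k L) = x :=
    DFunLike.congr_fun h x
  change x ∈ S
  rw [← hx]
  exact Subtype.property _

variable (k L)

/-- The left ideal `U(L) P` generated by a subspace `P` of `L`. -/
def Env.leftIdeal (P : Submodule k L) : Ideal (Env k L) := Ideal.span (Env.ι k L '' P)

variable [TopologicalSpace L]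

instance : Nonempty {P : Submodule k L // IsOpen (P : Set L)} := ⟨⟨⊤, isOpen_univ⟩⟩

variable [IsTopologicalLieStarAlgebra k L]

theorem Env.basis : RingSubgroupsBasis fun P : {P : Submodule k L // IsOpen (P : Set L)} =>
    (Env.leftIdeal k L P.1).toAddSubgroup := by
  refine leftIdealBasis (fun P : {P : Submodule k L // IsOpen (P : Set L)} =>
    Env.leftIdeal k L P.1) ?_ ?_
  · intro P Q
    refine ⟨⟨P.1 ⊓ Q.1, P.2.inter Q.2⟩, le_inf ?_ ?_⟩
    · exact Ideal.span_mono (Set.image_mono fun x hx => hx.1)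
    · exact Ideal.span_mono (Set.image_mono fun x hx => hx.2)
  · intro x
    have hx : x ∈ Algebra.adjoin k (Set.range (Env.ι k L)) := by
      rw [Env.adjoin_range_ι]; trivial
    induction hx using Algebra.adjoin_induction with
    | mem x hx =>
      obtain ⟨l, rfl⟩ := hx
      intro P
      have hc : Continuous fun y : L => ⁅y, l⁆ :=
        (IsTopologicalLieStarAlgebra.continuous_bracket (k := k) (L := L)).comp
          (continuous_id.prodMk continuous_const)
      let Q : Submodule k L := P.1 ⊓ P.1.comap (-(LieAlgebra.ad k L l : L →ₗ[k] L))
      have hQ : ∀ y, y ∈ Q ↔ y ∈ P.1 ∧ ⁅y, l⁆ ∈ P.1 := fun y => by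
        have h : -⁅l, y⁆ = ⁅y, l⁆ := lie_skew y l
        simp only [← h]
        rfl
      have hQo : IsOpen (Q : Set L) := by
        have : (Q : Set L) = (P.1 : Set L) ∩ (fun y : L => ⁅y, l⁆) ⁻¹' P.1 :=
          Set.ext fun y => hQ y
        rw [this]
        exact P.2.inter (P.2.preimage hc)
      refine ⟨⟨Q, hQo⟩, fun a ha => ?_⟩
      induction ha using Submodule.span_induction with
      | mem a ha =>
        obtain ⟨y, hy, rfl⟩ := ha
        have hy' := (hQ y).1 hy
        have h1 : Env.ι k L y * Env.ι k L l =
            Env.ι k L l * Env.ι k L y + Env.ι k L ⁅y, l⁆ := by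
          rw [Env.ι_lie]; abel
        rw [h1]
        exact add_mem (Ideal.mul_mem_left _ _ (Ideal.subset_span ⟨y, hy'.1, rfl⟩))
          (Ideal.subset_span ⟨_, hy'.2, rfl⟩)
      | zero => rw [zero_mul]; exact zero_mem _
      | add a b _ _ ha hb => rw [add_mul]; exact add_mem ha hb
      | smul r a _ ha => rw [smul_eq_mul, mul_assoc]; exact Ideal.mul_mem_left _ _ ha
    | algebraMap c =>
      intro P
      refine ⟨P, fun a ha => ?_⟩
      rw [← Algebra.commutes]
      exact Ideal.mul_mem_left _ _ ha
    | add x y _ _ hx hy =>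
      intro P
      obtain ⟨Q, hQ⟩ := hx P
      obtain ⟨Q', hQ'⟩ := hy P
      refine ⟨⟨Q.1 ⊓ Q'.1, Q.2.inter Q'.2⟩, fun a ha => ?_⟩
      rw [mul_add]
      exact add_mem (hQ a (Ideal.span_mono (Set.image_mono fun x hx => hx.1) ha))
        (hQ' a (Ideal.span_mono (Set.image_mono fun x hx => hx.2) ha))
    | mul x y _ _ hx hy =>
      intro P
      obtain ⟨Q, hQ⟩ := hy P
      obtain ⟨Q', hQ'⟩ := hx Q
      exact ⟨Q', fun a ha => by rw [← mul_assoc]; exact hQ _ (hQ' a ha)⟩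

instance : UniformSpace (Env k L) := basisUniformSpace (Env.basis k L)
instance : IsUniformAddGroup (Env k L) := basis_isUniformAddGroup (Env.basis k L)
instance : IsTopologicalRing (Env k L) := basis_isTopologicalRing (Env.basis k L)
instance : IsLinearTopology (Env k L) (Env k L) := leftIdealBasis_isLinearTopology (Env.basis k L)
instance : UniformContinuousConstSMul k (Env k L) := uniformContinuousConstSMul_of_algebra _ _

/-- The chiral enveloping algebra of a topological Lie* algebra `L`: the completion of `U(L)` with
respect to the topology with base the left ideals `U(L) P`, for `P` an open subspace of `L`. -/
abbrev ChiralEnv : Type _ := Completion (Env k L)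

instance : IsTopologicalChiralAlgebra (ChiralEnv k L) := isTopologicalChiralAlgebra_completion _

/-- The canonical map `L → U^ch(L)`. -/
def ChiralEnv.ι : L →ₗ[k] ChiralEnv k L where
  toFun x := (Env.ι k L x : Completion (Env k L))
  map_add' x y := by rw [map_add, Completion.coe_add]
  map_smul' c x := by rw [map_smul, Completion.coe_smul]; rfl


end Enveloping

section Sym

variable (R M : Type*) [CommRing R] [AddCommGroup M] [Module R M]

/-- The symmetric algebra `Sym_R M`, to be equipped with its `!`-topology. -/
def SymAlg := SymmetricAlgebra R M

instance : CommRing (SymAlg R M) := inferInstanceAs (CommRing (SymmetricAlgebra R M))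
instance : Algebra R (SymAlg R M) := inferInstanceAs (Algebra R (SymmetricAlgebra R M))

/-- The canonical map `M → Sym_R M`. -/
def SymAlg.ι : M →ₗ[R] SymAlg R M := SymmetricAlgebra.ι R M

/-- The ideal of `Sym_R M` generated by `J ⊆ R` and `P ⊆ M`; when `J M ⊆ P`, this is the kernel of
`Sym_R M → Sym_{R/J} (M/P)`. -/
def SymAlg.ideal (J : Ideal R) (P : Submodule R M) : Ideal (SymAlg R M) :=
  Ideal.span (algebraMap R (SymAlg R M) '' J ∪ SymAlg.ι R M '' P)

variable [TopologicalSpace R] [TopologicalSpace M]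

/-- The pairs `(J, P)` of an open ideal `J` of `R` and an open submodule `P` of `M` such that
`J M ⊆ P`. -/
def OpenPair := {p : Ideal R × Submodule R M //
  IsOpen (p.1 : Set R) ∧ IsOpen (p.2 : Set M) ∧ ∀ r ∈ p.1, ∀ m : M, r • m ∈ p.2}

instance : Nonempty (OpenPair R M) :=
  ⟨⟨(⊤, ⊤), isOpen_univ, isOpen_univ, fun _ _ _ => trivial⟩⟩

theorem SymAlg.basis : RingSubgroupsBasis fun p : OpenPair R M =>
    (SymAlg.ideal R M p.1.1 p.1.2).toAddSubgroup := by
  refine leftIdealBasis (fun p : OpenPair R M => SymAlg.ideal R M p.1.1 p.1.2) ?_ ?_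
  · intro p q
    refine ⟨⟨(p.1.1 ⊓ q.1.1, p.1.2 ⊓ q.1.2), p.2.1.inter q.2.1, p.2.2.1.inter q.2.2.1,
      fun r hr m => ⟨p.2.2.2 r hr.1 m, q.2.2.2 r hr.2 m⟩⟩, le_inf ?_ ?_⟩
    · exact Ideal.span_mono (Set.union_subset_union (Set.image_mono fun x hx => hx.1)
        (Set.image_mono fun x hx => hx.1))
    · exact Ideal.span_mono (Set.union_subset_union (Set.image_mono fun x hx => hx.2)
        (Set.image_mono fun x hx => hx.2))
  · exact fun x p => ⟨p, fun a ha => Ideal.mul_mem_right _ _ ha⟩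

instance : UniformSpace (SymAlg R M) := basisUniformSpace (SymAlg.basis R M)
instance : IsUniformAddGroup (SymAlg R M) := basis_isUniformAddGroup (SymAlg.basis R M)
instance : IsTopologicalRing (SymAlg R M) := basis_isTopologicalRing (SymAlg.basis R M)
instance : IsLinearTopology (SymAlg R M) (SymAlg R M) :=
  leftIdealBasis_isLinearTopology (SymAlg.basis R M)
instance : UniformContinuousConstSMul R (SymAlg R M) := uniformContinuousConstSMul_of_algebra _ _

/-- The topological algebra `Sym^!_R M = lim Sym_{R/J} (M/P)`, the limit being taken over the pairs
`(J, P)` of an open ideal `J` and an open submodule `P ⊇ J M`: the completion of `Sym_R M` with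
respect to the topology with base the kernels of the maps `Sym_R M → Sym_{R/J} (M/P)`. -/
abbrev SymShriek := Completion (SymAlg R M)

instance : IsTopologicalChiralAlgebra (SymShriek R M) := isTopologicalChiralAlgebra_completion _

/-- The canonical map `M → Sym^!_R M`. -/
def SymShriek.ι (m : M) : SymShriek R M := (SymAlg.ι R M m : SymAlg R M)

variable {R M} {B : Type*} [CommRing B] [UniformSpace B] [IsTopologicalChiralAlgebra B]
  [Algebra R B]

/-- The universal property of the symmetric algebra. -/
def SymAlg.lift {R M B : Type*} [CommRing R] [AddCommGroup M] [Module R M] [CommRing B]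
    [Algebra R B] (f : M →ₗ[R] B) : SymAlg R M →ₐ[R] B :=
  (SymmetricAlgebra.lift f : SymmetricAlgebra R M →ₐ[R] B)

theorem SymAlg.continuous_lift (hR : Continuous (algebraMap R B)) (f : M →ₗ[R] B)
    (hf : Continuous f) :
    Continuous (SymAlg.lift f) := by
  let g : SymAlg R M →ₐ[R] B := SymAlg.lift f
  refine continuous_of_continuousAt_zero g ?_
  rw [ContinuousAt, map_zero]
  intro U hU
  obtain ⟨I, hI, hIU⟩ := (IsLinearTopology.hasBasis_open_ideal (R := B)).mem_iff.1 hU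
  let J : Ideal R := I.comap (algebraMap R B)
  let P : Submodule R M := (I.restrictScalars R).comap f
  have hJP : ∀ r ∈ J, ∀ m : M, r • m ∈ P := by
    intro r hr m
    change f (r • m) ∈ I
    rw [map_smul, Algebra.smul_def]
    exact I.mul_mem_right _ hr
  have hle : SymAlg.ideal R M J P ≤ I.comap g := by
    refine Ideal.span_le.2 ?_
    rintro _ (⟨r, hr, rfl⟩ | ⟨m, hm, rfl⟩)
    · change g (algebraMap R (SymAlg R M) r) ∈ I
      rw [g.commutes]
      exact hr
    · change g (SymAlg.ι R M m) ∈ I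
      have : g (SymAlg.ι R M m) = f m := SymmetricAlgebra.lift_ι_apply f m
      rw [this]
      exact hm
  refine Filter.mem_map.2 (Filter.mem_of_superset ((basis_hasBasis (SymAlg.basis R M)).mem_of_mem
    (i := ⟨(J, P), hI.preimage hR, hI.preimage hf, hJP⟩) trivial) ?_)
  exact fun x hx => hIU (hle hx)

/-- The universal property of `Sym^!_R M`: a continuous `R`-linear map from `M` to a topological
commutative`^!` `R`-algebra `B` extends to a morphism `Sym^!_R M → B`. -/
def SymShriek.lift (hR : Continuous (algebraMap R B)) (f : M →ₗ[R] B) (hf : Continuous f) :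
    SymShriek R M →ₐ[R] B :=
  let g : SymAlg R M →ₐ[R] B := SymAlg.lift f
  { Completion.extensionHom (g : SymAlg R M →+* B) (SymAlg.continuous_lift hR f hf) with
    commutes' := fun r => (Completion.extensionHom_coe (g : SymAlg R M →+* B)
      (SymAlg.continuous_lift hR f hf) _).trans (g.commutes r) }

theorem SymShriek.continuous_lift (hR : Continuous (algebraMap R B)) (f : M →ₗ[R] B)
    (hf : Continuous f) : Continuous (SymShriek.lift hR f hf) :=
  Completion.continuous_extension

theorem SymShriek.lift_ι (hR : Continuous (algebraMap R B)) (f : M →ₗ[R] B)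
    (hf : Continuous f) (m : M) : SymShriek.lift hR f hf (SymShriek.ι R M m) = f m :=
  (Completion.extensionHom_coe _ (SymAlg.continuous_lift hR f hf) _).trans
    (SymmetricAlgebra.lift_ι_apply f m)

end Sym

section Filtration

/-- A chiral algebra filtration: an increasing filtration by closed subspaces with dense union,
compatible with the product and the unit. -/
structure ChiralFiltration (k A : Type*) [Field k] [Ring A] [Algebra k A] [UniformSpace A] where
  fil : ℕ → Submodule k A
  mono : Monotone fil
  isClosed : ∀ n, IsClosed (fil n : Set A)
  dense : Dense (⋃ n, (fil n : Set A))
  one_mem : 1 ∈ fil 0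
  mul_mem : ∀ {i j : ℕ} {a b : A}, a ∈ fil i → b ∈ fil j → a * b ∈ fil (i + j)

namespace ChiralFiltration

variable {k A : Type*} [Field k] [Ring A] [Algebra k A] [UniformSpace A]
  (F : ChiralFiltration k A)

/-- The subalgebra `A_0`. -/
def zeroPart : Subalgebra k A where
  carrier := F.fil 0
  mul_mem' ha hb := F.mul_mem ha hb
  add_mem' ha hb := (F.fil 0).add_mem ha hb
  algebraMap_mem' c := by
    rw [Algebra.algebraMap_eq_smul_one]
    exact (F.fil 0).smul_mem c F.one_mem

/-- The subalgebra `A_∞`, the union of all `A_n`. -/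
def inftyPart : Subalgebra k A where
  carrier := ⋃ n, (F.fil n : Set A)
  mul_mem' {a b} ha hb := by
    obtain ⟨i, hi⟩ := Set.mem_iUnion.1 ha
    obtain ⟨j, hj⟩ := Set.mem_iUnion.1 hb
    exact Set.mem_iUnion.2 ⟨i + j, F.mul_mem hi hj⟩
  add_mem' {a b} ha hb := by
    obtain ⟨i, hi⟩ := Set.mem_iUnion.1 ha
    obtain ⟨j, hj⟩ := Set.mem_iUnion.1 hb
    exact Set.mem_iUnion.2 ⟨max i j, add_mem (F.mono (le_max_left i j) hi)
      (F.mono (le_max_right i j) hj)⟩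
  algebraMap_mem' c := Set.mem_iUnion.2 ⟨0, F.zeroPart.algebraMap_mem c⟩

/-- `A_{n-1}`, with `A_{-1} = 0`. -/
def prev : ℕ → Submodule k A
  | 0 => ⊥
  | n + 1 => F.fil n

theorem prev_le (n : ℕ) : F.prev n ≤ F.fil n := by
  cases n with
  | zero => exact bot_le
  | succ n => exact F.mono n.le_succ

theorem mul_mem_prev_left {i j : ℕ} {a b : A} (ha : a ∈ F.prev i) (hb : b ∈ F.fil j) :
    a * b ∈ F.prev (i + j) := by
  cases i with
  | zero =>
    have : a = 0 := ha
    rw [this, zero_mul]; exact zero_mem _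
  | succ i =>
    rw [Nat.succ_add]
    exact F.mul_mem (i := i) ha hb

theorem mul_mem_prev_right {i j : ℕ} {a b : A} (ha : a ∈ F.fil i) (hb : b ∈ F.prev j) :
    a * b ∈ F.prev (i + j) := by
  cases j with
  | zero =>
    have : b = 0 := hb
    rw [this, mul_zero]; exact zero_mem _
  | succ j => exact F.mul_mem (i := i) (j := j) ha hb

/-- `A_n` as a left `A_0`-module. -/
def filMod (n : ℕ) : Submodule F.zeroPart A where
  carrier := F.fil n
  add_mem' ha hb := (F.fil n).add_mem ha hb
  zero_mem' := (F.fil n).zero_mem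
  smul_mem' r a ha := by
    have := F.mul_mem (i := 0) (j := n) r.2 ha
    rwa [zero_add] at this

/-- `A_{n-1}` as a left `A_0`-module. -/
def prevMod (n : ℕ) : Submodule F.zeroPart A where
  carrier := F.prev n
  add_mem' ha hb := (F.prev n).add_mem ha hb
  zero_mem' := (F.prev n).zero_mem
  smul_mem' r a ha := by
    have := F.mul_mem_prev_right (i := 0) (j := n) r.2 ha
    rwa [zero_add] at this

/-- The component `gr_n A = A_n / A_{n-1}`: a left `A_0`-module, with the quotient topology. -/
def gr (n : ℕ) := F.filMod n ⧸ (F.prevMod n).submoduleOf (F.filMod n)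

instance (n : ℕ) : AddCommGroup (F.gr n) :=
  inferInstanceAs (AddCommGroup (F.filMod n ⧸ (F.prevMod n).submoduleOf (F.filMod n)))

instance (n : ℕ) : Module F.zeroPart (F.gr n) :=
  inferInstanceAs (Module F.zeroPart (F.filMod n ⧸ (F.prevMod n).submoduleOf (F.filMod n)))

instance (n : ℕ) : TopologicalSpace (F.gr n) :=
  inferInstanceAs (TopologicalSpace (F.filMod n ⧸ (F.prevMod n).submoduleOf (F.filMod n)))

/-- The class in `gr_n A` of an element of `A_n`. -/
def cls (n : ℕ) (a : A) (ha : a ∈ F.fil n) : F.gr n :=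
  Submodule.Quotient.mk (p := (F.prevMod n).submoduleOf (F.filMod n)) ⟨a, ha⟩

theorem cls_eq {n : ℕ} {a b : A} {ha : a ∈ F.fil n} {hb : b ∈ F.fil n} :
    F.cls n a ha = F.cls n b hb ↔ a - b ∈ F.prev n :=
  Submodule.Quotient.eq _

theorem exists_cls {n : ℕ} (x : F.gr n) : ∃ a ha, x = F.cls n a ha := by
  obtain ⟨⟨a, ha⟩, rfl⟩ := Submodule.Quotient.mk_surjective _ x
  exact ⟨a, ha, rfl⟩

theorem cls_add {n : ℕ} {a b : A} (ha : a ∈ F.fil n) (hb : b ∈ F.fil n) :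
    F.cls n a ha + F.cls n b hb = F.cls n (a + b) (add_mem ha hb) := rfl

theorem cls_smul {n : ℕ} {a : A} (r : F.zeroPart) (ha : a ∈ F.fil n) :
    r • F.cls n a ha = F.cls n (r * a) ((F.filMod n).smul_mem r ha) := rfl

theorem cls_zero (n : ℕ) : F.cls n 0 (zero_mem _) = 0 := rfl

/-- The product `gr_i A × gr_j A → gr_{i+j} A`. -/
def grMul {i j : ℕ} (x : F.gr i) (y : F.gr j) : F.gr (i + j) :=
  Quotient.liftOn₂' x y (fun a b => F.cls (i + j) (a * b) (F.mul_mem a.2 b.2)) (by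
    intro a b a' b' h h'
    have h1 : (a : A) - a' ∈ F.prev i := (Submodule.quotientRel_def ((F.prevMod _).submoduleOf (F.filMod _))).1 h
    have h2 : (b : A) - b' ∈ F.prev j := (Submodule.quotientRel_def ((F.prevMod _).submoduleOf (F.filMod _))).1 h'
    refine F.cls_eq.2 ?_
    have : (a : A) * b - a' * b' = (a - a') * b + a' * (b - b') := by noncomm_ring
    rw [this]
    exact add_mem (F.mul_mem_prev_left h1 b.2) (F.mul_mem_prev_right a'.2 h2))

theorem grMul_cls {i j : ℕ} {a b : A} (ha : a ∈ F.fil i) (hb : b ∈ F.fil j) :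
    F.grMul (F.cls i a ha) (F.cls j b hb) = F.cls (i + j) (a * b) (F.mul_mem ha hb) := rfl

theorem sigma_cls_eq {i j : ℕ} (h : i = j) {a b : A} (hab : a = b) (ha : a ∈ F.fil i)
    (hb : b ∈ F.fil j) : (⟨i, F.cls i a ha⟩ : GradedMonoid F.gr) = ⟨j, F.cls j b hb⟩ := by
  subst h; subst hab; rfl

theorem natCast_mem (n : ℕ) : (n : A) ∈ F.fil 0 := _root_.natCast_mem F.zeroPart n
theorem intCast_mem (n : ℤ) : (n : A) ∈ F.fil 0 := _root_.intCast_mem F.zeroPart n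

instance : GradedMonoid.GMul F.gr := ⟨F.grMul⟩

instance : GradedMonoid.GOne F.gr := ⟨F.cls 0 1 F.one_mem⟩

instance : GradedMonoid.GMonoid F.gr where
  one_mul := by
    rintro ⟨i, x⟩
    obtain ⟨a, ha, rfl⟩ := F.exists_cls x
    exact F.sigma_cls_eq (zero_add i) (one_mul a) _ _
  mul_one := by
    rintro ⟨i, x⟩
    obtain ⟨a, ha, rfl⟩ := F.exists_cls x
    exact F.sigma_cls_eq (add_zero i) (mul_one a) _ _
  mul_assoc := by
    rintro ⟨i, x⟩ ⟨j, y⟩ ⟨l, z⟩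
    obtain ⟨a, ha, rfl⟩ := F.exists_cls x
    obtain ⟨b, hb, rfl⟩ := F.exists_cls y
    obtain ⟨c, hc, rfl⟩ := F.exists_cls z
    exact F.sigma_cls_eq (add_assoc i j l) (mul_assoc a b c) _ _

instance : DirectSum.GRing F.gr where
  __ := (inferInstance : GradedMonoid.GMonoid F.gr)
  mul_zero {i j} x := by
    obtain ⟨a, ha, rfl⟩ := F.exists_cls x
    exact F.cls_eq.2 (by simp)
  zero_mul {i j} x := by
    obtain ⟨a, ha, rfl⟩ := F.exists_cls x
    exact F.cls_eq.2 (by simp)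
  mul_add {i j} x y z := by
    obtain ⟨a, ha, rfl⟩ := F.exists_cls x
    obtain ⟨b, hb, rfl⟩ := F.exists_cls y
    obtain ⟨c, hc, rfl⟩ := F.exists_cls z
    exact F.cls_eq.2 (by simp [mul_add])
  add_mul {i j} x y z := by
    obtain ⟨a, ha, rfl⟩ := F.exists_cls x
    obtain ⟨b, hb, rfl⟩ := F.exists_cls y
    obtain ⟨c, hc, rfl⟩ := F.exists_cls z
    exact F.cls_eq.2 (by simp [add_mul])
  natCast n := F.cls 0 n (F.natCast_mem n)
  natCast_zero := F.cls_eq.2 (by simp)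
  natCast_succ n := F.cls_eq.2 (by simp)
  intCast n := F.cls 0 n (F.intCast_mem n)
  intCast_ofNat n := F.cls_eq.2 (by simp)
  intCast_negSucc_ofNat n := F.cls_eq.2 (by simp)

/-- The associated graded ring `⊕ gr_n A`. -/
def Gr := DirectSum ℕ F.gr

instance : Ring F.Gr := inferInstanceAs (Ring (DirectSum ℕ F.gr))

/-- The inclusion of the component `gr_n A`. -/
def of (n : ℕ) : F.gr n →+ F.Gr := DirectSum.of F.gr n

theorem of_cls_mul {i j : ℕ} {a b : A} (ha : a ∈ F.fil i) (hb : b ∈ F.fil j) :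
    F.of i (F.cls i a ha) * F.of j (F.cls j b hb) =
      F.of (i + j) (F.cls (i + j) (a * b) (F.mul_mem ha hb)) :=
  DirectSum.of_mul_of _ _

theorem of_congr {i j : ℕ} (h : i = j) {a b : A} (hab : a = b) (ha : a ∈ F.fil i)
    (hb : b ∈ F.fil j) : F.of i (F.cls i a ha) = F.of j (F.cls j b hb) := by
  subst h; subst hab; rfl

theorem Gr.induction {p : F.Gr → Prop} (x : F.Gr) (zero : p 0)
    (of : ∀ (n : ℕ) (a : A) (ha : a ∈ F.fil n), p (F.of n (F.cls n a ha)))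
    (add : ∀ x y, p x → p y → p (x + y)) : p x := by
  induction x using DirectSum.induction_on with
  | zero => exact zero
  | of n x =>
    obtain ⟨a, ha, rfl⟩ := F.exists_cls x
    exact of n a ha
  | add x y hx hy => exact add x y hx hy

/-- The ring homomorphism `A_0 → ⊕ gr_n A`. -/
def zeroHom : F.zeroPart →+* F.Gr where
  toFun r := F.of 0 (F.cls 0 r r.2)
  map_one' := rfl
  map_mul' r s := (F.of_cls_mul r.2 s.2).symm
  map_zero' := (F.of 0).map_zero
  map_add' r s := (F.of 0).map_add (F.cls 0 r r.2) (F.cls 0 s s.2)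

instance : Algebra k F.Gr :=
  (F.zeroHom.comp (algebraMap k F.zeroPart)).toAlgebra' (by
    intro c x
    induction x using Gr.induction with
    | zero => simp
    | of n a ha =>
      refine (F.of_cls_mul (F.zeroPart.algebraMap_mem c) ha).trans
        (Eq.trans ?_ (F.of_cls_mul ha (F.zeroPart.algebraMap_mem c)).symm)
      exact F.of_congr ((zero_add n).trans (add_zero n).symm) (Algebra.commutes c a) _ _
    | add x y hx hy => rw [mul_add, add_mul, hx, hy])


/-- The graded ring is commutative. -/
class IsCommutative : Prop where
  mul_comm : ∀ x y : F.Gr, x * y = y * x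

/-- The component in `gr_n A` of an element of the associated graded ring. -/
def comp (x : F.Gr) (n : ℕ) : F.gr n := DFunLike.coe (F := DirectSum ℕ F.gr) x n

/-- The subgroup `⊕ (P ∩ A_n) / (P ∩ A_{n-1})` of `⊕ gr_n A`. -/
def grSub (P : Submodule k A) : AddSubgroup F.Gr where
  carrier := {x | ∀ n, ∃ (a : A) (ha : a ∈ F.fil n), a ∈ P ∧
    F.comp x n = F.cls n a ha}
  zero_mem' n := ⟨0, zero_mem _, zero_mem _, rfl⟩
  add_mem' {x y} hx hy n := by
    obtain ⟨a, ha, haP, hxa⟩ := hx n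
    obtain ⟨b, hb, hbP, hyb⟩ := hy n
    refine ⟨a + b, add_mem ha hb, add_mem haP hbP, ?_⟩
    rw [← F.cls_add ha hb, ← hxa, ← hyb]
    exact DFinsupp.add_apply _ _ _
  neg_mem' {x} hx n := by
    obtain ⟨a, ha, haP, hxa⟩ := hx n
    refine ⟨-a, neg_mem ha, neg_mem haP, ?_⟩
    change -(F.comp x n) = _
    rw [hxa]; rfl

theorem grSub_mono {P Q : Submodule k A} (h : P ≤ Q) : F.grSub P ≤ F.grSub Q := by
  intro x hx n
  obtain ⟨a, ha, haP, hxa⟩ := hx n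
  exact ⟨a, ha, h haP, hxa⟩

theorem of_mem_grSub {P : Submodule k A} {n : ℕ} {a : A} (ha : a ∈ F.fil n) (haP : a ∈ P) :
    F.of n (F.cls n a ha) ∈ F.grSub P := by
  intro m
  by_cases h : n = m
  · subst h
    exact ⟨a, ha, haP, DirectSum.of_eq_same _ _⟩
  · exact ⟨0, zero_mem _, zero_mem _, DirectSum.of_eq_of_ne n m _ (Ne.symm h)⟩

theorem grSub_induction {P : Submodule k A} {p : F.Gr → Prop} {x : F.Gr} (hx : x ∈ F.grSub P)
    (zero : p 0)
    (of : ∀ (n : ℕ) (a : A) (ha : a ∈ F.fil n), a ∈ P → p (F.of n (F.cls n a ha)))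
    (add : ∀ x y, p x → p y → p (x + y)) : p x := by
  classical
  have hsum : x = ∑ n ∈ DFinsupp.support (x : DirectSum ℕ F.gr),
      F.of n (F.comp x n) :=
    (DirectSum.sum_support_of (x : DirectSum ℕ F.gr)).symm
  rw [hsum]
  refine Finset.sum_induction _ p add zero fun n _ => ?_
  obtain ⟨a, ha, haP, h⟩ := hx n
  rw [h]
  exact of n a ha haP

theorem mul_mem_grSub {P : Submodule k A} (hP : ∀ a b : A, b ∈ P → a * b ∈ P) (x : F.Gr) {y : F.Gr}
    (hy : y ∈ F.grSub P) : x * y ∈ F.grSub P := by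
  refine F.grSub_induction (p := fun y => x * y ∈ F.grSub P) hy ?_ ?_ ?_
  · rw [mul_zero]; exact zero_mem _
  · intro n b hb hbP
    induction x using Gr.induction with
    | zero => rw [zero_mul]; exact zero_mem _
    | of m a ha =>
      rw [F.of_cls_mul]
      exact F.of_mem_grSub _ (hP a b hbP)
    | add x y hx hy => rw [add_mul]; exact add_mem hx hy
  · intro y z hy hz
    rw [mul_add]; exact add_mem hy hz

instance : Nonempty {P : Submodule k A // IsOpen (P : Set A)} := ⟨⟨⊤, isOpen_univ⟩⟩

section Topology

variable [IsTopologicalChiralAlgebra A]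

theorem gr_basis : RingSubgroupsBasis fun P : {P : Submodule k A // IsOpen (P : Set A)} =>
    F.grSub P.1 := by
  have key : ∀ P : {P : Submodule k A // IsOpen (P : Set A)},
      ∃ Q : {P : Submodule k A // IsOpen (P : Set A)}, F.grSub Q.1 ≤ F.grSub P.1 ∧
        ∀ (x : F.Gr), ∀ y ∈ F.grSub Q.1, x * y ∈ F.grSub Q.1 := by
    intro P
    obtain ⟨I, hI, hIP⟩ := exists_open_leftIdeal (P.2.mem_nhds (zero_mem P.1))
    exact ⟨⟨I.restrictScalars k, hI⟩, F.grSub_mono hIP, fun x y hy =>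
      F.mul_mem_grSub (P := I.restrictScalars k) (fun a b hb => I.mul_mem_left a hb) x hy⟩
  refine ⟨?_, ?_, ?_, ?_⟩
  · intro P Q
    refine ⟨⟨P.1 ⊓ Q.1, P.2.inter Q.2⟩, ?_⟩
    exact fun x hx => ⟨F.grSub_mono inf_le_left hx, F.grSub_mono inf_le_right hx⟩
  · intro P
    obtain ⟨Q, hQP, hQ⟩ := key P
    refine ⟨Q, ?_⟩
    rintro _ ⟨x, -, y, hy, rfl⟩
    exact hQP (hQ x y hy)
  · intro x P
    obtain ⟨Q, hQP, hQ⟩ := key P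
    exact ⟨Q, fun y hy => hQP (hQ x y hy)⟩
  · intro x
    induction x using Gr.induction with
    | zero => exact fun P => ⟨P, fun y _ => by simp [zero_mem]⟩
    | of n b hb =>
      intro P
      refine ⟨⟨P.1.comap (LinearMap.mulRight k b), P.2.preimage (continuous_mul_const b)⟩, ?_⟩
      intro y hy
      change y * _ ∈ F.grSub P.1
      refine F.grSub_induction (p := fun y => y * _ ∈ F.grSub P.1) hy ?_ ?_ ?_
      · rw [zero_mul]; exact zero_mem _
      · intro m a ha haP
        rw [F.of_cls_mul]
        exact F.of_mem_grSub _ haP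
      · intro y z hy hz
        rw [add_mul]; exact add_mem hy hz
    | add x x' hx hx' =>
      intro P
      obtain ⟨Q, hQ⟩ := hx P
      obtain ⟨Q', hQ'⟩ := hx' P
      refine ⟨⟨Q.1 ⊓ Q'.1, Q.2.inter Q'.2⟩, fun y hy => ?_⟩
      change y * (x + x') ∈ F.grSub P.1
      rw [mul_add]
      exact add_mem (hQ (F.grSub_mono inf_le_left hy)) (hQ' (F.grSub_mono inf_le_right hy))

instance : UniformSpace F.Gr := basisUniformSpace F.gr_basis
instance : IsUniformAddGroup F.Gr := basis_isUniformAddGroup F.gr_basis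
instance : IsTopologicalRing F.Gr := basis_isTopologicalRing F.gr_basis
instance : UniformContinuousConstSMul k F.Gr := uniformContinuousConstSMul_of_algebra _ _

instance : IsLinearTopology F.Gr F.Gr where
  hasBasis_submodule' := by
    refine (basis_hasBasis F.gr_basis).to_hasBasis ?_ ?_
    · intro P _
      obtain ⟨I, hI, hIP⟩ := exists_open_leftIdeal (P.2.mem_nhds (zero_mem P.1))
      let J : Ideal F.Gr :=
        { F.grSub (I.restrictScalars k) with
          smul_mem' := fun x y hy =>
            F.mul_mem_grSub (P := I.restrictScalars k) (fun a b hb => I.mul_mem_left a hb) x hy }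
      refine ⟨J, ?_, F.grSub_mono hIP⟩
      exact (basis_hasBasis F.gr_basis).mem_of_mem (i := ⟨I.restrictScalars k, hI⟩) trivial
    · intro J hJ
      exact (basis_hasBasis F.gr_basis).mem_iff.1 hJ

/-- The completion of `⊕ gr_n A` with respect to the topology with base the subspaces
`⊕ (P ∩ A_n) / (P ∩ A_{n-1})`, for `P` an open subspace of `A`. -/
abbrev GrHat := Completion F.Gr

instance : IsTopologicalChiralAlgebra F.GrHat := isTopologicalChiralAlgebra_completion _

/-- The class in the completed graded algebra of an element of `A_n`. -/
def symb (n : ℕ) (a : A) (ha : a ∈ F.fil n) : F.GrHat := (F.of n (F.cls n a ha) : F.Gr)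

/-- A copy of `A_∞`, to be equipped with the topology formed by the left ideals `I` such that
every `I ∩ A_n` is open in `A_n`. -/
def Infty := ↥F.inftyPart

instance : Ring F.Infty := inferInstanceAs (Ring F.inftyPart)

/-- The inclusion of `A_∞` in `A`. -/
def inftyVal : F.Infty →+* A := (F.inftyPart.val : F.inftyPart →+* A)

/-- The inclusion of `A_n` in `A_∞`. -/
def toInfty (n : ℕ) (a : F.fil n) : F.Infty :=
  (⟨a, Set.mem_iUnion.2 ⟨n, a.2⟩⟩ : F.inftyPart)

/-- A left ideal `I` of `A_∞` such that every `I ∩ A_n` is open in `A_n`. -/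
def IsInftyOpen (I : Ideal F.Infty) : Prop := ∀ n, IsOpen {a : F.fil n | F.toInfty n a ∈ I}

instance : Nonempty {I : Ideal F.Infty // F.IsInftyOpen I} :=
  ⟨⟨⊤, fun n => by simp⟩⟩

theorem infty_basis : RingSubgroupsBasis fun I : {I : Ideal F.Infty // F.IsInftyOpen I} =>
    I.1.toAddSubgroup := by
  refine leftIdealBasis (fun I : {I : Ideal F.Infty // F.IsInftyOpen I} => I.1) ?_ ?_
  · exact fun I J => ⟨⟨I.1 ⊓ J.1, fun n => (I.2 n).inter (J.2 n)⟩, le_rfl⟩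
  · intro x I
    obtain ⟨m, hm⟩ := Set.mem_iUnion.1 (show (x : F.inftyPart).1 ∈ ⋃ n, (F.fil n : Set A) from x.2)
    let J : Ideal F.Infty := Submodule.comap (LinearMap.toSpanSingleton F.Infty F.Infty x) I.1
    have hJ : ∀ a, a ∈ J ↔ a * x ∈ I.1 := fun a => Iff.rfl
    refine ⟨⟨J, fun n => ?_⟩, fun a ha => (hJ a).1 ha⟩
    let g : F.fil n → F.fil (n + m) := fun a => ⟨a * (x : F.inftyPart).1, F.mul_mem a.2 hm⟩
    have hg : Continuous g :=
      (continuous_subtype_val.mul continuous_const).subtype_mk _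
    exact (I.2 (n + m)).preimage hg

instance : UniformSpace F.Infty := basisUniformSpace F.infty_basis
instance : IsUniformAddGroup F.Infty := basis_isUniformAddGroup F.infty_basis
instance : IsTopologicalRing F.Infty := basis_isTopologicalRing F.infty_basis

theorem continuous_inftyVal : Continuous F.inftyVal := by
  refine continuous_of_continuousAt_zero F.inftyVal ?_
  rw [ContinuousAt, map_zero]
  intro U hU
  obtain ⟨I, hI, hIU⟩ := exists_open_leftIdeal hU
  refine Filter.mem_of_superset ((basis_hasBasis F.infty_basis).mem_of_mem
    (i := ⟨I.comap F.inftyVal, fun n => hI.preimage continuous_subtype_val⟩) trivial) ?_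
  exact fun x hx => hIU hx

/-- The morphism from the completion of `A_∞` to `A` which extends the inclusion of `A_∞`. -/
def inftyMap : Completion F.Infty →+* A := Completion.extensionHom F.inftyVal F.continuous_inftyVal

/-- The filtration is admissible if the completion of `A_∞`, with respect to the topology formed by
the left ideals whose intersection with each `A_n` is open in `A_n`, maps isomorphically to `A`. -/
def IsAdmissible : Prop := IsHomeomorph F.inftyMap

end Topology


section PBW

theorem of_zero_injective {a b : A} (ha : a ∈ F.fil 0) (hb : b ∈ F.fil 0)
    (h : F.of 0 (F.cls 0 a ha) = F.of 0 (F.cls 0 b hb)) : a = b := by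
  have h' : F.cls 0 a ha = F.cls 0 b hb := DirectSum.of_injective (β := F.gr) 0 h
  exact sub_eq_zero.1 (F.cls_eq.1 h')

variable [F.IsCommutative]

instance : CommRing F.Gr where
  __ := (inferInstance : Ring F.Gr)
  mul_comm := IsCommutative.mul_comm

instance : CommRing F.zeroPart where
  __ := (inferInstance : Ring F.zeroPart)
  mul_comm r s := Subtype.ext <| F.of_zero_injective (F.mul_mem r.2 s.2) (F.mul_mem s.2 r.2) <|
    (F.of_cls_mul r.2 s.2).symm.trans <| (IsCommutative.mul_comm _ _).trans <| F.of_cls_mul s.2 r.2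

instance : Algebra F.zeroPart F.Gr := F.zeroHom.toAlgebra

variable [IsTopologicalChiralAlgebra A]

instance : UniformContinuousConstSMul F.zeroPart F.Gr := uniformContinuousConstSMul_of_algebra _ _

theorem continuous_of_cls (n : ℕ) : Continuous fun a : F.filMod n => F.of n (F.cls n a a.2) := by
  let g : F.filMod n →+ F.Gr :=
    { toFun := fun a => F.of n (F.cls n a a.2)
      map_zero' := (F.of n).map_zero
      map_add' := fun a b => (F.of n).map_add (F.cls n a a.2) (F.cls n b b.2) }
  refine continuous_of_continuousAt_zero g ?_
  rw [ContinuousAt, map_zero, (basis_hasBasis F.gr_basis).tendsto_right_iff]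
  intro P _
  have : {a : F.filMod n | (a : A) ∈ P.1} ∈ 𝓝 0 :=
    (P.2.preimage continuous_subtype_val).mem_nhds (zero_mem P.1)
  filter_upwards [this] with a ha
  exact F.of_mem_grSub a.2 ha

theorem continuous_of (n : ℕ) : Continuous (F.of n) :=
  continuous_coinduced_dom.2 (F.continuous_of_cls n)

/-- The canonical map from `gr_1 A` to the completed graded algebra. -/
def grOneHom : F.gr 1 →ₗ[F.zeroPart] F.GrHat where
  toFun x := (F.of 1 x : F.Gr)
  map_add' x y := by rw [map_add, Completion.coe_add]
  map_smul' r x := by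
    obtain ⟨a, ha, rfl⟩ := F.exists_cls x
    rw [F.cls_smul, RingHom.id_apply, Algebra.smul_def]
    change _ = ((F.of 0 (F.cls 0 r r.2) : F.Gr) : F.GrHat) * _
    rw [← Completion.coe_mul]
    exact congrArg _ ((F.of_congr (zero_add 1).symm rfl _ _).trans (F.of_cls_mul r.2 ha).symm)

theorem continuous_grOneHom : Continuous F.grOneHom :=
  (Completion.continuous_coe _).comp (F.continuous_of 1)

theorem continuous_algebraMap_grHat : Continuous (algebraMap F.zeroPart F.GrHat) :=
  (Completion.continuous_coe _).comp (F.continuous_of_cls 0)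

/-- The Poincaré-Birkhoff-Witt map `Sym^!_R (gr_1 A) → gr^ A`, where `R = A_0`. -/
def pbwMap : SymShriek F.zeroPart (F.gr 1) →ₐ[F.zeroPart] F.GrHat :=
  SymShriek.lift F.continuous_algebraMap_grHat F.grOneHom F.continuous_grOneHom

/-- The strong PBW property: the filtration is admissible and the Poincaré-Birkhoff-Witt map is an
isomorphism of topological algebras. -/
def IsStrongPBW : Prop := F.IsAdmissible ∧ IsHomeomorph F.pbwMap

end PBW

end ChiralFiltration
end Filtration

section Standard

variable (k L : Type*) [Field k] [LieRing L] [LieAlgebra k L]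

/-- The `n`-th term `U(L)_n = (k + L)^n` of the standard filtration on `U(L)`. -/
def Env.fil (n : ℕ) : Submodule k (Env k L) := (1 ⊔ LinearMap.range (Env.ι k L)) ^ n

theorem Env.fil_zero : Env.fil k L 0 = 1 := pow_zero _

theorem Env.fil_one : Env.fil k L 1 = 1 ⊔ LinearMap.range (Env.ι k L) := pow_one _

theorem Env.fil_succ (n : ℕ) : Env.fil k L (n + 1) = Env.fil k L n * Env.fil k L 1 := by
  rw [Env.fil_one]; exact pow_succ _ _

theorem Env.fil_add (m n : ℕ) : Env.fil k L (m + n) = Env.fil k L m * Env.fil k L n :=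
  pow_add _ _ _

theorem Env.fil_mono : Monotone (Env.fil k L) := fun _ _ h =>
  pow_le_pow_right₀ le_sup_left h

theorem Env.exists_mem_fil (x : Env k L) : ∃ n, x ∈ Env.fil k L n := by
  have hx : x ∈ Algebra.adjoin k (Set.range (Env.ι k L)) := by
    rw [Env.adjoin_range_ι]; trivial
  induction hx using Algebra.adjoin_induction with
  | mem x hx =>
    obtain ⟨l, rfl⟩ := hx
    exact ⟨1, by rw [Env.fil_one]; exact Submodule.mem_sup_right ⟨l, rfl⟩⟩
  | algebraMap c => exact ⟨0, by rw [Env.fil_zero]; exact Submodule.algebraMap_mem c⟩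
  | add x y _ _ hx hy =>
    obtain ⟨m, hm⟩ := hx
    obtain ⟨n, hn⟩ := hy
    exact ⟨max m n, add_mem (Env.fil_mono k L (le_max_left m n) hm)
      (Env.fil_mono k L (le_max_right m n) hn)⟩
  | mul x y _ _ hx hy =>
    obtain ⟨m, hm⟩ := hx
    obtain ⟨n, hn⟩ := hy
    exact ⟨m + n, by rw [Env.fil_add]; exact Submodule.mul_mem_mul hm hn⟩

variable {k L}

theorem Env.comm_of_mem_zero {x : Env k L} (hx : x ∈ Env.fil k L 0) (y : Env k L) :
    x * y - y * x = 0 := by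
  rw [Env.fil_zero] at hx
  obtain ⟨c, rfl⟩ := Submodule.mem_one.1 hx
  rw [Algebra.commutes, sub_self]

theorem Env.comm_one_one {x y : Env k L} (hx : x ∈ Env.fil k L 1) (hy : y ∈ Env.fil k L 1) :
    x * y - y * x ∈ Env.fil k L 1 := by
  rw [Env.fil_one] at hx hy
  obtain ⟨a, ha, _, ⟨l, rfl⟩, rfl⟩ := Submodule.mem_sup.1 hx
  obtain ⟨b, hb, _, ⟨m, rfl⟩, rfl⟩ := Submodule.mem_sup.1 hy
  rw [← Env.fil_zero] at ha hb
  have h1 := Env.comm_of_mem_zero ha (b + Env.ι k L m)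
  have h2 := Env.comm_of_mem_zero hb (Env.ι k L l)
  have h3 := Env.ι_lie (k := k) l m
  have : (a + Env.ι k L l) * (b + Env.ι k L m) - (b + Env.ι k L m) * (a + Env.ι k L l) =
      Env.ι k L ⁅l, m⁆ := by
    have h4 : (a + Env.ι k L l) * (b + Env.ι k L m) - (b + Env.ι k L m) * (a + Env.ι k L l) =
        (a * (b + Env.ι k L m) - (b + Env.ι k L m) * a) -
          (b * Env.ι k L l - Env.ι k L l * b) +
          (Env.ι k L l * Env.ι k L m - Env.ι k L m * Env.ι k L l) := by noncomm_ring
    rw [h4, h1, h2, h3, sub_zero, zero_add]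
  rw [this, Env.fil_one]
  exact Submodule.mem_sup_right ⟨_, rfl⟩

theorem Env.comm_one {n : ℕ} {x y : Env k L} (hx : x ∈ Env.fil k L n) (hy : y ∈ Env.fil k L 1) :
    x * y - y * x ∈ Env.fil k L n := by
  induction n generalizing x with
  | zero => rw [Env.comm_of_mem_zero hx]; exact zero_mem _
  | succ n ih =>
    rw [Env.fil_succ] at hx ⊢
    induction hx using Submodule.mul_induction_on' with
    | mem_mul_mem a ha b hb =>
      have : a * b * y - y * (a * b) = a * (b * y - y * b) + (a * y - y * a) * b := by
        noncomm_ring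
      rw [this]
      exact add_mem (Submodule.mul_mem_mul ha (Env.comm_one_one hb hy))
        (Submodule.mul_mem_mul (ih ha) hb)
    | add a _ b _ ha hb =>
      have : (a + b) * y - y * (a + b) = (a * y - y * a) + (b * y - y * b) := by noncomm_ring
      rw [this]
      exact add_mem ha hb

theorem Env.comm_mem {m n : ℕ} {x y : Env k L} (hx : x ∈ Env.fil k L (m + 1))
    (hy : y ∈ Env.fil k L n) : x * y - y * x ∈ Env.fil k L (m + n) := by
  induction n generalizing y with
  | zero =>
    rw [← neg_sub, Env.comm_of_mem_zero hy, neg_zero]; exact zero_mem _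
  | succ n ih =>
    rw [Env.fil_succ] at hy
    induction hy using Submodule.mul_induction_on' with
    | mem_mul_mem a ha b hb =>
      have : x * (a * b) - a * b * x = a * (x * b - b * x) + (x * a - a * x) * b := by
        noncomm_ring
      rw [this]
      refine add_mem ?_ ?_
      · have h := Submodule.mul_mem_mul ha (Env.comm_one hx hb)
        rw [← Env.fil_add] at h
        convert h using 2
        omega
      · have h := Submodule.mul_mem_mul (ih ha) hb
        rwa [← Env.fil_succ] at h
    | add a _ b _ ha hb =>
      have : x * (a + b) - (a + b) * x = (x * a - a * x) + (x * b - b * x) := by noncomm_ring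
      rw [this]
      exact add_mem ha hb

variable (k L)
variable [TopologicalSpace L] [IsTopologicalLieStarAlgebra k L]

/-- The image in `U^ch(L)` of the `n`-th term of the standard filtration on `U(L)`. -/
def ChiralEnv.im (n : ℕ) : Submodule k (ChiralEnv k L) where
  carrier := ((↑) : Env k L → ChiralEnv k L) '' Env.fil k L n
  add_mem' := by
    rintro _ _ ⟨x, hx, rfl⟩ ⟨y, hy, rfl⟩
    exact ⟨x + y, add_mem hx hy, Completion.coe_add x y⟩
  zero_mem' := ⟨0, zero_mem _, Completion.coe_zero⟩
  smul_mem' := by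
    rintro c _ ⟨x, hx, rfl⟩
    exact ⟨c • x, Submodule.smul_mem _ c hx, Completion.coe_smul c x⟩

/-- The standard filtration on `U^ch(L)`: its `n`-th term is the closure of the image of the
`n`-th term of the standard filtration on `U(L)`. -/
def stdFiltration : ChiralFiltration k (ChiralEnv k L) where
  fil n := (ChiralEnv.im k L n).topologicalClosure
  mono m n h := Submodule.topologicalClosure_mono (Set.image_mono (Env.fil_mono k L h))
  isClosed n := Submodule.isClosed_topologicalClosure _
  dense := by
    refine Completion.denseRange_coe.mono ?_
    rintro _ ⟨x, rfl⟩
    obtain ⟨n, hn⟩ := Env.exists_mem_fil k L x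
    exact Set.mem_iUnion.2 ⟨n, subset_closure ⟨x, hn, rfl⟩⟩
  one_mem := subset_closure ⟨1, by rw [Env.fil_zero]; exact Submodule.one_le.1 le_rfl, rfl⟩
  mul_mem {i j a b} ha hb := by
    refine map_mem_closure₂ continuous_mul ha hb ?_
    rintro _ ⟨x, hx, rfl⟩ _ ⟨y, hy, rfl⟩
    exact ⟨x * y, by rw [Env.fil_add]; exact Submodule.mul_mem_mul hx hy, Completion.coe_mul x y⟩

theorem stdFiltration_comm {i j : ℕ} {a b : ChiralEnv k L} (ha : a ∈ (stdFiltration k L).fil i)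
    (hb : b ∈ (stdFiltration k L).fil j) : a * b - b * a ∈ (stdFiltration k L).prev (i + j) := by
  have hc : Continuous (Function.uncurry fun a b : ChiralEnv k L => a * b - b * a) :=
    continuous_mul.sub (continuous_snd.mul continuous_fst)
  cases i with
  | zero =>
    have h := map_mem_closure₂ (f := fun a b : ChiralEnv k L => a * b - b * a) (u := {0}) hc ha hb (by
      rintro _ ⟨x, hx, rfl⟩ _ ⟨y, hy, rfl⟩
      change (x : ChiralEnv k L) * y - y * x = 0
      rw [← Completion.coe_mul, ← Completion.coe_mul, ← Completion.coe_sub,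
        Env.comm_of_mem_zero hx, Completion.coe_zero])
    rw [closure_singleton] at h
    have h0 : a * b - b * a = 0 := h
    rw [h0]; exact zero_mem _
  | succ i =>
    rw [Nat.succ_add]
    refine map_mem_closure₂ (f := fun a b : ChiralEnv k L => a * b - b * a) hc ha hb ?_
    rintro _ ⟨x, hx, rfl⟩ _ ⟨y, hy, rfl⟩
    refine ⟨x * y - y * x, Env.comm_mem hx hy, ?_⟩
    rw [Completion.coe_sub, Completion.coe_mul, Completion.coe_mul]

instance : (stdFiltration k L).IsCommutative where
  mul_comm x y := by
    induction x using ChiralFiltration.Gr.induction with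
    | zero => rw [zero_mul, mul_zero]
    | add x x' hx hx' => rw [add_mul, mul_add, hx, hx']
    | of i a ha =>
      induction y using ChiralFiltration.Gr.induction with
      | zero => rw [zero_mul, mul_zero]
      | add y y' hy hy' => rw [add_mul, mul_add, hy, hy']
      | of j b hb =>
        have hba : b * a ∈ (stdFiltration k L).fil (i + j) := by
          rw [add_comm]; exact (stdFiltration k L).mul_mem hb ha
        rw [ChiralFiltration.of_cls_mul, ChiralFiltration.of_cls_mul,
          (stdFiltration k L).of_congr (add_comm j i) rfl _ hba]
        exact congrArg _ ((stdFiltration k L).cls_eq.2 (stdFiltration_comm k L ha hb))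

theorem ChiralEnv.ι_mem (x : L) : ChiralEnv.ι k L x ∈ (stdFiltration k L).fil 1 :=
  subset_closure ⟨Env.ι k L x, by
    rw [Env.fil_one]; exact Submodule.mem_sup_right ⟨x, rfl⟩, rfl⟩

theorem ChiralEnv.continuous_ι [IsTopologicalAddGroup L] : Continuous (ChiralEnv.ι k L) := by
  refine (Completion.continuous_coe (Env k L)).comp ?_
  refine continuous_of_continuousAt_zero (Env.ι k L) ?_
  rw [ContinuousAt, map_zero, (basis_hasBasis (Env.basis k L)).tendsto_right_iff]
  intro P _
  filter_upwards [P.2.mem_nhds (zero_mem P.1)] with x hx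
  exact Ideal.subset_span ⟨x, hx, rfl⟩

/-- The map from `L` to the completed graded algebra of `U^ch(L)` which sends `x` to its class in
`gr_1 U^ch(L)`. -/
def lieToGr : L →ₗ[k] (stdFiltration k L).GrHat where
  toFun x := (stdFiltration k L).symb 1 (ChiralEnv.ι k L x) (ChiralEnv.ι_mem k L x)
  map_add' x y := by
    refine Eq.trans (congrArg ((↑) : (stdFiltration k L).Gr → (stdFiltration k L).GrHat) ?_)
      (Completion.coe_add _ _)
    exact ((stdFiltration k L).of_congr rfl (map_add _ x y) _
      (add_mem (ChiralEnv.ι_mem k L x) (ChiralEnv.ι_mem k L y))).trans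
      (((stdFiltration k L).of 1).map_add
        ((stdFiltration k L).cls 1 _ (ChiralEnv.ι_mem k L x))
        ((stdFiltration k L).cls 1 _ (ChiralEnv.ι_mem k L y)))
  map_smul' c x := by
    rw [RingHom.id_apply, Algebra.smul_def]
    refine Eq.trans (congrArg ((↑) : (stdFiltration k L).Gr → (stdFiltration k L).GrHat) ?_)
      (Completion.coe_mul _ _)
    refine Eq.trans ((stdFiltration k L).of_congr (zero_add 1).symm ?_ _
      ((stdFiltration k L).mul_mem ((stdFiltration k L).zeroPart.algebraMap_mem c)
        (ChiralEnv.ι_mem k L x))) ((stdFiltration k L).of_cls_mul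
          ((stdFiltration k L).zeroPart.algebraMap_mem c) (ChiralEnv.ι_mem k L x)).symm
    rw [map_smul, Algebra.smul_def]

theorem continuous_lieToGr [IsTopologicalAddGroup L] : Continuous (lieToGr k L) := by
  let g : L → (stdFiltration k L).filMod 1 := fun x => ⟨ChiralEnv.ι k L x, ChiralEnv.ι_mem k L x⟩
  have hg : Continuous g := (ChiralEnv.continuous_ι k L).subtype_mk _
  exact (Completion.continuous_coe _).comp (((stdFiltration k L).continuous_of_cls 1).comp hg)

/-- The canonical morphism `Sym^! L → gr^ U^ch(L)` which extends `L → gr_1 U^ch(L)`; the base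
field is discrete. -/
def symToGr [TopologicalSpace k] [DiscreteTopology k] [IsTopologicalAddGroup L] :
    SymShriek k L →ₐ[k] (stdFiltration k L).GrHat :=
  SymShriek.lift continuous_of_discreteTopology (lieToGr k L) (continuous_lieToGr k L)

end Standard

section Coisson

/-- A topological coisson algebra structure on a topological commutative`^!` algebra `S`: a
continuous Poisson bracket such that the open ideals which are Lie subalgebras form a base of the
topology. -/
structure CoissonStructure (k S : Type*) [Field k] [CommRing S] [Algebra k S]
    [TopologicalSpace S] where
  bracket : S →ₗ[k] S →ₗ[k] S
  bracket_self : ∀ x, bracket x x = 0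
  jacobi : ∀ x y z, bracket x (bracket y z) = bracket (bracket x y) z + bracket y (bracket x z)
  leibniz : ∀ x y z, bracket x (y * z) = bracket x y * z + y * bracket x z
  continuous_bracket : Continuous fun p : S × S => bracket p.1 p.2
  exists_ideal : ∀ U ∈ 𝓝 (0 : S), ∃ I : Ideal S, IsOpen (I : Set S) ∧ (I : Set S) ⊆ U ∧
    ∀ x ∈ I, ∀ y ∈ I, bracket x y ∈ I

/-- The bracket of `Sym^! L` extends that of the Lie algebra `L`. -/
def CoissonStructure.ExtendsLie {k L : Type*} [Field k] [TopologicalSpace k] [LieRing L]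
    [LieAlgebra k L] [TopologicalSpace L] (c : CoissonStructure k (SymShriek k L)) : Prop :=
  ∀ x y : L, c.bracket (SymShriek.ι k L x) (SymShriek.ι k L y) = SymShriek.ι k L ⁅x, y⁆

/-- The bracket of the completed graded algebra extends the usual Poisson bracket of the
commutative algebra `⊕ gr_n A`: for `a ∈ A_i` and `b ∈ A_j`, the bracket of the classes of `a` and
`b` is the class of `ab - ba` in `gr_{i+j-1} A`. (When `i = j = 0`, we have `ab - ba = 0`.) -/
def CoissonStructure.ExtendsGr {k A : Type*} [Field k] [Ring A] [Algebra k A] [UniformSpace A]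
    [IsTopologicalChiralAlgebra A] {F : ChiralFiltration k A} [F.IsCommutative]
    (c : CoissonStructure k F.GrHat) : Prop :=
  ∀ (i j : ℕ) (a b : A) (ha : a ∈ F.fil i) (hb : b ∈ F.fil j)
    (hab : a * b - b * a ∈ F.fil (i + j - 1)),
    c.bracket (F.symb i a ha) (F.symb j b hb) = F.symb (i + j - 1) (a * b - b * a) hab

end Coisson

end TopAlg

end

open TopAlg

universe u v w

/-!
The algebraic core is the Poincaré-Birkhoff-Witt theorem relative to a Lie subalgebra `P` of `L`,
over a field of any characteristic: the graded quotients of `U(L) / U(L) P` are the symmetric powers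
of `L / P`. Choose a basis of `L` indexed by a linearly ordered set, in which the basis vectors of
`P` come last (`PBW.exists_adapted_basis`). The Lie algebra acts on polynomials in the basis vectors
so that the action of `x` is the multiplication by `x` up to terms of lower degree (`PBW.act`,
`PBW.act_sub_mem`, `PBW.act_lie`), and, since `P` is a subalgebra and its variables come last, the
ideal generated by the variables of `P` is stable (`PBW.act_mem_varSpan`). Applying `U(L)` to the
polynomial `1` gives a symbol map which sends a product of `n` elements of `L` to the product of the
corresponding linear polynomials up to degree less than `n`, and `U(L) P` to that ideal
(`PBW.symbol_list_prod`, `PBW.symbol_mem_varSpan`).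

Open Lie subalgebras form a base of the topology of `L`, so the closures of the left ideals
`U(L) P`, for such `P`, form a base of the topology of `U^ch(L)`. Comparing symbols shows that the
topology of `Sym L` is induced from the graded algebra of `U^ch(L)`
(`TopAlg.mem_ideal_of_symGr_mem`), and the image of `Sym L` is dense because `U(L)_n` is dense in
`U^ch(L)_n`; passing to completions, `Sym^! L` is identified with the completed graded algebra
(`TopAlg.symToGr_isHomeomorph`). As `L` is complete, `U^ch(L)_0 = k` and `U^ch(L)_1 = k + L`
(`TopAlg.exists_of_mem_fil_zero`, `TopAlg.exists_of_mem_fil_one`), so the Poincaré-Birkhoff-Witt map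
over `U^ch(L)_0` is an isomorphism as well (`TopAlg.pbwMap_isHomeomorph`). Admissibility only uses
the density of `U(L)_n` in `U^ch(L)_n` (`TopAlg.stdFiltration_isAdmissible`).

The commutator defines a Poisson bracket on the graded algebra of any commutative filtration; it is
continuous because a left ideal is closed under commutators, and so it extends to the completion
(`TopAlg.ChiralFiltration.coissonStructure`). The coisson structure of `Sym^! L` is the transport of
this one. Both are unique, since a continuous bracket is determined by its values on generators of a
dense subalgebra.
-/

/-! ### The action of a Lie algebra on polynomials -/

section

open MvPolynomial Module

namespace PBW

variable {k L I : Type*} [Field k]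

section Degree

variable (k I)

/-- The space of polynomials of total degree at most `n`. -/
noncomputable def degLE (n : ℕ) : Submodule k (MvPolynomial I k) :=
  restrictSupport k {m | m.degree ≤ n}

/-- The span of the monomials which involve a variable indexed by `s`. -/
noncomputable def varSpan (k : Type*) {I : Type*} [Field k] (s : Set I) :
    Submodule k (MvPolynomial I k) :=
  restrictSupport k {m | ∃ i ∈ s, m i ≠ 0}

variable {k I}

theorem monomial_mem_degLE {m : I →₀ ℕ} {n : ℕ} (h : m.degree ≤ n) :
    monomial m (1 : k) ∈ degLE k I n :=
  (monomial_mem_restrictSupport k).2 (Or.inl h)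

theorem degLE_mono {m n : ℕ} (h : m ≤ n) : degLE k I m ≤ degLE k I n :=
  restrictSupport_mono k fun _ hx => le_trans hx h

theorem degLE_le {W : Submodule k (MvPolynomial I k)} {n : ℕ}
    (h : ∀ m : I →₀ ℕ, m.degree ≤ n → monomial m (1 : k) ∈ W) : degLE k I n ≤ W := by
  rw [degLE, restrictSupport_eq_span, Submodule.span_le]
  rintro _ ⟨m, hm, rfl⟩
  exact h m hm

theorem exists_mem_degLE (p : MvPolynomial I k) : ∃ n, p ∈ degLE k I n :=
  ⟨p.support.sup fun m => m.degree, fun _ hm =>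
    Finset.le_sup (f := fun m : I →₀ ℕ => m.degree) hm⟩

theorem one_mem_degLE : (1 : MvPolynomial I k) ∈ degLE k I 0 := by
  have h : (1 : MvPolynomial I k) = monomial 0 1 := rfl
  rw [h]
  exact monomial_mem_degLE (by simp)

theorem X_mul_mem_degLE (i : I) {n : ℕ} {p : MvPolynomial I k} (hp : p ∈ degLE k I n) :
    X i * p ∈ degLE k I (n + 1) := by
  suffices h : degLE k I n ≤ (degLE k I (n + 1)).comap (LinearMap.mulLeft k (X i)) from h hp
  refine degLE_le fun m hm => ?_
  rw [Submodule.mem_comap, LinearMap.mulLeft_apply, X, monomial_mul, one_mul]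
  refine monomial_mem_degLE ?_
  rw [map_add, Finsupp.degree_single]
  omega

theorem monomial_mem_varSpan {s : Set I} {m : I →₀ ℕ} (h : ∃ i ∈ s, m i ≠ 0) :
    monomial m (1 : k) ∈ varSpan k s :=
  (monomial_mem_restrictSupport k).2 (Or.inl h)

theorem varSpan_inf_degLE_le {W : Submodule k (MvPolynomial I k)} {s : Set I} {n : ℕ}
    (h : ∀ m : I →₀ ℕ, (∃ i ∈ s, m i ≠ 0) → m.degree ≤ n → monomial m (1 : k) ∈ W)
    {p : MvPolynomial I k} (hp : p ∈ varSpan k s) (hn : p ∈ degLE k I n) : p ∈ W := by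
  have : p ∈ restrictSupport k {m : I →₀ ℕ | (∃ i ∈ s, m i ≠ 0) ∧ m.degree ≤ n} :=
    fun m hm => ⟨hp hm, hn hm⟩
  rw [restrictSupport_eq_span] at this
  refine Submodule.span_le.2 ?_ this
  rintro _ ⟨m, hm, rfl⟩
  exact h m hm.1 hm.2

theorem mem_varSpan {s : Set I} {p : MvPolynomial I k} :
    p ∈ varSpan k s ↔ p ∈ Ideal.span (X '' s : Set (MvPolynomial I k)) :=
  mem_ideal_span_X_image.symm

theorem mem_varSpan_iff {s : Set I} {p : MvPolynomial I k} :
    p ∈ varSpan k s ↔ ∀ m, coeff m p ≠ 0 → ∃ i ∈ s, m i ≠ 0 :=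
  ⟨fun h _ hm => h (mem_support_iff.2 hm), fun h m hm => h m (mem_support_iff.1 hm)⟩

theorem X_mul_mem_varSpan {s : Set I} (q : MvPolynomial I k) {p : MvPolynomial I k}
    (hp : p ∈ varSpan k s) : q * p ∈ varSpan k s :=
  mem_varSpan.2 (Ideal.mul_mem_left _ _ (mem_varSpan.1 hp))

end Degree

variable [LieRing L] [LieAlgebra k L] (b : Basis I k L)

/-- The linear polynomial of an element of `L`. -/
noncomputable def lin : L →ₗ[k] MvPolynomial I k := b.constr k X

theorem lin_basis (i : I) : lin b (b i) = X i := b.constr_basis k _ i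

variable {b}

theorem mem_support_single_add (j : I) (m : I →₀ ℕ) : j ∈ (Finsupp.single j 1 + m).support := by
  rw [Finsupp.mem_support_iff, Finsupp.add_apply, Finsupp.single_eq_same]
  omega

theorem basis_le {V : Submodule k L} (h : ∀ i, b i ∈ V) (x : L) : x ∈ V := by
  have : Submodule.span k (Set.range b) ≤ V := Submodule.span_le.2 (by rintro _ ⟨i, rfl⟩; exact h i)
  exact this (b.mem_span x)

theorem lin_mul_mem (x : L) {p : MvPolynomial I k} {d : ℕ} (hp : p ∈ degLE k I d) :
    lin b x * p ∈ degLE k I (d + 1) := by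
  refine basis_le (b := b)
    (V := (degLE k I (d + 1)).comap ((LinearMap.mulRight k p).comp (lin b))) (fun i => ?_) x
  change lin b (b i) * p ∈ degLE k I (d + 1)
  rw [lin_basis]
  exact X_mul_mem_degLE i hp

theorem lin_mem_varSpan {s : Set I} {x : L} (hx : x ∈ Submodule.span k (b '' s)) :
    lin b x ∈ varSpan k s := by
  refine (Submodule.span_le (p := (varSpan k s).comap (lin b))).2 ?_ hx
  rintro _ ⟨i, hi, rfl⟩
  change lin b (b i) ∈ varSpan k s
  rw [lin_basis]
  exact mem_varSpan.2 (Ideal.subset_span ⟨i, hi, rfl⟩)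

variable [LinearOrder I] (b)

open Classical in
/-- One step of the recursion which defines the action of `L` on polynomials: given the action `A`
on polynomials of smaller degree, the action on a monomial `X_j N` with `j` minimal and `j < i` is
forced by `e_i · (e_j · N) = e_j · (e_i · N) + [e_i, e_j] · N`. -/
noncomputable def step (A : L →ₗ[k] Module.End k (MvPolynomial I k)) :
    L →ₗ[k] Module.End k (MvPolynomial I k) :=
  b.constr k fun i => (basisMonomials I k).constr k fun m =>
    if h : (m.support.filter (· < i)).Nonempty then
      X i * monomial m 1 +
        A (b ((m.support.filter (· < i)).min' h))
          (A (b i) (monomial (m - Finsupp.single ((m.support.filter (· < i)).min' h) 1) 1) -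
            X i * monomial (m - Finsupp.single ((m.support.filter (· < i)).min' h) 1) 1) +
        A ⁅b i, b ((m.support.filter (· < i)).min' h)⁆
          (monomial (m - Finsupp.single ((m.support.filter (· < i)).min' h) 1) 1)
    else X i * monomial m 1

/-- The action of `L` on polynomials of degree at most `n`; it is meaningless in higher degrees. -/
noncomputable def stage : ℕ → L →ₗ[k] Module.End k (MvPolynomial I k)
  | 0 => b.constr k fun i => LinearMap.mulLeft k (X i)
  | n + 1 => step b (stage n)

variable {b}

theorem step_of_le (A : L →ₗ[k] Module.End k (MvPolynomial I k)) {i : I} {m : I →₀ ℕ}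
    (h : ∀ j ∈ m.support, i ≤ j) : step b A (b i) (monomial m 1) = X i * monomial m 1 := by
  have hm : monomial m (1 : k) = basisMonomials I k m := by simp
  rw [step, b.constr_basis]
  conv_lhs => rw [hm, Basis.constr_basis]
  exact dif_neg (by simpa [Finset.filter_nonempty_iff] using h)

theorem min'_single_add {i j : I} {m : I →₀ ℕ} (h : ∀ l ∈ m.support, j ≤ l) (hij : j < i)
    (hne : ((Finsupp.single j 1 + m).support.filter (· < i)).Nonempty) :
    ((Finsupp.single j 1 + m).support.filter (· < i)).min' hne = j := by
  refine le_antisymm (Finset.min'_le _ _ (Finset.mem_filter.2 ⟨mem_support_single_add j m, hij⟩))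
    (Finset.le_min' _ _ _ fun l hl => ?_)
  by_cases hjl : j = l
  · exact hjl.le
  · refine h l ?_
    simpa [hjl, Finsupp.single_apply] using (Finset.mem_filter.1 hl).1

theorem step_of_lt (A : L →ₗ[k] Module.End k (MvPolynomial I k)) {i j : I} {m : I →₀ ℕ}
    (h : ∀ l ∈ m.support, j ≤ l) (hij : j < i) :
    step b A (b i) (monomial (Finsupp.single j 1 + m) 1) =
      X i * (X j * monomial m 1) + A (b j) (A (b i) (monomial m 1) - X i * monomial m 1) +
        A ⁅b i, b j⁆ (monomial m 1) := by
  have hm : monomial (Finsupp.single j 1 + m) (1 : k) =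
      basisMonomials I k (Finsupp.single j 1 + m) := by simp
  have hX : X j * monomial m (1 : k) = monomial (Finsupp.single j 1 + m) 1 := by
    rw [X, monomial_mul, one_mul]
  rw [step, b.constr_basis]
  conv_lhs => rw [hm, Basis.constr_basis]
  have hne : ((Finsupp.single j 1 + m).support.filter (· < i)).Nonempty :=
    ⟨j, Finset.mem_filter.2 ⟨mem_support_single_add j m, hij⟩⟩
  rw [dif_pos hne, hX, min'_single_add h hij hne, add_tsub_cancel_left]

/-- Every monomial which is not covered by `step_of_le` is covered by `step_of_lt`. -/
theorem monomial_cases (i : I) (m : I →₀ ℕ) :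
    (∀ j ∈ m.support, i ≤ j) ∨
      ∃ j m', (∀ l ∈ m'.support, j ≤ l) ∧ j < i ∧ m = Finsupp.single j 1 + m' := by
  by_cases h : ∀ j ∈ m.support, i ≤ j
  · exact Or.inl h
  · push Not at h
    obtain ⟨j, hj, hji⟩ := h
    have hne : m.support.Nonempty := ⟨j, hj⟩
    refine Or.inr ⟨m.support.min' hne, m - Finsupp.single (m.support.min' hne) 1, ?_,
      lt_of_le_of_lt (Finset.min'_le _ _ hj) hji, ?_⟩
    · intro l hl
      refine Finset.min'_le _ _ ?_
      rw [Finsupp.mem_support_iff] at hl ⊢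
      intro h0
      apply hl
      rw [Finsupp.tsub_apply, h0, Nat.zero_sub]
    · have h1 : Finsupp.single (m.support.min' hne) 1 ≤ m := by
        rw [Finsupp.single_le_iff]
        exact Nat.one_le_iff_ne_zero.2 (Finsupp.mem_support_iff.1 (Finset.min'_mem _ hne))
      exact (add_tsub_cancel_of_le h1).symm

/-- The action of `x` has the multiplication by the linear polynomial of `x` as principal part. -/
theorem stage_sub_mem (n : ℕ) (x : L) {p : MvPolynomial I k} {d : ℕ} (hp : p ∈ degLE k I d) :
    stage b n x p - lin b x * p ∈ degLE k I d := by
  induction n generalizing x p d with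
  | zero =>
    have : stage b 0 x p - lin b x * p = 0 := by
      let V : Submodule k L := LinearMap.ker
        ((LinearMap.applyₗ p).comp (stage b 0) - (LinearMap.mulRight k p).comp (lin b))
      refine basis_le (b := b) (V := V) (fun i => ?_) x
      change stage b 0 (b i) p - lin b (b i) * p = 0
      rw [stage, b.constr_basis, lin_basis, LinearMap.mulLeft_apply, sub_self]
    rw [this]; exact zero_mem _
  | succ n ih =>
    have key : ∀ (x : L) {p : MvPolynomial I k} {d : ℕ}, p ∈ degLE k I d →
        stage b n x p ∈ degLE k I (d + 1) := by
      intro x p d hp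
      have h1 := degLE_mono d.le_succ (ih x hp)
      have h2 : lin b x * p ∈ degLE k I (d + 1) := lin_mul_mem x hp
      simpa using add_mem h1 h2
    let W (i : I) : Submodule k (MvPolynomial I k) :=
      (degLE k I d).comap (stage b (n + 1) (b i) - LinearMap.mulLeft k (X i))
    suffices h : ∀ i, degLE k I d ≤ W i by
      refine basis_le (b := b) (V := (degLE k I d).comap
        ((LinearMap.applyₗ p).comp (stage b (n + 1)) - (LinearMap.mulRight k p).comp (lin b)))
        (fun i => ?_) x
      change stage b (n + 1) (b i) p - lin b (b i) * p ∈ degLE k I d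
      rw [lin_basis]
      exact h i hp
    refine fun i => degLE_le fun m hm => ?_
    change step b (stage b n) (b i) (monomial m 1) - X i * monomial m 1 ∈ degLE k I d
    rcases monomial_cases i m with h | ⟨j, m, h, hij, rfl⟩
    · rw [step_of_le _ h, sub_self]; exact zero_mem _
    · have hX : X j * monomial m (1 : k) = monomial (Finsupp.single j 1 + m) 1 := by
        rw [X, monomial_mul, one_mul]
      rw [map_add, Finsupp.degree_single] at hm
      rw [step_of_lt _ h hij, ← hX, add_assoc, add_sub_cancel_left]
      have hmm : monomial m (1 : k) ∈ degLE k I m.degree := monomial_mem_degLE le_rfl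
      have h1 := ih (b i) hmm
      rw [lin_basis] at h1
      exact degLE_mono (by omega) (add_mem (key (b j) h1) (key ⁅b i, b j⁆ hmm))

theorem stage_mem (n : ℕ) (x : L) {p : MvPolynomial I k} {d : ℕ} (hp : p ∈ degLE k I d) :
    stage b n x p ∈ degLE k I (d + 1) := by
  simpa using add_mem (degLE_mono d.le_succ (stage_sub_mem (b := b) n x hp))
    (lin_mul_mem (b := b) x hp)

theorem stage_succ (n : ℕ) (x : L) {p : MvPolynomial I k} (hp : p ∈ degLE k I n) :
    stage b (n + 1) x p = stage b n x p := by
  induction n generalizing x p with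
  | zero =>
    suffices h : ∀ i, degLE k I 0 ≤ LinearMap.ker (stage b 1 (b i) - stage b 0 (b i)) by
      refine sub_eq_zero.1 (basis_le (b := b) (V := LinearMap.ker
        ((LinearMap.applyₗ p).comp (stage b 1 - stage b 0))) (fun i => h i hp) x)
    refine fun i => degLE_le fun m hm => ?_
    have hm0 : m = 0 := (Finsupp.degree_eq_zero_iff m).1 (Nat.le_zero.1 hm)
    subst hm0
    change stage b 1 (b i) _ - stage b 0 (b i) _ = 0
    change step b (stage b 0) (b i) (monomial 0 1) - _ = 0
    rw [step_of_le _ (by simp), stage, b.constr_basis, LinearMap.mulLeft_apply, sub_self]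
  | succ n ih =>
    suffices h : ∀ i, degLE k I (n + 1) ≤
        LinearMap.ker (stage b (n + 1 + 1) (b i) - stage b (n + 1) (b i)) by
      refine sub_eq_zero.1 (basis_le (b := b) (V := LinearMap.ker
        ((LinearMap.applyₗ p).comp (stage b (n + 1 + 1) - stage b (n + 1)))) (fun i => h i hp) x)
    refine fun i => degLE_le fun m hm => ?_
    change step b (stage b (n + 1)) (b i) _ - step b (stage b n) (b i) _ = 0
    rw [sub_eq_zero]
    rcases monomial_cases i m with h | ⟨j, m, h, hij, rfl⟩
    · rw [step_of_le _ h, step_of_le _ h]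
    · rw [map_add, Finsupp.degree_single] at hm
      have hmm : monomial m (1 : k) ∈ degLE k I n := monomial_mem_degLE (by omega)
      have h1 := stage_sub_mem (b := b) n (b i) hmm
      rw [lin_basis] at h1
      rw [step_of_lt _ h hij, step_of_lt _ h hij, ih _ hmm, ih _ hmm, ih _ h1]

theorem stage_eq {n n' : ℕ} (h : n ≤ n') (x : L) {p : MvPolynomial I k} (hp : p ∈ degLE k I n) :
    stage b n' x p = stage b n x p := by
  induction n', h using Nat.le_induction with
  | base => rfl
  | succ n' h ih => rw [stage_succ n' x (degLE_mono h hp), ih]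

variable (b)

/-- The action of `L` on polynomials, obtained by glueing its truncations. -/
noncomputable def act : L →ₗ[k] Module.End k (MvPolynomial I k) :=
  b.constr k fun i => (basisMonomials I k).constr k fun m => stage b m.degree (b i) (monomial m 1)

variable {b}

theorem act_eq_stage {n : ℕ} (x : L) {p : MvPolynomial I k} (hp : p ∈ degLE k I n) :
    act b x p = stage b n x p := by
  suffices h : ∀ i, degLE k I n ≤ LinearMap.ker (act b (b i) - stage b n (b i)) by
    refine sub_eq_zero.1 (basis_le (b := b) (V := LinearMap.ker
      ((LinearMap.applyₗ p).comp (act b - stage b n))) (fun i => h i hp) x)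
  refine fun i => degLE_le fun m hm => ?_
  have hb : monomial m (1 : k) = basisMonomials I k m := by simp
  change act b (b i) _ - stage b n (b i) _ = 0
  rw [sub_eq_zero, act, b.constr_basis]
  conv_lhs => rw [hb, Basis.constr_basis]
  exact (stage_eq hm _ (monomial_mem_degLE le_rfl)).symm

theorem act_sub_mem (x : L) {p : MvPolynomial I k} {d : ℕ} (hp : p ∈ degLE k I d) :
    act b x p - lin b x * p ∈ degLE k I d := by
  rw [act_eq_stage x hp]; exact stage_sub_mem d x hp

theorem act_mem (x : L) {p : MvPolynomial I k} {d : ℕ} (hp : p ∈ degLE k I d) :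
    act b x p ∈ degLE k I (d + 1) := by
  rw [act_eq_stage x hp]; exact stage_mem d x hp

theorem act_of_le {i : I} {m : I →₀ ℕ} (h : ∀ j ∈ m.support, i ≤ j) :
    act b (b i) (monomial m 1) = X i * monomial m 1 := by
  rw [act_eq_stage (n := m.degree + 1) _ (monomial_mem_degLE (Nat.le_succ _)), stage,
    step_of_le _ h]

theorem act_X_mul {i j : I} {m : I →₀ ℕ} (h : ∀ l ∈ m.support, j ≤ l) (hij : j < i) :
    act b (b i) (X j * monomial m 1) =
      X i * (X j * monomial m 1) + act b (b j) (act b (b i) (monomial m 1) - X i * monomial m 1) +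
        act b ⁅b i, b j⁆ (monomial m 1) := by
  have hX : X j * monomial m (1 : k) = monomial (Finsupp.single j 1 + m) 1 := by
    rw [X, monomial_mul, one_mul]
  have hmm : monomial m (1 : k) ∈ degLE k I m.degree := monomial_mem_degLE le_rfl
  have h1 := act_sub_mem (b := b) (b i) hmm
  rw [lin_basis] at h1
  have h4 : X j * monomial m (1 : k) ∈ degLE k I (m.degree + 1) := X_mul_mem_degLE j hmm
  rw [act_eq_stage _ h4, hX, stage, step_of_lt _ h hij, act_eq_stage _ h1, act_eq_stage _ hmm,
    act_eq_stage _ hmm, hX]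

theorem act_X_mul_eq_add {i j : I} {m : I →₀ ℕ} (h : ∀ l ∈ m.support, j ≤ l) (hij : j < i) :
    act b (b i) (X j * monomial m 1) =
      act b (b j) (act b (b i) (monomial m 1)) + act b ⁅b i, b j⁆ (monomial m 1) := by
  have hX : X i * monomial m (1 : k) = monomial (Finsupp.single i 1 + m) 1 := by
    rw [X, monomial_mul, one_mul]
  have h2 : act b (b j) (X i * monomial m 1) = X j * (X i * monomial m 1) := by
    rw [hX, act_of_le]
    intro l hl
    by_cases hil : i = l
    · exact hil ▸ hij.le
    · refine h l ?_
      simpa [hil, Finsupp.single_apply] using hl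
  rw [act_X_mul h hij, map_sub, h2]
  ring

end PBW

end

/-! ### The representation of the enveloping algebra and its symbol map -/

section

open MvPolynomial Module

namespace PBW
variable {k L I : Type*} [Field k] [LieRing L] [LieAlgebra k L] {b : Basis I k L} [LinearOrder I]

/-- It suffices to check the representation identity on pairs of basis vectors in decreasing
order. -/
theorem act_lie_of_basis {p : MvPolynomial I k}
    (h : ∀ i j, j < i → act b ⁅b i, b j⁆ p =
      act b (b i) (act b (b j) p) - act b (b j) (act b (b i) p)) (x y : L) :
    act b ⁅x, y⁆ p = act b x (act b y p) - act b y (act b x p) := by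
  have h' : ∀ i j, act b ⁅b i, b j⁆ p =
      act b (b i) (act b (b j) p) - act b (b j) (act b (b i) p) := by
    intro i j
    rcases lt_trichotomy j i with hij | rfl | hij
    · exact h i j hij
    · rw [lie_self, map_zero, LinearMap.zero_apply, sub_self]
    · rw [← lie_skew, map_neg, LinearMap.neg_apply, h j i hij, neg_sub]
  let V (y : L) : Submodule k L :=
    { carrier := {x | act b ⁅x, y⁆ p = act b x (act b y p) - act b y (act b x p)}
      add_mem' := fun {x x'} hx hx' => by
        simp only [Set.mem_ofPred_eq, add_lie, map_add, LinearMap.add_apply] at *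
        rw [hx, hx']; abel
      zero_mem' := by simp
      smul_mem' := fun c x hx => by
        simp only [Set.mem_ofPred_eq, smul_lie, map_smul, LinearMap.smul_apply] at *
        rw [hx, smul_sub] }
  let W : Submodule k L :=
    { carrier := {y | ∀ x, act b ⁅x, y⁆ p = act b x (act b y p) - act b y (act b x p)}
      add_mem' := fun {y y'} hy hy' x => by
        simp only [lie_add, map_add, LinearMap.add_apply, hy x, hy' x]; abel
      zero_mem' := by simp
      smul_mem' := fun c y hy x => by
        simp only [lie_smul, map_smul, LinearMap.smul_apply, hy x, smul_sub] }
  exact basis_le (b := b) (V := W) (fun j x => basis_le (b := b) (V := V (b j))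
    (fun i => h' i j) x) y x

/-- The operators `act b x` form a representation of `L` on the space of polynomials. -/
theorem act_lie (x y : L) (p : MvPolynomial I k) :
    act b ⁅x, y⁆ p = act b x (act b y p) - act b y (act b x p) := by
  obtain ⟨n, hp⟩ := exists_mem_degLE p
  induction n using Nat.strong_induction_on generalizing x y p with
  | h n ih =>
  let K (i j : I) : Submodule k (MvPolynomial I k) := LinearMap.ker
    (act b ⁅b i, b j⁆ - ((act b (b i)).comp (act b (b j)) - (act b (b j)).comp (act b (b i))))
  have hK : ∀ i j q, q ∈ K i j ↔ act b ⁅b i, b j⁆ q =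
      act b (b i) (act b (b j) q) - act b (b j) (act b (b i) q) :=
    fun i j q => sub_eq_zero
  -- If `j` is at most all letters of the monomial, the identity is the definition of the action.
  have base : ∀ {i j : I} {m : I →₀ ℕ}, j < i → (∀ l ∈ m.support, j ≤ l) →
      monomial m (1 : k) ∈ K i j := by
    intro i j m hij h
    rw [hK, act_of_le h, act_X_mul_eq_add h hij]
    abel
  refine act_lie_of_basis (fun i j hij => ?_) x y
  suffices h : degLE k I n ≤ K i j from (hK i j p).1 (h hp)
  refine degLE_le fun m hm => ?_
  rcases monomial_cases j m with h | ⟨l, m, h, hlj, rfl⟩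
  · exact base hij h
  · have hX : ∀ j, X j * monomial m (1 : k) = monomial (Finsupp.single j 1 + m) 1 := fun j => by
      rw [X, monomial_mul, one_mul]
    rw [map_add, Finsupp.degree_single] at hm
    have hz : monomial m (1 : k) ∈ degLE k I m.degree := monomial_mem_degLE le_rfl
    have hd : m.degree < n := by omega
    have hc : X l * monomial m (1 : k) = act b (b l) (monomial m 1) := (act_of_le h).symm
    -- The identity for `i'` and `l` holds for `act b (b j') (monomial m 1)`: its principal part
    -- is the monomial `X_j' m`, all of whose letters are at least `l`.
    have key : ∀ i' j', l < i' → l < j' →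
        act b ⁅b i', b l⁆ (act b (b j') (monomial m 1)) =
          act b (b i') (act b (b l) (act b (b j') (monomial m 1))) -
            act b (b l) (act b (b i') (act b (b j') (monomial m 1))) := by
      intro i' j' hi hj
      rw [← hK]
      have h1 := act_sub_mem (b := b) (b j') hz
      rw [lin_basis] at h1
      have h2 : X j' * monomial m (1 : k) ∈ K i' l := by
        rw [hX]
        refine base hi fun t ht => ?_
        by_cases hjt : j' = t
        · exact hjt ▸ hj.le
        · refine h t ?_
          simpa [hjt, Finsupp.single_apply] using ht
      have h3 := add_mem ((hK _ _ _).2 (ih _ hd (b i') (b l) _ h1)) h2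
      rwa [sub_add_cancel] at h3
    rw [hK, ← hX l, hc]
    -- Expanding `X_l = act b (b l)` with the identities in lower degree, the remaining terms cancel
    -- by the Jacobi identity `e9`.
    have e1 := ih _ hd (b j) (b l) _ hz
    have e2 := ih _ hd (b i) (b l) _ hz
    have e3 := key i j (hlj.trans hij) hlj
    have e4 := key j i hlj (hlj.trans hij)
    have e5 := ih _ hd (b i) ⁅b j, b l⁆ _ hz
    have e6 := ih _ hd (b j) ⁅b i, b l⁆ _ hz
    have e7 := ih _ hd ⁅b i, b j⁆ (b l) _ hz
    have e8 := congrArg (act b (b l)) (ih _ hd (b i) (b j) _ hz)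
    have e9 := congrArg (fun x => act b x (monomial m 1)) (leibniz_lie (b i) (b j) (b l))
    have e10 := congrArg (act b (b i)) e1
    have e11 := congrArg (act b (b j)) e2
    simp only [map_add, map_sub, LinearMap.add_apply] at e8 e9 e10 e11
    linear_combination (-1 : MvPolynomial I k) * e7 + e8 - e9 + e5 - e6 + e10 - e11 + e3 - e4

theorem act_one (x : L) : act b x 1 = lin b x := by
  refine sub_eq_zero.1 (basis_le (b := b) (V := LinearMap.ker
    ((LinearMap.applyₗ (1 : MvPolynomial I k)).comp (act b) - lin b)) (fun i => ?_) x)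
  change act b (b i) 1 - lin b (b i) = 0
  have h := act_of_le (b := b) (i := i) (m := 0) (by simp)
  rw [monomial_zero', map_one, mul_one] at h
  rw [h, lin_basis, sub_self]

/-- If the basis vectors indexed by the upper set `s` span a Lie subalgebra, then the ideal of
polynomials generated by the corresponding variables is stable under `L`. -/
theorem act_mem_varSpan {s : Set I} (hs : IsUpperSet s)
    (hP : ∀ i ∈ s, ∀ j ∈ s, ⁅b i, b j⁆ ∈ Submodule.span k (b '' s)) (x : L)
    {p : MvPolynomial I k} (hp : p ∈ varSpan k s) : act b x p ∈ varSpan k s := by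
  obtain ⟨n, hn⟩ := exists_mem_degLE p
  induction n using Nat.strong_induction_on generalizing x p with
  | h n ih =>
  refine basis_le (b := b)
    (V := (varSpan k s).comap ((LinearMap.applyₗ p).comp (act b))) (fun i => ?_) x
  refine varSpan_inf_degLE_le (W := (varSpan k s).comap (act b (b i))) (fun m hm hmn => ?_) hp hn
  change act b (b i) (monomial m 1) ∈ varSpan k s
  have hmem := monomial_mem_varSpan (k := k) hm
  rcases monomial_cases i m with h | ⟨j, m, h, hji, rfl⟩
  · rw [act_of_le h]
    exact X_mul_mem_varSpan _ hmem
  · have hX : X j * monomial m (1 : k) = monomial (Finsupp.single j 1 + m) 1 := by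
      rw [X, monomial_mul, one_mul]
    rw [map_add, Finsupp.degree_single] at hmn
    rw [← hX] at hmem ⊢
    rw [act_X_mul h hji]
    have hz : monomial m (1 : k) ∈ degLE k I m.degree := monomial_mem_degLE le_rfl
    have hd : m.degree < n := by omega
    rw [add_assoc]
    refine add_mem (X_mul_mem_varSpan _ hmem) ?_
    by_cases hm' : ∃ i ∈ s, m i ≠ 0
    · have hzs := monomial_mem_varSpan (k := k) hm'
      have h1 := act_sub_mem (b := b) (b i) hz
      rw [lin_basis] at h1
      exact add_mem (ih _ hd (b j) (sub_mem (ih _ hd (b i) hzs hz) (X_mul_mem_varSpan _ hzs)) h1)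
        (ih _ hd _ hzs hz)
    · push Not at hm'
      -- Here `j` is the only letter of the monomial in `s`, and it is its smallest letter.
      have hj : j ∈ s := by
        obtain ⟨l, hl, hne⟩ := hm
        by_cases hjl : j = l
        · exact hjl ▸ hl
        · refine absurd (hm' l hl) ?_
          simpa [hjl, Finsupp.single_apply] using hne
      have h0 : m = 0 := by
        ext l
        by_contra hl
        exact hl (hm' l (hs (h l (Finsupp.mem_support_iff.2 hl)) hj))
      subst h0
      have h2 := act_of_le (b := b) (i := i) (m := 0) (by simp)
      rw [h2, sub_self, map_zero, zero_add, monomial_zero', map_one, act_one]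
      exact lin_mem_varSpan (hP i (hs hji.le hj) j hj)

section Rep

attribute [local instance 100] LieRing.ofAssociativeRing

variable (b)

/-- The representation of `U(L)` on the space of polynomials. -/
noncomputable def rep : Env k L →ₐ[k] Module.End k (MvPolynomial I k) :=
  (UniversalEnvelopingAlgebra.lift k
    ({ act b with
        map_lie' := fun {x y} => LinearMap.ext fun p => act_lie x y p } :
      L →ₗ⁅k⁆ Module.End k (MvPolynomial I k)) :
    UniversalEnvelopingAlgebra k L →ₐ[k] Module.End k (MvPolynomial I k))

theorem rep_ι (x : L) : rep b (Env.ι k L x) = act b x :=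
  UniversalEnvelopingAlgebra.lift_ι_apply k _ x

end Rep

end PBW

namespace TopAlg
variable {k L : Type*} [Field k] [LieRing L] [LieAlgebra k L]

theorem Env.induction {p : Env k L → Prop} (algebraMap : ∀ c, p (algebraMap k _ c))
    (ι : ∀ x, p (Env.ι k L x)) (add : ∀ u v, p u → p v → p (u + v))
    (mul : ∀ u v, p u → p v → p (u * v)) (u : Env k L) : p u := by
  have hu : u ∈ Algebra.adjoin k (Set.range (Env.ι k L)) := by
    rw [Env.adjoin_range_ι]; trivial
  induction hu using Algebra.adjoin_induction with
  | mem x hx => obtain ⟨l, rfl⟩ := hx; exact ι l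
  | algebraMap c => exact algebraMap c
  | add x y _ _ hx hy => exact add x y hx hy
  | mul x y _ _ hx hy => exact mul x y hx hy

variable (k L) in
/-- The term before `U(L)_n` in the standard filtration, with `U(L)_{-1} = 0`. -/
def Env.filPrev : ℕ → Submodule k (Env k L)
  | 0 => ⊥
  | n + 1 => Env.fil k L n

end TopAlg

namespace PBW
variable {k L I : Type*} [Field k] [LieRing L] [LieAlgebra k L] {b : Basis I k L} [LinearOrder I]

variable (k I) in
/-- The space of polynomials of total degree less than `n`. -/
noncomputable def degLT : ℕ → Submodule k (MvPolynomial I k)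
  | 0 => ⊥
  | n + 1 => degLE k I n

variable (b) in
/-- The symbol map `u ↦ u · 1` from `U(L)` to polynomials. -/
noncomputable def symbol : Env k L →ₗ[k] MvPolynomial I k :=
  (LinearMap.applyₗ (1 : MvPolynomial I k)).comp (rep b).toLinearMap

theorem symbol_ι_mul (x : L) (u : Env k L) :
    symbol b (Env.ι k L x * u) = act b x (symbol b u) := by
  change rep b (Env.ι k L x * u) 1 = act b x (rep b u 1)
  rw [map_mul, rep_ι]; rfl

theorem symbol_algebraMap (c : k) : symbol b (algebraMap k _ c) = C c := by
  change rep b (algebraMap k _ c) 1 = _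
  rw [AlgHom.commutes, Module.algebraMap_end_apply, MvPolynomial.smul_eq_C_mul, mul_one]

theorem symbol_ι (x : L) : symbol b (Env.ι k L x) = lin b x := by
  change rep b (Env.ι k L x) 1 = _
  rw [rep_ι, act_one]

theorem rep_mem_degLE {n d : ℕ} {u : Env k L} (hu : u ∈ Env.fil k L n) {p : MvPolynomial I k}
    (hp : p ∈ degLE k I d) : rep b u p ∈ degLE k I (n + d) := by
  induction n generalizing u p d with
  | zero =>
    rw [Env.fil_zero] at hu
    obtain ⟨c, rfl⟩ := Submodule.mem_one.1 hu
    rw [AlgHom.commutes, Module.algebraMap_end_apply, zero_add]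
    exact Submodule.smul_mem _ _ hp
  | succ n ih =>
    rw [Env.fil_succ] at hu
    induction hu using Submodule.mul_induction_on' with
    | mem_mul_mem u hu v hv =>
      rw [map_mul, Module.End.mul_apply, add_assoc, add_comm 1 d]
      refine ih hu ?_
      rw [Env.fil_one] at hv
      obtain ⟨c, hc, _, ⟨x, rfl⟩, rfl⟩ := Submodule.mem_sup.1 hv
      obtain ⟨c, rfl⟩ := Submodule.mem_one.1 hc
      rw [map_add, LinearMap.add_apply, AlgHom.commutes, Module.algebraMap_end_apply, rep_ι]
      exact add_mem (Submodule.smul_mem _ _ (degLE_mono d.le_succ hp)) (act_mem x hp)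
    | add u _ v _ hu hv =>
      rw [map_add, LinearMap.add_apply]
      exact add_mem hu hv

theorem symbol_mem_degLE {n : ℕ} {u : Env k L} (hu : u ∈ Env.fil k L n) :
    symbol b u ∈ degLE k I n :=
  rep_mem_degLE hu one_mem_degLE

theorem symbol_mem_degLT {n : ℕ} {u : Env k L} (hu : u ∈ Env.filPrev k L n) :
    symbol b u ∈ degLT k I n := by
  cases n with
  | zero =>
    have h : u = 0 := hu
    rw [h, map_zero]; exact zero_mem _
  | succ n => exact symbol_mem_degLE hu

theorem list_prod_mem_fil (l : List L) : (l.map (Env.ι k L)).prod ∈ Env.fil k L l.length := by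
  induction l with
  | nil =>
    change 1 ∈ Env.fil k L 0
    rw [Env.fil_zero]; exact Submodule.one_le.1 le_rfl
  | cons x l ih =>
    rw [List.map_cons, List.prod_cons, List.length_cons, add_comm, Env.fil_add, Env.fil_one]
    exact Submodule.mul_mem_mul (Submodule.mem_sup_right ⟨x, rfl⟩) ih

/-- The principal part of the symbol of a product of elements of `L` is the product of the
corresponding linear polynomials. -/
theorem symbol_list_prod (l : List L) :
    symbol b (l.map (Env.ι k L)).prod - (l.map (lin b)).prod ∈ degLT k I l.length := by
  induction l with
  | nil =>
    have h : symbol b (1 : Env k L) = 1 := by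
      rw [← map_one (algebraMap k (Env k L)), symbol_algebraMap, map_one]
    simp only [List.map_nil, List.prod_nil, h, sub_self]
    exact zero_mem _
  | cons x l ih =>
    simp only [List.map_cons, List.prod_cons, symbol_ι_mul, List.length_cons]
    have h1 := act_sub_mem (b := b) x (symbol_mem_degLE (b := b) (list_prod_mem_fil (k := k) l))
    have h2 : lin b x * (symbol b (l.map (Env.ι k L)).prod - (l.map (lin b)).prod) ∈
        degLE k I l.length := by
      generalize l.length = n at ih
      cases n with
      | zero =>
        have h : symbol b (l.map (Env.ι k L)).prod - (l.map (lin b)).prod = 0 := ih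
        rw [h, mul_zero]; exact zero_mem _
      | succ n => exact lin_mul_mem x ih
    have h3 := add_mem h1 h2
    rwa [mul_sub, sub_add_sub_cancel] at h3

theorem rep_mem_varSpan {s : Set I} (hs : IsUpperSet s)
    (hP : ∀ i ∈ s, ∀ j ∈ s, ⁅b i, b j⁆ ∈ Submodule.span k (b '' s)) (u : Env k L)
    {p : MvPolynomial I k} (hp : p ∈ varSpan k s) : rep b u p ∈ varSpan k s := by
  induction u using Env.induction generalizing p with
  | algebraMap c =>
    rw [AlgHom.commutes, Module.algebraMap_end_apply]
    exact Submodule.smul_mem _ _ hp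
  | ι x => rw [rep_ι]; exact act_mem_varSpan hs hP x hp
  | add u v hu hv => rw [map_add, LinearMap.add_apply]; exact add_mem (hu hp) (hv hp)
  | mul u v hu hv => rw [map_mul, Module.End.mul_apply]; exact hu (hv hp)

/-- The symbol of an element of `U(L) P` lies in the ideal generated by the variables of `P`. -/
theorem symbol_mem_varSpan {s : Set I} (hs : IsUpperSet s)
    (hP : ∀ i ∈ s, ∀ j ∈ s, ⁅b i, b j⁆ ∈ Submodule.span k (b '' s)) {P : Submodule k L}
    (hPs : P ≤ Submodule.span k (b '' s)) {u : Env k L} (hu : u ∈ Env.leftIdeal k L P) :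
    symbol b u ∈ varSpan k s := by
  induction hu using Submodule.span_induction with
  | mem u hu =>
    obtain ⟨x, hx, rfl⟩ := hu
    rw [symbol_ι]
    exact lin_mem_varSpan (hPs hx)
  | zero => rw [map_zero]; exact zero_mem _
  | add u v _ _ hu hv => rw [map_add]; exact add_mem hu hv
  | smul r u _ hu =>
    change rep b (r * u) 1 ∈ _
    rw [map_mul, Module.End.mul_apply]
    exact rep_mem_varSpan hs hP r hu

end PBW

end

/-! ### Completions, adapted bases, admissibility and the universal property -/

section

open MvPolynomial Module

namespace PBW

variable {k : Type u} {L : Type v} [Field k] [LieRing L] [LieAlgebra k L]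

/-- A basis of `L` adapted to a Lie subalgebra `P`: the basis vectors which lie in `P` span `P`, and
they come last. -/
theorem exists_adapted_basis (P : LieSubalgebra k L) :
    ∃ (I : Type v) (_ : LinearOrder I) (b : Basis I k L) (s : Set I), IsUpperSet s ∧
      Submodule.span k (b '' s) = P.toSubmodule ∧
      ∀ i ∈ s, ∀ j ∈ s, ⁅b i, b j⁆ ∈ Submodule.span k (b '' s) := by
  suffices h : ∃ (I : Type v) (_ : LinearOrder I) (b : Basis I k L) (s : Set I), IsUpperSet s ∧
      Submodule.span k (b '' s) = P.toSubmodule by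
    obtain ⟨I, hI, b, s, hs, hsP⟩ := h
    have hbP : ∀ i ∈ s, b i ∈ P.toSubmodule := fun i hi =>
      hsP ▸ Submodule.subset_span ⟨i, hi, rfl⟩
    exact ⟨I, hI, b, s, hs, hsP, fun i hi j hj => hsP ▸ P.lie_mem (hbP i hi) (hbP j hj)⟩
  generalize P.toSubmodule = P
  obtain ⟨Q, hQ⟩ := P.exists_isCompl
  let bQ := Basis.ofVectorSpace k Q
  let bP := Basis.ofVectorSpace k P
  let : LinearOrder (Basis.ofVectorSpaceIndex k Q) := WellOrderingRel.isWellOrder.linearOrder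
  let : LinearOrder (Basis.ofVectorSpaceIndex k P) := WellOrderingRel.isWellOrder.linearOrder
  let b : Basis (Basis.ofVectorSpaceIndex k Q ⊕ₗ Basis.ofVectorSpaceIndex k P) k L :=
    ((bQ.prod bP).map (Submodule.prodEquivOfIsCompl Q P hQ.symm)).reindex toLex
  have hb : ∀ i, b (toLex (Sum.inr i)) = bP i := fun i => by simp [b]
  refine ⟨_, inferInstance, b, Set.range fun i => toLex (Sum.inr i), ?_, ?_⟩
  · rintro _ j hij ⟨i, rfl⟩
    obtain ⟨j, rfl⟩ := toLex.surjective j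
    rcases j with j | j
    · exact absurd hij (Sum.Lex.not_inr_le_inl)
    · exact ⟨j, rfl⟩
  · rw [← Set.range_comp]
    have : (b ∘ fun i => toLex (Sum.inr i)) = P.subtype ∘ bP := funext hb
    rw [this, Set.range_comp, Submodule.span_image, bP.span_eq, Submodule.map_top,
      Submodule.range_subtype]

end PBW

namespace TopAlg

/-- A homomorphism of topological groups with dense image which induces the topology of its source
identifies any complete separated group which contains it with the completion. -/
theorem isHomeomorph_of_isInducing_comp_coe {T B : Type*} [AddCommGroup T] [UniformSpace T]
    [IsUniformAddGroup T] [AddCommGroup B] [UniformSpace B] [IsUniformAddGroup B] [CompleteSpace B]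
    [T2Space B] (f : T →+ B) (hf : IsInducing f) (hd : DenseRange f)
    (g : Completion T → B) (hg : Continuous g) (hgf : ∀ t : T, g t = f t) : IsHomeomorph g := by
  let pkg : AbstractCompletion T := ⟨B, f, ‹_›, ‹_›, inferInstance,
    AddMonoidHom.isUniformInducing_of_isInducing hf, hd⟩
  let e : Completion T ≃ᵤ B := (Completion.cPkg (α := T)).compareEquiv pkg
  have h : g = e := by
    refine Completion.ext hg e.continuous fun t => ?_
    rw [hgf]
    exact ((Completion.cPkg (α := T)).compare_coe pkg t).symm
  rw [h]
  exact e.toHomeomorph.isHomeomorph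

/-- A homomorphism of topological groups is inducing if it is continuous and the neighbourhoods of
zero can be recovered. -/
theorem isInducing_of_nhds_zero {T B : Type*} [AddGroup T] [TopologicalSpace T]
    [IsTopologicalAddGroup T] [AddGroup B] [TopologicalSpace B] [IsTopologicalAddGroup B]
    (f : T →+ B) (hf : Continuous f) (h : ∀ U ∈ 𝓝 (0 : T), ∃ V ∈ 𝓝 (0 : B), f ⁻¹' V ⊆ U) :
    IsInducing f := by
  rw [IsTopologicalAddGroup.isInducing_iff_nhds_zero]
  refine le_antisymm ?_ fun U hU => ?_
  · rw [← Filter.map_le_iff_le_comap]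
    exact (hf.tendsto 0).trans_eq (by rw [map_zero])
  · obtain ⟨V, hV, hVU⟩ := h U hU
    exact ⟨V, hV, hVU⟩

theorem isOpen_of_basis {T ι : Type*} [Ring T] [Nonempty ι] {B : ι → Ideal T}
    (hB : RingSubgroupsBasis fun i => (B i).toAddSubgroup) (i : ι) :
    @IsOpen T (basisUniformSpace hB).toTopologicalSpace (B i) := by
  let := basisUniformSpace hB
  have := basis_isUniformAddGroup hB
  exact AddSubgroup.isOpen_of_mem_nhds (B i).toAddSubgroup
    ((basis_hasBasis hB).mem_of_mem (i := i) trivial)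

section ClosureIdeal

variable {T : Type*} [Ring T] [UniformSpace T] [IsUniformAddGroup T] [IsTopologicalRing T]

/-- The closure of a left ideal in the completion of a topological ring. -/
noncomputable def closureIdeal (I : Ideal T) : Ideal (Completion T) :=
  { (I.toAddSubgroup.map (Completion.toCompl (α := T))).topologicalClosure with
    smul_mem' := fun r x hx => by
      change r * x ∈ closure (((↑) : T → Completion T) '' (I : Set T))
      induction r using Completion.induction_on with
      | hp => exact isClosed_closure.preimage (continuous_mul_const x)
      | ih r =>
        refine map_mem_closure (continuous_const_mul (r : Completion T)) hx ?_
        rintro _ ⟨y, hy, rfl⟩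
        exact ⟨r * y, I.mul_mem_left r hy, Completion.coe_mul r y⟩ }

theorem isOpen_closureIdeal {I : Ideal T} (hI : IsOpen (I : Set T)) :
    IsOpen (closureIdeal I : Set (Completion T)) := by
  have h := Completion.isDenseInducing_coe.closure_image_mem_nhds (hI.mem_nhds (zero_mem I))
  rw [Completion.coe_zero] at h
  exact (closureIdeal I).toAddSubgroup.isOpen_of_mem_nhds h

theorem coe_mem_closureIdeal {I : Ideal T} (hI : IsOpen (I : Set T)) {x : T} :
    (x : Completion T) ∈ closureIdeal I ↔ x ∈ I := by
  have h := (Completion.isDenseInducing_coe (α := T)).isInducing.closure_eq_preimage_closure_image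
    (I : Set T)
  have hc : IsClosed (I : Set T) := I.toAddSubgroup.isClosed_of_isOpen hI
  rw [hc.closure_eq] at h
  exact (Set.ext_iff.1 h x).symm

/-- If the open left ideals `I i` form a base of a topology, so do their closures in the
completion. -/
theorem exists_closureIdeal_subset {ι : Sort*} {I : ι → Ideal T}
    (hI : ∀ U ∈ 𝓝 (0 : T), ∃ i, (I i : Set T) ⊆ U) {U : Set (Completion T)}
    (hU : U ∈ 𝓝 0) : ∃ i, (closureIdeal (I i) : Set (Completion T)) ⊆ U := by
  obtain ⟨V, ⟨hV, hVc⟩, hVU⟩ := (closed_nhds_basis (0 : Completion T)).mem_iff.1 hU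
  have h : ((↑) : T → Completion T) ⁻¹' V ∈ 𝓝 0 := by
    refine (Completion.continuous_coe T).continuousAt.preimage_mem_nhds ?_
    rwa [Completion.coe_zero]
  obtain ⟨i, hi⟩ := hI _ h
  exact ⟨i, (closure_minimal (Set.image_subset_iff.2 hi) hVc).trans hVU⟩

end ClosureIdeal

section Hat

variable {k L : Type*} [Field k] [LieRing L] [LieAlgebra k L] [TopologicalSpace L]
  [IsTopologicalLieStarAlgebra k L]

variable (k L) in
/-- The closure in `U^ch(L)` of the left ideal `U(L) P`. -/
noncomputable def ChiralEnv.hat (P : Submodule k L) : Ideal (ChiralEnv k L) :=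
  closureIdeal (Env.leftIdeal k L P)

theorem Env.isOpen_leftIdeal {P : Submodule k L} (hP : IsOpen (P : Set L)) :
    IsOpen (Env.leftIdeal k L P : Set (Env k L)) :=
  isOpen_of_basis (B := fun P : {P : Submodule k L // IsOpen (P : Set L)} =>
    Env.leftIdeal k L P.1) (Env.basis k L) ⟨P, hP⟩

theorem ChiralEnv.isOpen_hat {P : Submodule k L} (hP : IsOpen (P : Set L)) :
    IsOpen (ChiralEnv.hat k L P : Set (ChiralEnv k L)) :=
  isOpen_closureIdeal (Env.isOpen_leftIdeal hP)

theorem ChiralEnv.coe_mem_hat {P : Submodule k L} (hP : IsOpen (P : Set L)) {u : Env k L} :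
    (u : ChiralEnv k L) ∈ ChiralEnv.hat k L P ↔ u ∈ Env.leftIdeal k L P :=
  coe_mem_closureIdeal (Env.isOpen_leftIdeal hP)

theorem exists_open_lieSubalgebra_le {P : Submodule k L} (hP : IsOpen (P : Set L)) :
    ∃ Q : LieSubalgebra k L, IsOpen (Q : Set L) ∧ Q.toSubmodule ≤ P := by
  obtain ⟨Q, hQ, hQP⟩ := IsTopologicalLieStarAlgebra.exists_subalgebra (k := k) (L := L) P
    (hP.mem_nhds (zero_mem P))
  exact ⟨Q, hQ, hQP⟩

/-- The left ideals generated by open Lie subalgebras form a base of the topology of `U^ch(L)`. -/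
theorem ChiralEnv.exists_hat_subset {U : Set (ChiralEnv k L)} (hU : U ∈ 𝓝 0) :
    ∃ P : LieSubalgebra k L, IsOpen (P : Set L) ∧
      (ChiralEnv.hat k L P.toSubmodule : Set (ChiralEnv k L)) ⊆ U := by
  obtain ⟨P, hP⟩ := exists_closureIdeal_subset
    (I := fun P : {P : LieSubalgebra k L // IsOpen (P : Set L)} =>
      Env.leftIdeal k L P.1.toSubmodule) (fun V hV => by
      obtain ⟨P, -, hP⟩ := (basis_hasBasis (Env.basis k L)).mem_iff.1 hV
      obtain ⟨Q, hQ, hQP⟩ := exists_open_lieSubalgebra_le P.2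
      have hle : Env.leftIdeal k L Q.toSubmodule ≤ Env.leftIdeal k L P.1 :=
        Ideal.span_mono (Set.image_mono hQP)
      exact ⟨⟨Q, hQ⟩, fun x hx => hP (hle hx)⟩) hU
  exact ⟨P.1, P.2, hP⟩

/-- Modulo an open left ideal, `U^ch(L)_n` is the image of `U(L)_n`. -/
theorem exists_fil_sub_mem {n : ℕ} {a : ChiralEnv k L} (ha : a ∈ (stdFiltration k L).fil n)
    {I : Set (ChiralEnv k L)} (hI : I ∈ 𝓝 0) : ∃ u ∈ Env.fil k L n, a - u ∈ I := by
  have h : (fun x => a - x) ⁻¹' I ∈ 𝓝 a := by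
    refine (continuous_const.sub continuous_id).continuousAt.preimage_mem_nhds ?_
    simpa using hI
  obtain ⟨_, hx, u, hu, rfl⟩ := mem_closure_iff_nhds.1 (show a ∈ closure _ from ha) _ h
  exact ⟨u, hu, hx⟩

theorem coe_mem_stdFiltration {n : ℕ} {u : Env k L} (hu : u ∈ Env.fil k L n) :
    (u : ChiralEnv k L) ∈ (stdFiltration k L).fil n :=
  subset_closure ⟨u, hu, rfl⟩

theorem ChiralEnv.ι_lie (x y : L) : ChiralEnv.ι k L ⁅x, y⁆ =
    ChiralEnv.ι k L x * ChiralEnv.ι k L y - ChiralEnv.ι k L y * ChiralEnv.ι k L x := by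
  change ((Env.ι k L ⁅x, y⁆ : Env k L) : ChiralEnv k L) = _
  rw [Env.ι_lie, Completion.coe_sub, Completion.coe_mul, Completion.coe_mul]
  rfl

/-- Admissibility: a left ideal of `U^ch(L)_∞` whose trace on `U^ch(L)_1` is open contains `ι P`
for an open subspace `P`, hence the trace of the closure of `U(L) P`. -/
theorem stdFiltration_isAdmissible [IsTopologicalAddGroup L] :
    (stdFiltration k L).IsAdmissible := by
  let F := stdFiltration k L
  have key : ∀ u : Env k L, (u : ChiralEnv k L) ∈ F.inftyPart := fun u => by
    obtain ⟨n, hn⟩ := Env.exists_mem_fil k L u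
    exact Set.mem_iUnion.2 ⟨n, coe_mem_stdFiltration hn⟩
  let j : Env k L →+* F.Infty :=
    { toFun := fun u => (⟨u, key u⟩ : F.inftyPart)
      map_one' := rfl
      map_mul' := fun u v => Subtype.ext (Completion.coe_mul u v)
      map_zero' := rfl
      map_add' := fun u v => Subtype.ext (Completion.coe_add u v) }
  refine isHomeomorph_of_isInducing_comp_coe (F.inftyVal : F.Infty →+ ChiralEnv k L) ?_ ?_ _
    Completion.continuous_extension (fun t => Completion.extensionHom_coe _ F.continuous_inftyVal t)
  · refine isInducing_of_nhds_zero _ F.continuous_inftyVal fun V hV => ?_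
    obtain ⟨I, -, hIV⟩ := (basis_hasBasis F.infty_basis).mem_iff.1 hV
    let g : L → F.fil 1 := fun x => ⟨ChiralEnv.ι k L x, ChiralEnv.ι_mem k L x⟩
    have hg : Continuous g := (ChiralEnv.continuous_ι k L).subtype_mk _
    have hgI : g ⁻¹' {a : F.fil 1 | F.toInfty 1 a ∈ I.1} ∈ 𝓝 0 := by
      refine ((I.2 1).preimage hg).mem_nhds ?_
      have h0 : F.toInfty 1 (g 0) = 0 := Subtype.ext (map_zero (ChiralEnv.ι k L))
      change F.toInfty 1 (g 0) ∈ I.1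
      rw [h0]; exact zero_mem _
    obtain ⟨P, hP, hPI⟩ :=
      IsTopologicalLieStarAlgebra.exists_subalgebra (k := k) (L := L) _ hgI
    have hle : Env.leftIdeal k L P.toSubmodule ≤ I.1.comap j := by
      refine Ideal.span_le.2 ?_
      rintro _ ⟨x, hx, rfl⟩
      exact hPI hx
    refine ⟨ChiralEnv.hat k L P.toSubmodule,
      (ChiralEnv.isOpen_hat hP).mem_nhds (zero_mem _), fun x hx => hIV ?_⟩
    obtain ⟨n, hn⟩ := Set.mem_iUnion.1
      (show (x : F.inftyPart).1 ∈ ⋃ n, (F.fil n : Set (ChiralEnv k L)) from x.2)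
    have hopen : ∃ W ∈ 𝓝 (0 : ChiralEnv k L), ∀ (a : ChiralEnv k L) (ha : a ∈ F.fil n),
        a ∈ W → F.toInfty n ⟨a, ha⟩ ∈ I.1 := by
      have h1 : {a : F.fil n | F.toInfty n a ∈ I.1} ∈ 𝓝 (0 : F.fil n) :=
        (I.2 n).mem_nhds (show F.toInfty n 0 ∈ I.1 from zero_mem I.1)
      rw [nhds_subtype_eq_comap] at h1
      obtain ⟨W, hW, hWI⟩ := h1
      exact ⟨W, hW, fun a ha haW => hWI (show (⟨a, ha⟩ : F.fil n) ∈ Subtype.val ⁻¹' W from haW)⟩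
    obtain ⟨W, hW, hWI⟩ := hopen
    obtain ⟨u, hu, hxu⟩ := exists_fil_sub_mem hn
      (Filter.inter_mem hW ((ChiralEnv.isOpen_hat hP).mem_nhds (zero_mem _)))
    have hu' : u ∈ Env.leftIdeal k L P.toSubmodule := by
      rw [← ChiralEnv.coe_mem_hat hP]
      have h2 := sub_mem (show (x : F.inftyPart).1 ∈ ChiralEnv.hat k L P.toSubmodule from hx) hxu.2
      rwa [sub_sub_cancel] at h2
    have h3 := add_mem (hWI _ (sub_mem hn (coe_mem_stdFiltration hu)) hxu.1) (hle hu')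
    have h4 : F.toInfty n ⟨_, sub_mem hn (coe_mem_stdFiltration hu)⟩ + j u = x :=
      Subtype.ext (sub_add_cancel _ _)
    change x ∈ I.1
    rwa [← h4]
  · refine F.dense.mono ?_
    intro x hx
    exact ⟨(⟨x, hx⟩ : F.inftyPart), rfl⟩

section UniversalProperty

attribute [local instance 100] LieRing.ofAssociativeRing

/-- The universal property of the chiral enveloping algebra. -/
theorem ChiralEnv.existsUnique_lift {B : Type*} [Ring B] [Algebra k B] [UniformSpace B]
    [IsTopologicalChiralAlgebra B] (f : L →ₗ[k] B) (hf : Continuous f)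
    (hlie : ∀ x y : L, f ⁅x, y⁆ = f x * f y - f y * f x) :
    ∃! g : ChiralEnv k L →ₐ[k] B, Continuous g ∧ ∀ x, g (ChiralEnv.ι k L x) = f x := by
  let f' : L →ₗ⁅k⁆ B := { f with map_lie' := fun {x y} => hlie x y }
  let h : Env k L →ₐ[k] B :=
    (UniversalEnvelopingAlgebra.lift k f' : UniversalEnvelopingAlgebra k L →ₐ[k] B)
  have hι : ∀ x, h (Env.ι k L x) = f x := UniversalEnvelopingAlgebra.lift_ι_apply k f'
  have hc : Continuous h := by
    refine continuous_of_continuousAt_zero h ?_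
    rw [ContinuousAt, map_zero]
    intro U hU
    obtain ⟨I, hI, hIU⟩ := exists_open_leftIdeal hU
    have hle : Env.leftIdeal k L ((I.restrictScalars k).comap f) ≤ I.comap h := by
      refine Ideal.span_le.2 ?_
      rintro _ ⟨x, hx, rfl⟩
      change h (Env.ι k L x) ∈ I
      rw [hι]; exact hx
    refine Filter.mem_map.2 (Filter.mem_of_superset
      ((basis_hasBasis (Env.basis k L)).mem_of_mem
        (i := ⟨(I.restrictScalars k).comap f, hI.preimage hf⟩) trivial) ?_)
    exact fun x hx => hIU (hle hx)
  let g : ChiralEnv k L →ₐ[k] B :=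
    { Completion.extensionHom (h : Env k L →+* B) hc with
      commutes' := fun c =>
        (Completion.extensionHom_coe (h : Env k L →+* B) hc _).trans (h.commutes c) }
  refine ⟨g, ⟨Completion.continuous_extension, fun x =>
    (Completion.extensionHom_coe (h : Env k L →+* B) hc _).trans (hι x)⟩, ?_⟩
  rintro g' ⟨hg', hg'ι⟩
  refine AlgHom.ext fun x => ?_
  refine congrFun (Completion.ext (f := g') (g := g) hg' Completion.continuous_extension
    fun u => ?_) x
  refine Eq.trans ?_ (Completion.extensionHom_coe (h : Env k L →+* B) hc u).symm
  induction u using Env.induction with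
  | algebraMap c => exact (g'.commutes c).trans (h.commutes c).symm
  | ι x => exact (hg'ι x).trans (hι x).symm
  | add u v hu hv =>
    rw [Completion.coe_add, map_add, map_add, hu, hv]
  | mul u v hu hv =>
    rw [Completion.coe_mul, map_mul, map_mul, hu, hv]

end UniversalProperty

end Hat

end TopAlg

end

/-! ### The symmetric algebra and the graded algebra -/

section

open MvPolynomial Module

namespace TopAlg

namespace ChiralFiltration

variable {k A : Type*} [Field k] [Ring A] [Algebra k A] [UniformSpace A]
  (F : ChiralFiltration k A)

theorem comp_of_self (n : ℕ) (x : F.gr n) : F.comp (F.of n x) n = x :=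
  DirectSum.of_eq_same _ _

theorem comp_of_of_ne {m n : ℕ} (h : m ≠ n) (x : F.gr m) : F.comp (F.of m x) n = 0 :=
  DirectSum.of_eq_of_ne m n _ h.symm

theorem smul_of_cls (c : k) {n : ℕ} {a : A} (ha : a ∈ F.fil n) :
    c • F.of n (F.cls n a ha) = F.of n (F.cls n (c • a) (Submodule.smul_mem _ c ha)) := by
  rw [Algebra.smul_def]
  refine (F.of_cls_mul (F.zeroPart.algebraMap_mem c) ha).trans ?_
  exact F.of_congr (zero_add n) (Algebra.smul_def c a).symm _ _

end ChiralFiltration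

section SymPoly

variable {k L I : Type*} [Field k]

theorem SymAlg.induction {R M : Type*} [CommRing R] [AddCommGroup M] [Module R M]
    {p : SymAlg R M → Prop} (algebraMap : ∀ r, p (algebraMap R _ r)) (ι : ∀ x, p (SymAlg.ι R M x))
    (mul : ∀ x y, p x → p y → p (x * y)) (add : ∀ x y, p x → p y → p (x + y))
    (x : SymAlg R M) : p x :=
  SymmetricAlgebra.induction R M (motive := p) algebraMap ι mul add x

theorem SymAlg.lift_ι {R M B : Type*} [CommRing R] [AddCommGroup M] [Module R M] [CommRing B]
    [Algebra R B] (f : M →ₗ[R] B) (m : M) : SymAlg.lift f (SymAlg.ι R M m) = f m :=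
  SymmetricAlgebra.lift_ι_apply f m

/-- The symmetric algebra is spanned by products of elements of the module. -/
theorem SymAlg.induction_list {M : Type*} [AddCommGroup M] [Module k M] {p : SymAlg k M → Prop}
    (zero : p 0) (prod : ∀ (c : k) (l : List M), p (c • (l.map (SymAlg.ι k M)).prod))
    (add : ∀ x y, p x → p y → p (x + y)) (x : SymAlg k M) : p x := by
  let S : Submodule k (SymAlg k M) :=
    Submodule.span k (Set.range fun l : List M => (l.map (SymAlg.ι k M)).prod)
  have hS : x ∈ S := by
    induction x using SymAlg.induction with
    | algebraMap c =>
      rw [Algebra.algebraMap_eq_smul_one]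
      exact Submodule.smul_mem _ _ (Submodule.subset_span ⟨[], rfl⟩)
    | ι m => exact Submodule.subset_span ⟨[m], by simp⟩
    | mul x y hx hy =>
      have h := Submodule.mul_mem_mul hx hy
      rw [Submodule.span_mul_span] at h
      refine Submodule.span_mono ?_ h
      rintro _ ⟨_, ⟨l, rfl⟩, _, ⟨l', rfl⟩, rfl⟩
      exact ⟨l ++ l', by simp⟩
    | add x y hx hy => exact add_mem hx hy
  induction hS using Submodule.closure_induction with
  | zero => exact zero
  | add x y _ _ hx hy => exact add x y hx hy
  | smul_mem c x hx => obtain ⟨l, rfl⟩ := hx; exact prod c l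

theorem coeff_eq_zero_of_mem_degLT {n : ℕ} {p : MvPolynomial I k} (hp : p ∈ PBW.degLT k I n)
    {m : I →₀ ℕ} (hm : m.degree = n) : coeff m p = 0 := by
  cases n with
  | zero =>
    have h : p = 0 := hp
    rw [h, coeff_zero]
  | succ n =>
    by_contra hne
    have h1 : m.degree ≤ n := hp (mem_support_iff.2 hne)
    omega

variable [LieRing L] [LieAlgebra k L] (b : Basis I k L)

/-- The identification of the symmetric algebra with polynomials in the vectors of a basis. -/
noncomputable def symPoly : SymAlg k L ≃ₐ[k] MvPolynomial I k :=
  (SymmetricAlgebra.equivMvPolynomial b : SymmetricAlgebra k L ≃ₐ[k] MvPolynomial I k)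

theorem symPoly_ι (x : L) : symPoly b (SymAlg.ι k L x) = PBW.lin b x :=
  SymmetricAlgebra.lift_ι_apply _ x

theorem symPoly_list_prod (l : List L) :
    symPoly b (l.map (SymAlg.ι k L)).prod = (l.map (PBW.lin b)).prod := by
  rw [map_list_prod, List.map_map]
  congr 2
  exact funext fun x => symPoly_ι b x

theorem list_prod_lin_isHomogeneous (l : List L) :
    ((l.map (PBW.lin b)).prod).IsHomogeneous l.length := by
  induction l with
  | nil => exact isHomogeneous_one _ _
  | cons x l ih =>
    rw [List.map_cons, List.prod_cons, List.length_cons, add_comm]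
    refine IsHomogeneous.mul ?_ ih
    refine PBW.basis_le (b := b) (V := (homogeneousSubmodule I k 1).comap (PBW.lin b))
      (fun i => ?_) x
    change PBW.lin b (b i) ∈ homogeneousSubmodule I k 1
    rw [PBW.lin_basis]
    exact isHomogeneous_X _ _

end SymPoly

section SymToGr

variable {k : Type u} {L : Type v} [Field k] [LieRing L] [LieAlgebra k L] [TopologicalSpace L]
  [IsTopologicalLieStarAlgebra k L]

variable (k L) in
/-- The class in `gr_1 U^ch(L)` of an element of `L`, as an element of the graded algebra. -/
noncomputable def lieToGrAlg : L →ₗ[k] (stdFiltration k L).Gr where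
  toFun x := (stdFiltration k L).of 1
    ((stdFiltration k L).cls 1 (ChiralEnv.ι k L x) (ChiralEnv.ι_mem k L x))
  map_add' x y :=
    ((stdFiltration k L).of_congr rfl (map_add _ x y) _
      (add_mem (ChiralEnv.ι_mem k L x) (ChiralEnv.ι_mem k L y))).trans
      (((stdFiltration k L).of 1).map_add
        ((stdFiltration k L).cls 1 _ (ChiralEnv.ι_mem k L x))
        ((stdFiltration k L).cls 1 _ (ChiralEnv.ι_mem k L y)))
  map_smul' c x := by
    rw [RingHom.id_apply, Algebra.smul_def]
    refine Eq.trans ((stdFiltration k L).of_congr (zero_add 1).symm ?_ _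
      ((stdFiltration k L).mul_mem ((stdFiltration k L).zeroPart.algebraMap_mem c)
        (ChiralEnv.ι_mem k L x))) ((stdFiltration k L).of_cls_mul
          ((stdFiltration k L).zeroPart.algebraMap_mem c) (ChiralEnv.ι_mem k L x)).symm
    rw [map_smul, Algebra.smul_def]

variable (k L) in
/-- The graded Poincaré-Birkhoff-Witt map `Sym L → ⊕ gr_n U^ch(L)`, before completion. -/
noncomputable def symGr : SymAlg k L →ₐ[k] (stdFiltration k L).Gr := SymAlg.lift (lieToGrAlg k L)

theorem symGr_ι (x : L) : symGr k L (SymAlg.ι k L x) = lieToGrAlg k L x := SymAlg.lift_ι _ x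

theorem symGr_list_prod (l : List L) : symGr k L (l.map (SymAlg.ι k L)).prod =
    (stdFiltration k L).of l.length ((stdFiltration k L).cls l.length
      ((l.map (Env.ι k L)).prod : Env k L) (coe_mem_stdFiltration (PBW.list_prod_mem_fil l))) := by
  induction l with
  | nil => exact map_one _
  | cons x l ih =>
    simp only [List.map_cons, List.prod_cons]
    rw [map_mul, ih, symGr_ι]
    refine ((stdFiltration k L).of_cls_mul (ChiralEnv.ι_mem k L x) _).trans ?_
    exact (stdFiltration k L).of_congr (add_comm _ _) (Completion.coe_mul _ _).symm _ _

variable {I : Type v} [LinearOrder I] (b : Basis I k L)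

/-- Every component of the image of `y` in the graded algebra is the class of an element of `U(L)`
whose symbol has the same component as the polynomial of `y`. -/
theorem exists_comp_symGr (y : SymAlg k L) (n : ℕ) : ∃ (u : Env k L) (hu : u ∈ Env.fil k L n),
    (stdFiltration k L).comp (symGr k L y) n =
      (stdFiltration k L).cls n u (coe_mem_stdFiltration hu) ∧
    ∀ m : I →₀ ℕ, m.degree = n → coeff m (PBW.symbol b u) = coeff m (symPoly b y) := by
  induction y using SymAlg.induction_list with
  | zero => exact ⟨0, zero_mem _, by rw [map_zero]; rfl, fun m _ => by simp⟩
  | add x y hx hy =>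
    obtain ⟨u, hu, hux, hus⟩ := hx
    obtain ⟨v, hv, hvy, hvs⟩ := hy
    refine ⟨u + v, add_mem hu hv, ?_, fun m hm => ?_⟩
    · rw [map_add]
      refine (DFinsupp.add_apply (symGr k L x : DirectSum ℕ _) (symGr k L y) n).trans ?_
      refine (congrArg₂ (· + ·) hux hvy).trans ?_
      exact (stdFiltration k L).cls_eq.2 (by rw [Completion.coe_add, sub_self]; exact zero_mem _)
    · rw [map_add, map_add, coeff_add, coeff_add, hus m hm, hvs m hm]
  | prod c l =>
    by_cases h : l.length = n
    · subst h
      refine ⟨c • (l.map (Env.ι k L)).prod, Submodule.smul_mem _ _ (PBW.list_prod_mem_fil l),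
        ?_, fun m hm => ?_⟩
      · rw [map_smul, symGr_list_prod, ChiralFiltration.smul_of_cls, ChiralFiltration.comp_of_self]
        exact (stdFiltration k L).cls_eq.2
          (by rw [Completion.coe_smul, sub_self]; exact zero_mem _)
      · have h1 := coeff_eq_zero_of_mem_degLT (PBW.symbol_list_prod (b := b) l) hm
        rw [coeff_sub, sub_eq_zero] at h1
        rw [map_smul, map_smul, coeff_smul, coeff_smul, h1, symPoly_list_prod]
    · refine ⟨0, zero_mem _, ?_, fun m hm => ?_⟩
      · rw [map_smul, symGr_list_prod, ChiralFiltration.smul_of_cls,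
            ChiralFiltration.comp_of_of_ne _ h]
        rfl
      · rw [map_zero, coeff_zero, map_smul, symPoly_list_prod, coeff_smul,
          (list_prod_lin_isHomogeneous b l).coeff_eq_zero (by omega), smul_zero]

/-- The injectivity part of the Poincaré-Birkhoff-Witt theorem relative to an open Lie subalgebra
`P`: the preimage of the subgroup of the graded algebra given by `P` is the ideal generated
by `P`. -/
theorem mem_ideal_of_symGr_mem {P : LieSubalgebra k L} (hP : IsOpen (P : Set L)) {y : SymAlg k L}
    (hy : symGr k L y ∈ (stdFiltration k L).grSub
      ((ChiralEnv.hat k L P.toSubmodule).restrictScalars k)) :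
    y ∈ SymAlg.ideal k L ⊥ P.toSubmodule := by
  obtain ⟨I, _, b, s, hs, hsP, hPl⟩ := PBW.exists_adapted_basis P
  have key : symPoly b y ∈ PBW.varSpan k s := by
    refine PBW.mem_varSpan_iff.2 fun m hm => ?_
    obtain ⟨u, hu, huy, hus⟩ := exists_comp_symGr b y m.degree
    obtain ⟨a, ha, haP, hya⟩ := hy m.degree
    have h1 : (u : ChiralEnv k L) - a ∈ (stdFiltration k L).prev m.degree :=
      (stdFiltration k L).cls_eq.1 (huy.symm.trans hya)
    have h2 : ∃ v ∈ Env.filPrev k L m.degree, (u : ChiralEnv k L) - a - (v : Env k L) ∈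
        ChiralEnv.hat k L P.toSubmodule := by
      generalize m.degree = n at h1
      cases n with
      | zero =>
        have h0 : (u : ChiralEnv k L) - a = 0 := h1
        refine ⟨0, zero_mem _, ?_⟩
        rw [h0, Completion.coe_zero, sub_zero]; exact zero_mem _
      | succ n => exact exists_fil_sub_mem h1 ((ChiralEnv.isOpen_hat hP).mem_nhds (zero_mem _))
    obtain ⟨v, hv, huv⟩ := h2
    have h3 : u - v ∈ Env.leftIdeal k L P.toSubmodule := by
      rw [← ChiralEnv.coe_mem_hat hP, Completion.coe_sub]
      have h4 := add_mem huv (show a ∈ ChiralEnv.hat k L P.toSubmodule from haP)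
      have h5 : (u : ChiralEnv k L) - a - v + a = u - v := by abel
      rwa [h5] at h4
    have h6 := PBW.symbol_mem_varSpan hs hPl hsP.ge h3
    refine PBW.mem_varSpan_iff.1 h6 m ?_
    rw [map_sub, coeff_sub, coeff_eq_zero_of_mem_degLT (PBW.symbol_mem_degLT hv) rfl, sub_zero,
      hus m rfl]
    exact hm
  have h7 : Ideal.span (X '' s) ≤
      (SymAlg.ideal k L ⊥ P.toSubmodule).comap (symPoly b).symm := by
    refine Ideal.span_le.2 ?_
    rintro _ ⟨i, hi, rfl⟩
    change (symPoly b).symm (X i) ∈ SymAlg.ideal k L ⊥ P.toSubmodule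
    rw [← PBW.lin_basis b, ← symPoly_ι, AlgEquiv.symm_apply_apply]
    exact Ideal.subset_span (Or.inr ⟨b i, hsP ▸ Submodule.subset_span ⟨i, hi, rfl⟩, rfl⟩)
  have h8 := h7 (PBW.mem_varSpan.1 key)
  change (symPoly b).symm (symPoly b y) ∈ SymAlg.ideal k L ⊥ P.toSubmodule at h8
  rwa [AlgEquiv.symm_apply_apply] at h8

/-- The classes of elements of `U(L)` are in the image of the symmetric algebra. -/
theorem exists_symGr_eq {n : ℕ} {u : Env k L} (hu : u ∈ Env.fil k L n) :
    ∃ y, symGr k L y =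
      (stdFiltration k L).of n ((stdFiltration k L).cls n u (coe_mem_stdFiltration hu)) := by
  let F := stdFiltration k L
  induction n generalizing u with
  | zero =>
    have hu' := hu
    rw [Env.fil_zero] at hu'
    obtain ⟨c, rfl⟩ := Submodule.mem_one.1 hu'
    exact ⟨algebraMap k _ c, (symGr k L).commutes c⟩
  | succ n ih =>
    have hu' := hu
    rw [Env.fil_succ] at hu'
    induction hu' using Submodule.mul_induction_on' with
    | mem_mul_mem u hu₁ v hv =>
      rw [Env.fil_one] at hv
      obtain ⟨c, hc, _, ⟨x, rfl⟩, rfl⟩ := Submodule.mem_sup.1 hv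
      obtain ⟨c, rfl⟩ := Submodule.mem_one.1 hc
      obtain ⟨y, hy⟩ := ih hu₁
      refine ⟨y * SymAlg.ι k L x, ?_⟩
      rw [map_mul, hy, symGr_ι]
      refine (F.of_cls_mul (coe_mem_stdFiltration hu₁) (ChiralEnv.ι_mem k L x)).trans
        (congrArg _ (F.cls_eq.2 ?_))
      have h : (u : ChiralEnv k L) * ChiralEnv.ι k L x -
          ((u * (algebraMap k _ c + Env.ι k L x) : Env k L) : ChiralEnv k L) =
          ((-(c • u) : Env k L) : ChiralEnv k L) := by
        change (u : ChiralEnv k L) * (Env.ι k L x : Env k L) - _ = _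
        rw [← Completion.coe_mul, ← Completion.coe_sub, mul_add, ← Algebra.commutes,
          ← Algebra.smul_def]
        congr 1
        abel
      rw [h]
      exact coe_mem_stdFiltration (neg_mem (Submodule.smul_mem _ c hu₁))
    | add u hu₁ v hv₁ ihu ihv =>
      have hu₂ : u ∈ Env.fil k L (n + 1) := by rw [Env.fil_succ]; exact hu₁
      have hv₂ : v ∈ Env.fil k L (n + 1) := by rw [Env.fil_succ]; exact hv₁
      obtain ⟨y, hy⟩ := ihu hu₂
      obtain ⟨z, hz⟩ := ihv hv₂
      refine ⟨y + z, ?_⟩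
      rw [map_add, hy, hz]
      refine ((F.of (n + 1)).map_add _ _).symm.trans (congrArg _ (F.cls_eq.2 ?_))
      rw [Completion.coe_add, sub_self]; exact zero_mem _

theorem lift_lieToGr (y : SymAlg k L) :
    SymAlg.lift (lieToGr k L) y = (symGr k L y : (stdFiltration k L).Gr) := by
  induction y using SymAlg.induction with
  | algebraMap c =>
    refine (AlgHom.commutes (SymAlg.lift (lieToGr k L)) c).trans ?_
    exact (congrArg ((↑) : (stdFiltration k L).Gr → (stdFiltration k L).GrHat)
      ((symGr k L).commutes c).symm)
  | ι x => rw [SymAlg.lift_ι, symGr_ι]; rfl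
  | mul x y hx hy => rw [map_mul, map_mul, hx, hy, Completion.coe_mul]
  | add x y hx hy => rw [map_add, map_add, hx, hy, Completion.coe_add]

theorem dense_of_forall_exists_sub_mem {T : Type*} [AddCommGroup T] [UniformSpace T]
    [IsUniformAddGroup T]
    {S : Set T} (h : ∀ x, ∀ U ∈ 𝓝 (0 : T), ∃ y ∈ S, x - y ∈ U) : Dense S := by
  intro x
  rw [mem_closure_iff_nhds]
  intro V hV
  have h1 : (fun y => x - y) ⁻¹' V ∈ 𝓝 0 := by
    refine (continuous_const.sub continuous_id).continuousAt.preimage_mem_nhds ?_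
    simpa using hV
  obtain ⟨y, hy, hxy⟩ := h x _ h1
  exact ⟨y, by simpa using hxy, hy⟩

theorem denseRange_symGr : DenseRange (symGr k L) := by
  let F := stdFiltration k L
  refine dense_of_forall_exists_sub_mem fun x U hU => ?_
  obtain ⟨P, -, hP⟩ := (basis_hasBasis F.gr_basis).mem_iff.1 hU
  suffices h : ∃ y, x - symGr k L y ∈ F.grSub P.1 by
    obtain ⟨y, hy⟩ := h
    exact ⟨_, ⟨y, rfl⟩, hP hy⟩
  induction x using ChiralFiltration.Gr.induction with
  | zero => exact ⟨0, by rw [map_zero, sub_zero]; exact zero_mem _⟩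
  | of n a ha =>
    obtain ⟨u, hu, hau⟩ := exists_fil_sub_mem ha (P.2.mem_nhds (zero_mem _))
    obtain ⟨y, hy⟩ := exists_symGr_eq hu
    refine ⟨y, ?_⟩
    rw [hy, ← (F.of n).map_sub]
    exact F.of_mem_grSub (sub_mem ha (coe_mem_stdFiltration hu)) hau
  | add x x' hx hx' =>
    obtain ⟨y, hy⟩ := hx
    obtain ⟨y', hy'⟩ := hx'
    refine ⟨y + y', ?_⟩
    rw [map_add, add_sub_add_comm]
    exact add_mem hy hy'

/-- The ideals generated by open Lie subalgebras form a base of the topology of `Sym L`. -/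
theorem exists_ideal_of_nhds [TopologicalSpace k] {U : Set (SymAlg k L)} (hU : U ∈ 𝓝 0) :
    ∃ P : LieSubalgebra k L, IsOpen (P : Set L) ∧
      (SymAlg.ideal k L ⊥ P.toSubmodule : Set (SymAlg k L)) ⊆ U := by
  obtain ⟨p, -, hp⟩ := (basis_hasBasis (SymAlg.basis k L)).mem_iff.1 hU
  obtain ⟨Q, hQ, hQP⟩ := exists_open_lieSubalgebra_le p.2.2.1
  have hle : SymAlg.ideal k L ⊥ Q.toSubmodule ≤ SymAlg.ideal k L p.1.1 p.1.2 :=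
    Ideal.span_mono (Set.union_subset_union (Set.image_mono fun x hx => by
      have h0 : x = 0 := hx
      rw [h0]; exact zero_mem p.1.1) (Set.image_mono hQP))
  exact ⟨Q, hQ, fun x hx => hp (hle hx)⟩

/-- The relative Poincaré-Birkhoff-Witt theorem, as a statement on neighbourhoods of zero. -/
theorem exists_nhds_lift_lieToGr {P : LieSubalgebra k L} (hP : IsOpen (P : Set L)) :
    ∃ V ∈ 𝓝 (0 : (stdFiltration k L).GrHat), ∀ y : SymAlg k L,
      SymAlg.lift (lieToGr k L) y ∈ V → y ∈ SymAlg.ideal k L ⊥ P.toSubmodule := by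
  let W := (ChiralEnv.hat k L P.toSubmodule).restrictScalars k
  have hW : ((stdFiltration k L).grSub W : Set (stdFiltration k L).Gr) ∈
      𝓝 (0 : (stdFiltration k L).Gr) :=
    (basis_hasBasis (stdFiltration k L).gr_basis).mem_of_mem
      (i := ⟨W, ChiralEnv.isOpen_hat hP⟩) trivial
  have hi := (Completion.isDenseInducing_coe (α := (stdFiltration k L).Gr)).isInducing
  rw [hi.nhds_eq_comap, Completion.coe_zero] at hW
  obtain ⟨V, hV, hVW⟩ := hW
  refine ⟨V, hV, fun y hy => mem_ideal_of_symGr_mem hP (hVW ?_)⟩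
  rw [lift_lieToGr] at hy
  exact hy

theorem denseRange_lift_lieToGr : DenseRange (SymAlg.lift (lieToGr k L)) := by
  have h := Completion.denseRange_coe.comp (denseRange_symGr (k := k) (L := L))
    (Completion.continuous_coe (stdFiltration k L).Gr)
  have h' : ((↑) : (stdFiltration k L).Gr → (stdFiltration k L).GrHat) ∘ symGr k L =
      SymAlg.lift (lieToGr k L) := funext fun y => (lift_lieToGr y).symm
  rwa [h'] at h

section

variable [TopologicalSpace k] [DiscreteTopology k] [IsTopologicalAddGroup L]

theorem continuous_lift_lieToGr : Continuous (SymAlg.lift (lieToGr k L)) :=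
  SymAlg.continuous_lift continuous_of_discreteTopology _ (continuous_lieToGr k L)

theorem isInducing_lift_lieToGr : IsInducing (SymAlg.lift (lieToGr k L)) := by
  refine isInducing_of_nhds_zero
    (SymAlg.lift (lieToGr k L) : SymAlg k L →+ (stdFiltration k L).GrHat)
    continuous_lift_lieToGr fun U hU => ?_
  obtain ⟨P, hP, hPU⟩ := exists_ideal_of_nhds hU
  obtain ⟨V, hV, h⟩ := exists_nhds_lift_lieToGr hP
  exact ⟨V, hV, fun y hy => hPU (h y hy)⟩

theorem symToGr_coe (y : SymAlg k L) : symToGr k L (y : SymShriek k L) =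
    SymAlg.lift (lieToGr k L) y :=
  Completion.extensionHom_coe _ continuous_lift_lieToGr y

/-- `Sym L` carries the topology induced from its dense image in the completed graded algebra, so
the map extends to a homeomorphism of the completions. -/
theorem symToGr_isHomeomorph : IsHomeomorph (symToGr k L) :=
  isHomeomorph_of_isInducing_comp_coe
    (SymAlg.lift (lieToGr k L) : SymAlg k L →+ (stdFiltration k L).GrHat)
    isInducing_lift_lieToGr denseRange_lift_lieToGr _ Completion.continuous_extension symToGr_coe

end

end SymToGr

end TopAlg

end

/-! ### The Poincaré-Birkhoff-Witt map over the zeroth part of the filtration -/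

section

open MvPolynomial Module

namespace PBW

variable {k L I : Type*} [Field k] [LieRing L] [LieAlgebra k L] (b : Basis I k L)

theorem coeff_single_lin (i : I) (x : L) :
    coeff (Finsupp.single i 1) (lin b x) = b.repr x i := by
  classical
  have h : (MvPolynomial.lcoeff k (Finsupp.single i 1)).comp (lin b) = b.coord i := by
    refine b.ext fun j => ?_
    rw [LinearMap.comp_apply, lin_basis, lcoeff_apply, coeff_X, Basis.coord_apply,
      Basis.repr_self, Finsupp.single_apply]
    simp [Finsupp.single_left_inj]
  exact LinearMap.congr_fun h x

theorem coeff_zero_lin (x : L) : coeff 0 (lin b x) = 0 := by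
  classical
  have h : (MvPolynomial.lcoeff k 0).comp (lin b) = 0 := by
    refine b.ext fun j => ?_
    rw [LinearMap.comp_apply, lin_basis, lcoeff_apply, coeff_zero_X, LinearMap.zero_apply]
  exact LinearMap.congr_fun h x

/-- The part of degree at most one of a polynomial in the ideal generated by the variables which
belong to a subspace. -/
theorem eq_zero_of_C_add_lin_mem {s : Set I} {c : k} {x : L} (h : C c + lin b x ∈ varSpan k s) :
    c = 0 ∧ x ∈ Submodule.span k (b '' s) := by
  rw [mem_varSpan_iff] at h
  refine ⟨?_, ?_⟩
  · by_contra hc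
    obtain ⟨i, -, hi⟩ := h 0 (by rwa [coeff_add, coeff_zero_C, coeff_zero_lin, add_zero])
    exact hi rfl
  · rw [b.mem_span_image]
    intro i hi
    classical
    obtain ⟨j, hj, hij⟩ := h (Finsupp.single i 1) (by
      rw [coeff_add, coeff_C, if_neg (by simp [eq_comm]), zero_add, coeff_single_lin]
      exact Finsupp.mem_support_iff.1 hi)
    by_cases hne : i = j
    · exact hne ▸ hj
    · exact absurd (Finsupp.single_eq_of_ne (Ne.symm hne)) hij

end PBW

namespace TopAlg

variable {k : Type u} {L : Type v} [Field k] [LieRing L] [LieAlgebra k L]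

/-- For an open Lie subalgebra `P`, the sum `k + L` meets the closure of `U(L) P` in `P`. -/
theorem ChiralEnv.eq_zero_of_mem_hat [TopologicalSpace L] [IsTopologicalLieStarAlgebra k L]
    {P : LieSubalgebra k L} (hP : IsOpen (P : Set L)) {c : k} {x : L}
    (h : algebraMap k (ChiralEnv k L) c + ChiralEnv.ι k L x ∈ ChiralEnv.hat k L P.toSubmodule) :
    c = 0 ∧ x ∈ P := by
  obtain ⟨I, _, b, s, hs, hsP, hPl⟩ := PBW.exists_adapted_basis P
  have h1 : algebraMap k (Env k L) c + Env.ι k L x ∈ Env.leftIdeal k L P.toSubmodule := by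
    rw [← ChiralEnv.coe_mem_hat hP, Completion.coe_add]
    exact h
  have h2 := PBW.symbol_mem_varSpan hs hPl hsP.ge h1
  rw [map_add, PBW.symbol_algebraMap, PBW.symbol_ι] at h2
  have h3 := PBW.eq_zero_of_C_add_lin_mem b h2
  rw [hsP] at h3
  exact h3

theorem Env.mem_fil_one {u : Env k L} (hu : u ∈ Env.fil k L 1) :
    ∃ c x, u = algebraMap k _ c + Env.ι k L x := by
  rw [Env.fil_one] at hu
  obtain ⟨c, hc, _, ⟨x, rfl⟩, rfl⟩ := Submodule.mem_sup.1 hu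
  obtain ⟨c, rfl⟩ := Submodule.mem_one.1 hc
  exact ⟨c, x, rfl⟩

section

variable [UniformSpace L] [IsUniformAddGroup L] [IsTopologicalLieStarAlgebra k L]

theorem ChiralEnv.isInducing_ι : IsInducing (ChiralEnv.ι k L) := by
  refine isInducing_of_nhds_zero (ChiralEnv.ι k L : L →+ ChiralEnv k L)
    (ChiralEnv.continuous_ι k L) fun U hU => ?_
  obtain ⟨P, hP, hPU⟩ := IsTopologicalLieStarAlgebra.exists_subalgebra (k := k) (L := L) U hU
  refine ⟨_, (ChiralEnv.isOpen_hat hP).mem_nhds (zero_mem _), fun x hx => hPU ?_⟩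
  refine (ChiralEnv.eq_zero_of_mem_hat hP (c := (0 : k)) ?_).2
  rw [map_zero, zero_add]; exact hx

/-- The image of `L` is complete, hence closed. -/
theorem ChiralEnv.isClosed_range_ι [CompleteSpace L] :
    IsClosed (Set.range (ChiralEnv.ι k L)) := by
  have h := AddMonoidHom.isUniformInducing_of_isInducing
    (f := (ChiralEnv.ι k L : L →+ ChiralEnv k L)) ChiralEnv.isInducing_ι
  exact h.isComplete_range.isClosed

/-- `U^ch(L)_1 = k + L`: this uses the completeness of `L`. -/
theorem exists_of_mem_fil_one [CompleteSpace L] {a : ChiralEnv k L}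
    (ha : a ∈ (stdFiltration k L).fil 1) :
    ∃ (c : k) (x : L), a = algebraMap k _ c + ChiralEnv.ι k L x := by
  have htop : IsOpen ((⊤ : LieSubalgebra k L) : Set L) := isOpen_univ
  -- The constant term of an approximation of `a` is determined modulo the ideal `U(L) L`.
  have key : ∀ U ∈ 𝓝 (0 : ChiralEnv k L), ∃ (c : k) (x : L),
      a - (algebraMap k _ c + ChiralEnv.ι k L x) ∈ U := by
    intro U hU
    obtain ⟨u, hu, hau⟩ := exists_fil_sub_mem ha hU
    obtain ⟨c, x, rfl⟩ := Env.mem_fil_one hu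
    refine ⟨c, x, ?_⟩
    rwa [Completion.coe_add] at hau
  obtain ⟨c, x₀, hc⟩ := key _ ((ChiralEnv.isOpen_hat htop).mem_nhds (zero_mem _))
  have hmem : a - algebraMap k _ c ∈ closure (Set.range (ChiralEnv.ι k L)) := by
    rw [mem_closure_iff_nhds]
    intro V hV
    have h1 : (fun y => a - algebraMap k _ c - y) ⁻¹' V ∈ 𝓝 0 := by
      refine (continuous_const.sub continuous_id).continuousAt.preimage_mem_nhds ?_
      simpa using hV
    obtain ⟨c', x, hc'⟩ := key _
      (Filter.inter_mem h1 ((ChiralEnv.isOpen_hat htop).mem_nhds (zero_mem _)))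
    have h2 : c - c' = 0 := by
      refine (ChiralEnv.eq_zero_of_mem_hat htop (x := x₀ - x) ?_).1
      have h3 := sub_mem hc'.2 hc
      have h4 : a - (algebraMap k (ChiralEnv k L) c' + ChiralEnv.ι k L x) -
          (a - (algebraMap k (ChiralEnv k L) c + ChiralEnv.ι k L x₀)) =
          algebraMap k (ChiralEnv k L) (c - c') + ChiralEnv.ι k L (x₀ - x) := by
        rw [map_sub, map_sub]; abel
      rwa [h4] at h3
    rw [sub_eq_zero] at h2
    subst h2
    refine ⟨ChiralEnv.ι k L x, ?_, x, rfl⟩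
    have h5 := hc'.1
    rw [Set.mem_preimage] at h5
    convert h5 using 1
    abel
  rw [ChiralEnv.isClosed_range_ι.closure_eq] at hmem
  obtain ⟨x, hx⟩ := hmem
  exact ⟨c, x, by rw [hx]; abel⟩

/-- `U^ch(L)_0 = k`. -/
theorem exists_of_mem_fil_zero [CompleteSpace L] {a : ChiralEnv k L}
    (ha : a ∈ (stdFiltration k L).fil 0) : ∃ c : k, a = algebraMap k _ c := by
  obtain ⟨c, x, rfl⟩ := exists_of_mem_fil_one ((stdFiltration k L).mono zero_le_one ha)
  refine ⟨c, ?_⟩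
  suffices h : ChiralEnv.ι k L x = 0 by rw [h, add_zero]
  have h : ChiralEnv.ι k L x ∈ closure ({0} : Set (ChiralEnv k L)) := by
    rw [mem_closure_iff_nhds]
    intro V hV
    have h1 : (fun y => ChiralEnv.ι k L x - y) ⁻¹' V ∈ 𝓝 0 := by
      refine (continuous_const.sub continuous_id).continuousAt.preimage_mem_nhds ?_
      simpa using hV
    obtain ⟨P, hP, hPV⟩ := ChiralEnv.exists_hat_subset h1
    obtain ⟨u, hu, hau⟩ := exists_fil_sub_mem ha
      ((ChiralEnv.isOpen_hat hP).mem_nhds (zero_mem _))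
    rw [Env.fil_zero] at hu
    obtain ⟨c', rfl⟩ := Submodule.mem_one.1 hu
    have h2 : algebraMap k (ChiralEnv k L) c + ChiralEnv.ι k L x -
        algebraMap k (ChiralEnv k L) c' ∈ ChiralEnv.hat k L P.toSubmodule := hau
    have h3 : algebraMap k (ChiralEnv k L) (c - c') + ChiralEnv.ι k L x ∈
        ChiralEnv.hat k L P.toSubmodule := by
      rw [map_sub]
      convert h2 using 1
      abel
    obtain ⟨hc, -⟩ := ChiralEnv.eq_zero_of_mem_hat hP h3
    rw [hc, map_zero, zero_add] at h3
    refine ⟨0, ?_, rfl⟩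
    have h4 : ChiralEnv.ι k L x - ChiralEnv.ι k L x ∈ V := hPV h3
    rwa [sub_self] at h4
  rwa [closure_singleton] at h

variable [CompleteSpace L]

/-- The Poincaré-Birkhoff-Witt map of the standard filtration is a homeomorphism, because
`gr_1 U^ch(L)` is the image of `L` and `U^ch(L)_0 = k`. -/
theorem pbwMap_isHomeomorph : IsHomeomorph (stdFiltration k L).pbwMap := by
  let F := stdFiltration k L
  let S := SymAlg F.zeroPart (F.gr 1)
  let h : S →ₐ[F.zeroPart] F.GrHat := SymAlg.lift F.grOneHom
  let _ : Algebra k S :=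
    ((algebraMap F.zeroPart S).comp (algebraMap k F.zeroPart)).toAlgebra
  let ψ₁ : L →ₗ[k] S :=
    { toFun := fun x => SymAlg.ι F.zeroPart (F.gr 1)
        (F.cls 1 (ChiralEnv.ι k L x) (ChiralEnv.ι_mem k L x))
      map_add' := fun x y => by
        rw [← map_add, F.cls_add]
        exact congrArg _ (F.cls_eq.2 (by rw [map_add, sub_self]; exact zero_mem _))
      map_smul' := fun c x => by
        rw [RingHom.id_apply, Algebra.smul_def]
        change _ = algebraMap F.zeroPart S (algebraMap k F.zeroPart c) * _
        rw [← Algebra.smul_def, ← map_smul, F.cls_smul]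
        refine congrArg _ (F.cls_eq.2 ?_)
        rw [map_smul, Algebra.smul_def]
        change algebraMap k (ChiralEnv k L) c * _ - algebraMap k (ChiralEnv k L) c * _ ∈ _
        rw [sub_self]; exact zero_mem _ }
  let ψ : SymAlg k L →ₐ[k] S := SymAlg.lift ψ₁
  have hψι : ∀ x, ψ (SymAlg.ι k L x) = SymAlg.ι F.zeroPart (F.gr 1)
      (F.cls 1 (ChiralEnv.ι k L x) (ChiralEnv.ι_mem k L x)) := fun x => SymAlg.lift_ι ψ₁ x
  have hψ : ∀ y, h (ψ y) = SymAlg.lift (lieToGr k L) y := by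
    intro y
    induction y using SymAlg.induction with
    | algebraMap c =>
      rw [AlgHom.commutes, AlgHom.commutes]
      exact h.commutes (algebraMap k F.zeroPart c)
    | ι x =>
      rw [hψι]
      exact (SymAlg.lift_ι F.grOneHom _).trans (SymAlg.lift_ι (lieToGr k L) x).symm
    | mul x y hx hy => rw [map_mul, map_mul, map_mul, hx, hy]
    | add x y hx hy => rw [map_add, map_add, map_add, hx, hy]
  have hsurj : Function.Surjective ψ := by
    intro z
    induction z using SymAlg.induction with
    | algebraMap r =>
      obtain ⟨c, hc⟩ := exists_of_mem_fil_zero r.2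
      refine ⟨algebraMap k _ c, ?_⟩
      rw [AlgHom.commutes]
      exact congrArg (algebraMap F.zeroPart S) (Subtype.ext hc.symm)
    | ι m =>
      obtain ⟨a, ha, rfl⟩ := F.exists_cls m
      obtain ⟨c, x, hcx⟩ := exists_of_mem_fil_one ha
      refine ⟨SymAlg.ι k L x, ?_⟩
      rw [hψι]
      refine congrArg _ (F.cls_eq.2 ?_)
      rw [hcx, sub_add_cancel_right]
      exact neg_mem (F.zeroPart.algebraMap_mem c)
    | mul x y hx hy =>
      obtain ⟨x, rfl⟩ := hx
      obtain ⟨y, rfl⟩ := hy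
      exact ⟨x * y, map_mul _ _ _⟩
    | add x y hx hy =>
      obtain ⟨x, rfl⟩ := hx
      obtain ⟨y, rfl⟩ := hy
      exact ⟨x + y, map_add _ _ _⟩
  have hcont : Continuous h :=
    SymAlg.continuous_lift F.continuous_algebraMap_grHat _ F.continuous_grOneHom
  refine isHomeomorph_of_isInducing_comp_coe (h : S →+ F.GrHat) ?_ ?_ _
    Completion.continuous_extension (fun t => Completion.extensionHom_coe _ hcont t)
  · refine isInducing_of_nhds_zero (h : S →+ F.GrHat) hcont fun U hU => ?_
    obtain ⟨p, -, hp⟩ := (basis_hasBasis (SymAlg.basis F.zeroPart (F.gr 1))).mem_iff.1 hU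
    let g : L → F.filMod 1 := fun x => ⟨ChiralEnv.ι k L x, ChiralEnv.ι_mem k L x⟩
    have hg : Continuous g := (ChiralEnv.continuous_ι k L).subtype_mk _
    have hq : Continuous fun x : L => F.cls 1 (ChiralEnv.ι k L x) (ChiralEnv.ι_mem k L x) :=
      (continuous_coinduced_rng (f := fun a : F.filMod 1 => F.cls 1 a a.2)).comp hg
    have hU' : (fun x : L => F.cls 1 (ChiralEnv.ι k L x) (ChiralEnv.ι_mem k L x)) ⁻¹' p.1.2 ∈
        𝓝 0 := by
      refine (p.2.2.1.preimage hq).mem_nhds ?_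
      have h0 : F.cls 1 (ChiralEnv.ι k L 0) (ChiralEnv.ι_mem k L 0) = 0 :=
        F.cls_eq.2 (by rw [map_zero, sub_self]; exact zero_mem _)
      rw [Set.mem_preimage, h0]
      exact zero_mem p.1.2
    obtain ⟨P, hP, hPU⟩ := IsTopologicalLieStarAlgebra.exists_subalgebra (k := k) (L := L) _ hU'
    obtain ⟨V, hV, hVP⟩ := exists_nhds_lift_lieToGr hP
    have hle : SymAlg.ideal k L ⊥ P.toSubmodule ≤
        (SymAlg.ideal F.zeroPart (F.gr 1) p.1.1 p.1.2).comap ψ := by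
      refine Ideal.span_le.2 ?_
      rintro _ (⟨c, hc, rfl⟩ | ⟨x, hx, rfl⟩)
      · have hc0 : c = 0 := hc
        rw [hc0, map_zero]; exact zero_mem _
      · change ψ (SymAlg.ι k L x) ∈ SymAlg.ideal F.zeroPart (F.gr 1) p.1.1 p.1.2
        rw [hψι]
        exact Ideal.subset_span (Or.inr ⟨_, hPU hx, rfl⟩)
    refine ⟨V, hV, fun z hz => hp ?_⟩
    obtain ⟨y, rfl⟩ := hsurj z
    refine hle (hVP y ?_)
    rw [← hψ]; exact hz
  · refine (denseRange_lift_lieToGr (k := k) (L := L)).mono ?_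
    rintro _ ⟨y, rfl⟩
    exact ⟨ψ y, hψ y⟩

end

end TopAlg

end

/-! ### Coisson structures -/

namespace TopAlg

/-- A biadditive map of topological groups is continuous if it is continuous at zero and in each
variable. -/
theorem continuous_of_biadditive {G H K : Type*} [AddCommGroup G] [TopologicalSpace G]
    [IsTopologicalAddGroup G] [AddCommGroup H] [TopologicalSpace H] [IsTopologicalAddGroup H]
    [AddCommGroup K] [TopologicalSpace K] [IsTopologicalAddGroup K] (φ : G →+ H →+ K)
    (h0 : Filter.Tendsto (fun p : G × H => φ p.1 p.2) (𝓝 0 ×ˢ 𝓝 0) (𝓝 0))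
    (hr : ∀ x, Continuous (φ x)) (hl : ∀ y, Continuous fun x => φ x y) :
    Continuous fun p : G × H => φ p.1 p.2 := by
  rw [continuous_iff_continuousAt]
  rintro ⟨x, y⟩
  have h1 : (fun p : G × H => φ p.1 p.2) = fun p =>
      φ (p.1 - x) (p.2 - y) + (φ x p.2 + φ p.1 y - φ x y) := by
    funext p
    simp only [map_sub, AddMonoidHom.sub_apply]
    abel
  have h2 : Filter.Tendsto (fun p : G × H => φ (p.1 - x) (p.2 - y)) (𝓝 (x, y)) (𝓝 0) := by
    have h3 : Continuous fun p : G × H => (p.1 - x, p.2 - y) := by fun_prop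
    have h4 := h3.tendsto (x, y)
    rw [sub_self, sub_self, nhds_prod_eq (x := (0 : G))] at h4
    exact h0.comp h4
  have h5 : Continuous fun p : G × H => φ x p.2 + φ p.1 y - φ x y :=
    (((hr x).comp continuous_snd).add ((hl y).comp continuous_fst)).sub continuous_const
  rw [ContinuousAt, h1]
  simpa using h2.add (h5.tendsto (x, y))

namespace ChiralFiltration

variable {k A : Type*} [Field k] [Ring A] [Algebra k A] [UniformSpace A]
  (F : ChiralFiltration k A)

theorem cls_congr {n : ℕ} {a b : A} (hab : a = b) (ha : a ∈ F.fil n) (hb : b ∈ F.fil n) :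
    F.cls n a ha = F.cls n b hb := by
  subst hab; rfl

theorem of_cls_congr {i j : ℕ} {a b : A} (hab : a = b) (h : i = j ∨ a = 0) (ha : a ∈ F.fil i)
    (hb : b ∈ F.fil j) : F.of i (F.cls i a ha) = F.of j (F.cls j b hb) := by
  rcases h with h | h
  · exact F.of_congr h hab ha hb
  · subst hab
    subst h
    exact ((F.of i).map_zero).trans ((F.of j).map_zero).symm

theorem of_cls_add {n : ℕ} {a b : A} (ha : a ∈ F.fil n) (hb : b ∈ F.fil n) :
    F.of n (F.cls n a ha) + F.of n (F.cls n b hb) = F.of n (F.cls n (a + b) (add_mem ha hb)) :=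
  ((F.of n).map_add _ _).symm

section Bracket

variable [F.IsCommutative]

theorem comm_mem_prev {i j : ℕ} {a b : A} (ha : a ∈ F.fil i) (hb : b ∈ F.fil j) :
    a * b - b * a ∈ F.prev (i + j) := by
  have h := IsCommutative.mul_comm (F.of i (F.cls i a ha)) (F.of j (F.cls j b hb))
  rw [of_cls_mul, of_cls_mul, F.of_congr (add_comm j i) rfl (F.mul_mem hb ha)
    (add_comm j i ▸ F.mul_mem hb ha)] at h
  exact F.cls_eq.1 (DirectSum.of_injective (β := F.gr) (i + j) h)

theorem comm_mem {i j : ℕ} {a b : A} (ha : a ∈ F.fil i) (hb : b ∈ F.fil j) :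
    a * b - b * a ∈ F.fil (i + j - 1) := by
  have h := F.comm_mem_prev ha hb
  cases hn : i + j with
  | zero =>
    rw [hn] at h
    have h0 : a * b - b * a = 0 := h
    rw [h0]; exact zero_mem _
  | succ n => rw [hn] at h; exact h

theorem comm_eq_zero {i j : ℕ} (hij : i + j = 0) {a b : A} (ha : a ∈ F.fil i) (hb : b ∈ F.fil j) :
    a * b - b * a = 0 := by
  have h := F.comm_mem_prev ha hb
  rw [hij] at h
  exact h

/-- The class of a commutator depends only on the class of the left factor. -/
theorem comm_mem_prev_of_left {i j : ℕ} {a b : A} (ha : a ∈ F.prev i) (hb : b ∈ F.fil j) :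
    a * b - b * a ∈ F.prev (i + j - 1) := by
  cases i with
  | zero =>
    have h0 : a = 0 := ha
    rw [h0, zero_mul, mul_zero, sub_self]; exact zero_mem _
  | succ i =>
    have h := F.comm_mem_prev (i := i) ha hb
    rwa [show i + 1 + j - 1 = i + j by omega]

theorem comm_mem_prev_of_right {i j : ℕ} {a b : A} (ha : a ∈ F.fil i) (hb : b ∈ F.prev j) :
    a * b - b * a ∈ F.prev (i + j - 1) := by
  rw [← neg_sub, add_comm]
  exact neg_mem (F.comm_mem_prev_of_left hb ha)

/-- The bracket `gr_i A × gr_j A → gr_{i+j-1} A` induced by the commutator. -/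
def grBracketFun {i j : ℕ} (x : F.gr i) (y : F.gr j) : F.gr (i + j - 1) :=
  Quotient.liftOn₂' x y (fun a b => F.cls (i + j - 1) (a * b - b * a) (F.comm_mem a.2 b.2)) (by
    intro a b a' b' h h'
    have h1 : (a : A) - a' ∈ F.prev i :=
      (Submodule.quotientRel_def ((F.prevMod _).submoduleOf (F.filMod _))).1 h
    have h2 : (b : A) - b' ∈ F.prev j :=
      (Submodule.quotientRel_def ((F.prevMod _).submoduleOf (F.filMod _))).1 h'
    refine F.cls_eq.2 ?_
    have h3 : (a * b - b * a : A) - (a' * b' - b' * a') =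
        ((a - a') * b - b * (a - a')) + (a' * (b - b') - (b - b') * a') := by noncomm_ring
    rw [h3]
    exact add_mem (F.comm_mem_prev_of_left h1 b.2) (F.comm_mem_prev_of_right a'.2 h2))

theorem grBracketFun_cls {i j : ℕ} {a b : A} (ha : a ∈ F.fil i) (hb : b ∈ F.fil j) :
    F.grBracketFun (F.cls i a ha) (F.cls j b hb) =
      F.cls (i + j - 1) (a * b - b * a) (F.comm_mem ha hb) := rfl

theorem grBracketFun_add_right {i j : ℕ} (x : F.gr i) (y y' : F.gr j) :
    F.grBracketFun x (y + y') = F.grBracketFun x y + F.grBracketFun x y' := by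
  obtain ⟨a, ha, rfl⟩ := F.exists_cls x
  obtain ⟨b, hb, rfl⟩ := F.exists_cls y
  obtain ⟨b', hb', rfl⟩ := F.exists_cls y'
  rw [F.cls_add, grBracketFun_cls, grBracketFun_cls, grBracketFun_cls, F.cls_add]
  exact F.cls_congr (by noncomm_ring) _ _

theorem grBracketFun_add_left {i j : ℕ} (x x' : F.gr i) (y : F.gr j) :
    F.grBracketFun (x + x') y = F.grBracketFun x y + F.grBracketFun x' y := by
  obtain ⟨a, ha, rfl⟩ := F.exists_cls x
  obtain ⟨a', ha', rfl⟩ := F.exists_cls x'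
  obtain ⟨b, hb, rfl⟩ := F.exists_cls y
  rw [F.cls_add, grBracketFun_cls, grBracketFun_cls, grBracketFun_cls, F.cls_add]
  exact F.cls_congr (by noncomm_ring) _ _

/-- The bracket of a homogeneous element with an element of the graded algebra. -/
noncomputable def bracketOf (i : ℕ) (x : F.gr i) : F.Gr →+ F.Gr :=
  (DirectSum.toAddMonoid fun j => (F.of (i + j - 1)).comp
    (AddMonoidHom.mk' (F.grBracketFun x) (F.grBracketFun_add_right x)) :
    DirectSum ℕ F.gr →+ F.Gr)

theorem bracketOf_of {i j : ℕ} (x : F.gr i) (y : F.gr j) :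
    F.bracketOf i x (F.of j y) = F.of (i + j - 1) (F.grBracketFun x y) :=
  DirectSum.toAddMonoid_of (β := F.gr) _ j y

theorem bracketOf_add {i : ℕ} (x x' : F.gr i) :
    F.bracketOf i (x + x') = F.bracketOf i x + F.bracketOf i x' := by
  ext y
  induction y using Gr.induction with
  | zero => simp
  | add y y' hy hy' => rw [map_add, map_add, hy, hy']
  | of j b hb =>
    rw [AddMonoidHom.add_apply, bracketOf_of, bracketOf_of, bracketOf_of, grBracketFun_add_left,
      map_add]

/-- The Poisson bracket of the graded algebra, as a biadditive map. -/
noncomputable def bracketHom : F.Gr →+ F.Gr →+ F.Gr :=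
  (DirectSum.toAddMonoid fun i => AddMonoidHom.mk' (F.bracketOf i) F.bracketOf_add :
    DirectSum ℕ F.gr →+ (F.Gr →+ F.Gr))

theorem bracketHom_of {i j : ℕ} {a b : A} (ha : a ∈ F.fil i) (hb : b ∈ F.fil j) :
    F.bracketHom (F.of i (F.cls i a ha)) (F.of j (F.cls j b hb)) =
      F.of (i + j - 1) (F.cls (i + j - 1) (a * b - b * a) (F.comm_mem ha hb)) :=
  (DFunLike.congr_fun (DirectSum.toAddMonoid_of (β := F.gr) _ i (F.cls i a ha)) _).trans
    (F.bracketOf_of _ _)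

theorem bracketHom_antisymm (x y : F.Gr) : F.bracketHom x y = -F.bracketHom y x := by
  induction x using Gr.induction with
  | zero => simp
  | add x x' hx hx' => rw [map_add, map_add, AddMonoidHom.add_apply, hx, hx', neg_add]
  | of i a ha =>
    induction y using Gr.induction with
    | zero => simp
    | add y y' hy hy' => rw [map_add, map_add, AddMonoidHom.add_apply, hy, hy', neg_add]
    | of j b hb =>
      rw [bracketHom_of, bracketHom_of, ← map_neg]
      exact F.of_congr (by omega) (neg_sub _ _).symm _ (neg_mem (F.comm_mem hb ha))

theorem bracketHom_self (x : F.Gr) : F.bracketHom x x = 0 := by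
  induction x using Gr.induction with
  | zero => simp
  | add x y hx hy =>
    rw [map_add, map_add, AddMonoidHom.add_apply, AddMonoidHom.add_apply, hx, hy,
      F.bracketHom_antisymm y x]
    abel
  | of i a ha =>
    rw [bracketHom_of]
    exact (F.of_cls_congr (sub_self _) (Or.inr (sub_self _)) _ (zero_mem (F.fil 0))).trans
      ((F.of 0).map_zero)

theorem bracketHom_leibniz (x y z : F.Gr) :
    F.bracketHom x (y * z) = F.bracketHom x y * z + y * F.bracketHom x z := by
  induction x using Gr.induction with
  | zero => simp
  | add x x' hx hx' => simp only [map_add, AddMonoidHom.add_apply, hx, hx']; ring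
  | of i a ha =>
    induction y using Gr.induction with
    | zero => simp
    | add y y' hy hy' => simp only [map_add, add_mul, hy, hy']; ring
    | of j b hb =>
      induction z using Gr.induction with
      | zero => simp
      | add z z' hz hz' => simp only [map_add, mul_add, hz, hz']; ring
      | of l c hc =>
        have h1 : (a * b - b * a) * c ∈ F.fil (i + (j + l) - 1) := by
          by_cases h0 : i + j = 0
          · rw [F.comm_eq_zero h0 ha hb, zero_mul]; exact zero_mem _
          · have h := F.mul_mem (F.comm_mem ha hb) hc
            rwa [show i + j - 1 + l = i + (j + l) - 1 by omega] at h
        have h2 : b * (a * c - c * a) ∈ F.fil (i + (j + l) - 1) := by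
          by_cases h0 : i + l = 0
          · rw [F.comm_eq_zero h0 ha hc, mul_zero]; exact zero_mem _
          · have h := F.mul_mem hb (F.comm_mem ha hc)
            rwa [show j + (i + l - 1) = i + (j + l) - 1 by omega] at h
        rw [of_cls_mul, bracketHom_of, bracketHom_of, bracketHom_of, of_cls_mul, of_cls_mul]
        rw [F.of_cls_congr (i := i + j - 1 + l) rfl ?_ _ h1,
          F.of_cls_congr (i := j + (i + l - 1)) rfl ?_ _ h2, of_cls_add]
        · exact F.of_congr rfl (by noncomm_ring) _ _
        · by_cases h0 : i + l = 0
          · exact Or.inr (by rw [F.comm_eq_zero h0 ha hc, mul_zero])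
          · exact Or.inl (by omega)
        · by_cases h0 : i + j = 0
          · exact Or.inr (by rw [F.comm_eq_zero h0 ha hb, zero_mul])
          · exact Or.inl (by omega)

/-- The degrees of iterated brackets: the truncated subtraction is harmless, because an iterated
bracket vanishes when its degree would be negative. -/
theorem bracketHom_bracketHom_of {i j l : ℕ} {a b c : A} (ha : a ∈ F.fil i) (hb : b ∈ F.fil j)
    (hc : c ∈ F.fil l) : ∃ h : a * (b * c - c * b) - (b * c - c * b) * a ∈ F.fil (i + j + l - 2),
    F.bracketHom (F.of i (F.cls i a ha))
      (F.bracketHom (F.of j (F.cls j b hb)) (F.of l (F.cls l c hc))) =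
      F.of (i + j + l - 2) (F.cls _ (a * (b * c - c * b) - (b * c - c * b) * a) h) := by
  rw [bracketHom_of, bracketHom_of]
  by_cases h0 : j + l = 0
  · have h1 : a * (b * c - c * b) - (b * c - c * b) * a = 0 := by
      rw [F.comm_eq_zero h0 hb hc, mul_zero, zero_mul, sub_self]
    have h2 : a * (b * c - c * b) - (b * c - c * b) * a ∈ F.fil (i + j + l - 2) := by
      rw [h1]; exact zero_mem _
    exact ⟨h2, F.of_cls_congr rfl (Or.inr h1) _ _⟩
  · have he : i + (j + l - 1) - 1 = i + j + l - 2 := by omega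
    exact ⟨he ▸ F.comm_mem ha (F.comm_mem hb hc), F.of_cls_congr rfl (Or.inl he) _ _⟩

theorem bracketHom_jacobi (x y z : F.Gr) : F.bracketHom x (F.bracketHom y z) =
    F.bracketHom (F.bracketHom x y) z + F.bracketHom y (F.bracketHom x z) := by
  induction x using Gr.induction with
  | zero => simp
  | add x x' hx hx' =>
    simp only [map_add, AddMonoidHom.add_apply, hx, hx']; abel
  | of i a ha =>
    induction y using Gr.induction with
    | zero => simp
    | add y y' hy hy' => simp only [map_add, AddMonoidHom.add_apply, hy, hy']; abel
    | of j b hb =>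
      induction z using Gr.induction with
      | zero => simp
      | add z z' hz hz' => simp only [map_add, hz, hz']; abel
      | of l c hc =>
        rw [F.bracketHom_antisymm (F.bracketHom _ _)]
        obtain ⟨h1, e1⟩ := F.bracketHom_bracketHom_of ha hb hc
        obtain ⟨h2, e2⟩ := F.bracketHom_bracketHom_of hc ha hb
        obtain ⟨h3, e3⟩ := F.bracketHom_bracketHom_of hb ha hc
        rw [e1, e2, e3, ← map_neg]
        have h2' : -(c * (a * b - b * a) - (a * b - b * a) * c) ∈ F.fil (i + j + l - 2) := by
          rw [show i + j + l - 2 = l + i + j - 2 by omega]; exact neg_mem h2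
        have h3' : b * (a * c - c * a) - (a * c - c * a) * b ∈ F.fil (i + j + l - 2) := by
          rw [show i + j + l - 2 = j + i + l - 2 by omega]; exact h3
        refine Eq.trans ?_ (congrArg₂ (· + ·)
          (F.of_congr (i := i + j + l - 2) (j := l + i + j - 2) (by omega) rfl h2' (neg_mem h2))
          (F.of_congr (i := i + j + l - 2) (j := j + i + l - 2) (by omega) rfl h3' h3))
        refine Eq.trans ?_ (F.of_cls_add h2' h3').symm
        exact F.of_congr rfl (by noncomm_ring) _ _

theorem bracketHom_smul_right (c : k) (x y : F.Gr) :
    F.bracketHom x (c • y) = c • F.bracketHom x y := by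
  induction x using Gr.induction with
  | zero => simp
  | add x x' hx hx' =>
    rw [map_add, AddMonoidHom.add_apply, hx, hx', AddMonoidHom.add_apply, smul_add]
  | of i a ha =>
    induction y using Gr.induction with
    | zero => simp
    | add y y' hy hy' => rw [smul_add, map_add, hy, hy', map_add, smul_add]
    | of j b hb =>
      rw [smul_of_cls, bracketHom_of, bracketHom_of, smul_of_cls]
      exact F.of_congr rfl (by rw [mul_smul_comm, smul_mul_assoc, smul_sub]) _ _

/-- A left ideal is closed under commutators, so its graded ideal is closed under brackets. -/
theorem bracketHom_mem_grSub {I : Ideal A} {x y : F.Gr}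
    (hx : x ∈ F.grSub (I.restrictScalars k)) (hy : y ∈ F.grSub (I.restrictScalars k)) :
    F.bracketHom x y ∈ F.grSub (I.restrictScalars k) := by
  refine F.grSub_induction (p := fun x => F.bracketHom x y ∈ F.grSub (I.restrictScalars k)) hx
    ?_ ?_ ?_
  · rw [map_zero]; exact zero_mem _
  · intro i a ha haI
    refine F.grSub_induction (p := fun y => F.bracketHom _ y ∈ F.grSub (I.restrictScalars k)) hy
      ?_ ?_ ?_
    · rw [map_zero]; exact zero_mem _
    · intro j b hb hbI
      rw [bracketHom_of]
      exact F.of_mem_grSub _ (sub_mem (I.mul_mem_left a hbI) (I.mul_mem_left b haI))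
    · intro y y' hy hy'
      rw [map_add]; exact add_mem hy hy'
  · intro x x' hx hx'
    rw [map_add]; exact add_mem hx hx'

end Bracket

section BracketTopology

variable [F.IsCommutative] [IsTopologicalChiralAlgebra A]

theorem exists_grIdeal {U : Set F.Gr} (hU : U ∈ 𝓝 0) : ∃ I : Ideal A, IsOpen (I : Set A) ∧
    (F.grSub (I.restrictScalars k) : Set F.Gr) ⊆ U := by
  obtain ⟨P, -, hP⟩ := (basis_hasBasis F.gr_basis).mem_iff.1 hU
  obtain ⟨I, hI, hIP⟩ := exists_open_leftIdeal (P.2.mem_nhds (zero_mem P.1))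
  exact ⟨I, hI, fun x hx => hP (F.grSub_mono hIP hx)⟩

theorem grSub_mem_nhds {P : Submodule k A} (hP : IsOpen (P : Set A)) :
    (F.grSub P : Set F.Gr) ∈ 𝓝 0 :=
  (basis_hasBasis F.gr_basis).mem_of_mem (i := ⟨P, hP⟩) trivial

theorem continuous_bracketHom_right (x : F.Gr) : Continuous (F.bracketHom x) := by
  induction x using Gr.induction with
  | zero => rw [map_zero]; exact continuous_const
  | add x x' hx hx' => rw [map_add]; exact hx.add hx'
  | of i a ha =>
    refine continuous_of_continuousAt_zero _ ?_
    rw [ContinuousAt, map_zero, Filter.tendsto_def]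
    intro U hU
    obtain ⟨I, hI, hIU⟩ := F.exists_grIdeal hU
    let P : Submodule k A :=
      I.restrictScalars k ⊓ (I.restrictScalars k).comap (LinearMap.mulRight k a)
    have hP : IsOpen (P : Set A) := hI.inter (hI.preimage (continuous_mul_const a))
    refine Filter.mem_of_superset (F.grSub_mem_nhds hP) fun y hy => hIU ?_
    refine F.grSub_induction (p := fun y => F.bracketHom _ y ∈ F.grSub (I.restrictScalars k)) hy
      ?_ ?_ ?_
    · rw [map_zero]; exact zero_mem _
    · intro j b hb hbP
      rw [bracketHom_of]
      exact F.of_mem_grSub _ (sub_mem (I.mul_mem_left a hbP.1) hbP.2)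
    · intro y y' hy hy'
      rw [map_add]; exact add_mem hy hy'

theorem continuous_bracketHom : Continuous fun p : F.Gr × F.Gr => F.bracketHom p.1 p.2 := by
  refine continuous_of_biadditive _ ?_ F.continuous_bracketHom_right fun y => ?_
  · rw [Filter.tendsto_def]
    intro U hU
    obtain ⟨I, hI, hIU⟩ := F.exists_grIdeal hU
    have h := F.grSub_mem_nhds (P := I.restrictScalars k) hI
    exact Filter.mem_of_superset (Filter.prod_mem_prod h h) fun p hp =>
      hIU (F.bracketHom_mem_grSub hp.1 hp.2)
  · have h : (fun x => F.bracketHom x y) = fun x => -F.bracketHom y x :=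
      funext fun x => F.bracketHom_antisymm x y
    rw [h]
    exact (F.continuous_bracketHom_right y).neg

/-- The bracket of the completed graded algebra, as the continuous extension of the Poisson bracket
of the graded algebra. -/
noncomputable def hatBracketFun (x y : F.GrHat) : F.GrHat :=
  ((Completion.isDenseInducing_coe (α := F.Gr)).prodMap Completion.isDenseInducing_coe).extend
    (fun p : F.Gr × F.Gr => (F.bracketHom p.1 p.2 : F.GrHat)) (x, y)

theorem continuous_hatBracketFun :
    Continuous fun p : F.GrHat × F.GrHat => F.hatBracketFun p.1 p.2 := by
  let m : F.Gr →+ F.Gr →+ F.GrHat := F.bracketHom.compr₂ Completion.toCompl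
  have h : Continuous fun p : F.Gr × F.Gr => m p.1 p.2 :=
    (Completion.continuous_coe F.Gr).comp F.continuous_bracketHom
  have di : IsDenseInducing (Completion.toCompl : F.Gr →+ F.GrHat) :=
    Completion.isDenseInducing_coe
  exact (di.extend_Z_bilin di h :)

theorem hatBracketFun_coe (x y : F.Gr) :
    F.hatBracketFun (x : F.GrHat) (y : F.GrHat) = (F.bracketHom x y : F.Gr) :=
  ((Completion.isDenseInducing_coe (α := F.Gr)).prodMap
    Completion.isDenseInducing_coe).extend_eq
      ((Completion.continuous_coe F.Gr).comp F.continuous_bracketHom) (x, y)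

theorem continuous_hatBracketFun_comp {X : Type*} [TopologicalSpace X] {f g : X → F.GrHat}
    (hf : Continuous f) (hg : Continuous g) : Continuous fun x => F.hatBracketFun (f x) (g x) :=
  F.continuous_hatBracketFun.comp (hf.prodMk hg)

theorem hatBracketFun_self (x : F.GrHat) : F.hatBracketFun x x = 0 := by
  induction x using Completion.induction_on with
  | hp =>
    exact isClosed_eq (F.continuous_hatBracketFun_comp (f := fun x => x) (g := fun x => x)
      continuous_id continuous_id) continuous_const
  | ih x => rw [hatBracketFun_coe, bracketHom_self, Completion.coe_zero]

theorem hatBracketFun_add_right (x y z : F.GrHat) :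
    F.hatBracketFun x (y + z) = F.hatBracketFun x y + F.hatBracketFun x z := by
  induction x, y, z using Completion.induction_on₃ with
  | hp =>
    refine isClosed_eq (F.continuous_hatBracketFun_comp ?_ ?_)
      ((F.continuous_hatBracketFun_comp ?_ ?_).add (F.continuous_hatBracketFun_comp ?_ ?_)) <;>
      fun_prop
  | ih x y z =>
    rw [← Completion.coe_add, hatBracketFun_coe, hatBracketFun_coe, hatBracketFun_coe, map_add,
      Completion.coe_add]

theorem hatBracketFun_antisymm (x y : F.GrHat) :
    F.hatBracketFun x y = -F.hatBracketFun y x := by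
  induction x, y using Completion.induction_on₂ with
  | hp =>
    refine isClosed_eq (F.continuous_hatBracketFun_comp ?_ ?_)
      (F.continuous_hatBracketFun_comp ?_ ?_).neg <;> fun_prop
  | ih x y =>
    rw [hatBracketFun_coe, hatBracketFun_coe, bracketHom_antisymm, Completion.coe_neg]

theorem hatBracketFun_smul_right (c : k) (x y : F.GrHat) :
    F.hatBracketFun x (c • y) = c • F.hatBracketFun x y := by
  induction x, y using Completion.induction_on₂ with
  | hp =>
    refine isClosed_eq (F.continuous_hatBracketFun_comp continuous_fst
      (continuous_snd.const_smul c))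
      ((F.continuous_hatBracketFun_comp continuous_fst continuous_snd).const_smul c)
  | ih x y =>
    rw [← Completion.coe_smul, hatBracketFun_coe, hatBracketFun_coe, bracketHom_smul_right,
      Completion.coe_smul]

theorem hatBracketFun_leibniz (x y z : F.GrHat) :
    F.hatBracketFun x (y * z) = F.hatBracketFun x y * z + y * F.hatBracketFun x z := by
  induction x, y, z using Completion.induction_on₃ with
  | hp =>
    refine isClosed_eq (F.continuous_hatBracketFun_comp ?_ ?_)
      (((F.continuous_hatBracketFun_comp ?_ ?_).mul ?_).add
        (Continuous.mul ?_ (F.continuous_hatBracketFun_comp ?_ ?_))) <;>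
      fun_prop
  | ih x y z =>
    rw [← Completion.coe_mul, hatBracketFun_coe, hatBracketFun_coe, hatBracketFun_coe,
      bracketHom_leibniz, Completion.coe_add, Completion.coe_mul, Completion.coe_mul]

theorem hatBracketFun_jacobi (x y z : F.GrHat) : F.hatBracketFun x (F.hatBracketFun y z) =
    F.hatBracketFun (F.hatBracketFun x y) z + F.hatBracketFun y (F.hatBracketFun x z) := by
  induction x, y, z using Completion.induction_on₃ with
  | hp =>
    refine isClosed_eq (F.continuous_hatBracketFun_comp ?_ (F.continuous_hatBracketFun_comp ?_ ?_))
      ((F.continuous_hatBracketFun_comp (F.continuous_hatBracketFun_comp ?_ ?_) ?_).add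
        (F.continuous_hatBracketFun_comp ?_ (F.continuous_hatBracketFun_comp ?_ ?_))) <;>
      fun_prop
  | ih x y z =>
    simp only [hatBracketFun_coe]
    rw [bracketHom_jacobi, Completion.coe_add]

/-- The coisson structure of the completed graded algebra of a commutative filtration. -/
noncomputable def coissonStructure : CoissonStructure k F.GrHat where
  bracket := LinearMap.mk₂ k F.hatBracketFun
    (fun x x' y => by
      rw [hatBracketFun_antisymm, hatBracketFun_add_right, neg_add, ← hatBracketFun_antisymm,
        ← hatBracketFun_antisymm])
    (fun c x y => by
      rw [hatBracketFun_antisymm, hatBracketFun_smul_right, ← smul_neg, ← hatBracketFun_antisymm])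
    F.hatBracketFun_add_right
    F.hatBracketFun_smul_right
  bracket_self := F.hatBracketFun_self
  jacobi := F.hatBracketFun_jacobi
  leibniz := F.hatBracketFun_leibniz
  continuous_bracket := F.continuous_hatBracketFun
  exists_ideal U hU := by
    let J (I : Ideal A) : Ideal F.Gr :=
      { F.grSub (I.restrictScalars k) with
        smul_mem' := fun x y hy =>
          F.mul_mem_grSub (P := I.restrictScalars k) (fun a b hb => I.mul_mem_left a hb) x hy }
    obtain ⟨I, hIU⟩ := exists_closureIdeal_subset
      (I := fun I : {I : Ideal A // IsOpen (I : Set A)} => J I.1) (fun V hV => by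
        obtain ⟨I, hI, hIV⟩ := F.exists_grIdeal hV
        exact ⟨⟨I, hI⟩, hIV⟩) hU
    refine ⟨closureIdeal (J I.1), isOpen_closureIdeal ?_, hIU, fun x hx y hy => ?_⟩
    · exact AddSubgroup.isOpen_of_mem_nhds (F.grSub (I.1.restrictScalars k))
        (F.grSub_mem_nhds I.2)
    · refine map_mem_closure₂ (f := F.hatBracketFun) F.continuous_hatBracketFun hx hy ?_
      rintro _ ⟨x, hx, rfl⟩ _ ⟨y, hy, rfl⟩
      exact ⟨_, F.bracketHom_mem_grSub hx hy, (F.hatBracketFun_coe x y).symm⟩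

theorem coissonStructure_extendsGr : F.coissonStructure.ExtendsGr := by
  intro i j a b ha hb hab
  refine (F.hatBracketFun_coe _ _).trans ?_
  rw [bracketHom_of]
  rfl

end BracketTopology

end ChiralFiltration

/-- Two coisson structures with the same bracket are equal. -/
theorem CoissonStructure.ext_bracket {k S : Type*} [Field k] [CommRing S] [Algebra k S]
    [TopologicalSpace S] {c d : CoissonStructure k S}
    (h : ∀ x y, c.bracket x y = d.bracket x y) : c = d := by
  have hb : c.bracket = d.bracket := LinearMap.ext₂ h
  cases c
  cases d
  congr

theorem CoissonStructure.antisymm {k S : Type*} [Field k] [CommRing S] [Algebra k S]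
    [TopologicalSpace S] (c : CoissonStructure k S) (x y : S) :
    c.bracket x y = -c.bracket y x := by
  have h := c.bracket_self (x + y)
  rw [map_add, map_add, LinearMap.add_apply, LinearMap.add_apply, c.bracket_self, c.bracket_self,
    zero_add, add_zero, add_comm] at h
  exact eq_neg_of_add_eq_zero_left h

theorem CoissonStructure.bracket_algebraMap {k S : Type*} [Field k] [CommRing S] [Algebra k S]
    [TopologicalSpace S] (c : CoissonStructure k S) (x : S) (r : k) :
    c.bracket x (algebraMap k S r) = 0 := by
  have h := c.leibniz x 1 1
  rw [mul_one, mul_one, one_mul] at h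
  rw [Algebra.algebraMap_eq_smul_one, map_smul, left_eq_add.1 h, smul_zero]

/-- A coisson structure on the completed graded algebra is determined by the brackets of classes. -/
theorem CoissonStructure.ExtendsGr.unique {k A : Type*} [Field k] [Ring A] [Algebra k A]
    [UniformSpace A] [IsTopologicalChiralAlgebra A] {F : ChiralFiltration k A} [F.IsCommutative]
    {c d : CoissonStructure k F.GrHat} (hc : c.ExtendsGr) (hd : d.ExtendsGr) : c = d := by
  refine CoissonStructure.ext_bracket fun x y => ?_
  induction x, y using Completion.induction_on₂ with
  | hp => exact isClosed_eq c.continuous_bracket d.continuous_bracket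
  | ih x y =>
    induction x using ChiralFiltration.Gr.induction with
    | zero => simp only [Completion.coe_zero, map_zero, LinearMap.zero_apply]
    | add x x' hx hx' => simp only [Completion.coe_add, map_add, LinearMap.add_apply, hx, hx']
    | of i a ha =>
      induction y using ChiralFiltration.Gr.induction with
      | zero => simp only [Completion.coe_zero, map_zero]
      | add y y' hy hy' => simp only [Completion.coe_add, map_add, hy, hy']
      | of j b hb =>
        exact (hc i j a b ha hb (F.comm_mem ha hb)).trans (hd i j a b ha hb (F.comm_mem ha hb)).symm

/-- A coisson structure on `Sym^! L` is determined by its values on `L`. -/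
theorem CoissonStructure.ExtendsLie.unique {k L : Type*} [Field k] [TopologicalSpace k]
    [LieRing L] [LieAlgebra k L] [TopologicalSpace L] {c d : CoissonStructure k (SymShriek k L)}
    (hc : c.ExtendsLie) (hd : d.ExtendsLie) : c = d := by
  have coe_algebraMap : ∀ r : k, ((algebraMap k (SymAlg k L) r : SymAlg k L) : SymShriek k L) =
      algebraMap k (SymShriek k L) r := fun r => rfl
  have key : ∀ x : SymShriek k L, ∀ S : SymAlg k L,
      (∀ l : L, c.bracket x (SymShriek.ι k L l) = d.bracket x (SymShriek.ι k L l)) →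
      c.bracket x S = d.bracket x S := by
    intro x S h
    induction S using SymAlg.induction with
    | algebraMap r => rw [coe_algebraMap, c.bracket_algebraMap, d.bracket_algebraMap]
    | ι l => exact h l
    | mul y z hy hz => rw [Completion.coe_mul, c.leibniz, d.leibniz, hy, hz]
    | add y z hy hz => rw [Completion.coe_add, map_add, map_add, hy, hz]
  refine CoissonStructure.ext_bracket fun x y => ?_
  induction x, y using Completion.induction_on₂ with
  | hp => exact isClosed_eq c.continuous_bracket d.continuous_bracket
  | ih x y =>
    refine key _ y fun l => ?_
    rw [c.antisymm, d.antisymm]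
    refine congrArg _ (key _ x fun l' => ?_)
    rw [hc, hd]

/-- Transport of a coisson structure along an isomorphism of topological algebras. -/
def CoissonStructure.transport {k S T : Type*} [Field k] [CommRing S] [Algebra k S]
    [TopologicalSpace S] [CommRing T] [Algebra k T] [TopologicalSpace T]
    (e : S ≃ₐ[k] T) (he : Continuous e) (he' : Continuous e.symm) (d : CoissonStructure k T) :
    CoissonStructure k S where
  bracket := LinearMap.mk₂ k (fun x y => e.symm (d.bracket (e x) (e y)))
    (fun x x' y => by simp only [map_add, LinearMap.add_apply])
    (fun c x y => by simp only [map_smul, LinearMap.smul_apply])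
    (fun x y y' => by simp only [map_add])
    (fun c x y => by simp only [map_smul])
  bracket_self x := by
    rw [LinearMap.mk₂_apply, d.bracket_self, map_zero]
  jacobi x y z := by
    simp only [LinearMap.mk₂_apply, AlgEquiv.apply_symm_apply]
    rw [d.jacobi, map_add]
  leibniz x y z := by
    simp only [LinearMap.mk₂_apply, map_mul]
    rw [d.leibniz, map_add, map_mul, map_mul, AlgEquiv.symm_apply_apply, AlgEquiv.symm_apply_apply]
  continuous_bracket :=
    he'.comp (d.continuous_bracket.comp ((he.comp continuous_fst).prodMk (he.comp continuous_snd)))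
  exists_ideal U hU := by
    have hU' : e.symm ⁻¹' U ∈ 𝓝 (0 : T) :=
      he'.continuousAt.preimage_mem_nhds (by rwa [map_zero])
    obtain ⟨I, hI, hIU, hb⟩ := d.exists_ideal _ hU'
    refine ⟨I.comap e, hI.preimage he, fun x hx => ?_, fun x hx y hy => ?_⟩
    · have h := hIU hx
      rwa [Set.mem_preimage, AlgEquiv.symm_apply_apply] at h
    · have h := hb _ hx _ hy
      change e (e.symm (d.bracket (e x) (e y))) ∈ I
      rwa [AlgEquiv.apply_symm_apply]

section SymCoisson

variable {k : Type u} {L : Type v} [Field k] [TopologicalSpace k] [DiscreteTopology k]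
  [LieRing L] [LieAlgebra k L] [TopologicalSpace L] [IsTopologicalAddGroup L]
  [IsTopologicalLieStarAlgebra k L]

variable (k L) in
/-- The isomorphism of topological algebras between `Sym^! L` and the completed graded algebra. -/
noncomputable def symEquivGr : SymShriek k L ≃ₐ[k] (stdFiltration k L).GrHat :=
  AlgEquiv.ofBijective (symToGr k L) symToGr_isHomeomorph.bijective

variable (k L) in
/-- The coisson structure of `Sym^! L`. -/
noncomputable def symCoisson : CoissonStructure k (SymShriek k L) :=
  (stdFiltration k L).coissonStructure.transport (symEquivGr k L) symToGr_isHomeomorph.continuous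
    ((symToGr_isHomeomorph (k := k) (L := L)).homeomorph).symm.continuous

theorem symToGr_symCoisson (x y : SymShriek k L) : symToGr k L ((symCoisson k L).bracket x y) =
    (stdFiltration k L).coissonStructure.bracket (symToGr k L x) (symToGr k L y) :=
  (symEquivGr k L).apply_symm_apply _

theorem symCoisson_extendsLie : (symCoisson k L).ExtendsLie := by
  intro x y
  apply symToGr_isHomeomorph.injective
  have hι : ∀ x, symToGr k L (SymShriek.ι k L x) =
      (stdFiltration k L).symb 1 (ChiralEnv.ι k L x) (ChiralEnv.ι_mem k L x) :=
    fun x => SymShriek.lift_ι _ _ _ x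
  have hmem : ChiralEnv.ι k L x * ChiralEnv.ι k L y - ChiralEnv.ι k L y * ChiralEnv.ι k L x ∈
      (stdFiltration k L).fil (1 + 1 - 1) := by
    rw [← ChiralEnv.ι_lie]; exact ChiralEnv.ι_mem k L _
  rw [symToGr_symCoisson, hι, hι, hι,
    (stdFiltration k L).coissonStructure_extendsGr 1 1 _ _ _ _ hmem]
  exact congrArg _ ((stdFiltration k L).of_congr rfl (ChiralEnv.ι_lie x y).symm _ _)

end SymCoisson

end TopAlg

theorem mainTheorem5 {k : Type u} {L : Type v} [Field k] [TopologicalSpace k] [DiscreteTopology k]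
    [LieRing L] [LieAlgebra k L] [UniformSpace L] [IsUniformAddGroup L] [CompleteSpace L]
    [T2Space L] [IsTopologicalLieStarAlgebra k L] :
    (Continuous (ChiralEnv.ι k L) ∧
      (∀ x y : L, ChiralEnv.ι k L ⁅x, y⁆ =
        ChiralEnv.ι k L x * ChiralEnv.ι k L y - ChiralEnv.ι k L y * ChiralEnv.ι k L x) ∧
      ∀ (B : Type w) [Ring B] [Algebra k B] [UniformSpace B] [IsTopologicalChiralAlgebra B]
        (f : L →ₗ[k] B), Continuous f → (∀ x y : L, f ⁅x, y⁆ = f x * f y - f y * f x) →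
        ∃! g : ChiralEnv k L →ₐ[k] B, Continuous g ∧ ∀ x, g (ChiralEnv.ι k L x) = f x) ∧
    (stdFiltration k L).IsStrongPBW ∧
    IsHomeomorph (symToGr k L) ∧
    (∃! c : CoissonStructure k (SymShriek k L), c.ExtendsLie) ∧
    (∃! c : CoissonStructure k (stdFiltration k L).GrHat, c.ExtendsGr) ∧
    ∀ (c : CoissonStructure k (SymShriek k L)) (d : CoissonStructure k (stdFiltration k L).GrHat),
      c.ExtendsLie → d.ExtendsGr → ∀ x y : SymShriek k L,
        symToGr k L (c.bracket x y) = d.bracket (symToGr k L x) (symToGr k L y) := by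
  refine ⟨⟨ChiralEnv.continuous_ι k L, ChiralEnv.ι_lie, fun B _ _ _ _ f hf hlie =>
    ChiralEnv.existsUnique_lift f hf hlie⟩, ⟨stdFiltration_isAdmissible, pbwMap_isHomeomorph⟩,
    symToGr_isHomeomorph, ⟨symCoisson k L, symCoisson_extendsLie, fun c hc =>
      hc.unique symCoisson_extendsLie⟩, ⟨(stdFiltration k L).coissonStructure,
      (stdFiltration k L).coissonStructure_extendsGr, fun c hc =>
      hc.unique (stdFiltration k L).coissonStructure_extendsGr⟩, fun c d hc hd x y => ?_⟩
  rw [hc.unique symCoisson_extendsLie, hd.unique (stdFiltration k L).coissonStructure_extendsGr]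
  exact symToGr_symCoisson x y
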